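/- Let $G$ be a finite abelian group acting on $\mathbb{C}^n$ through a faithful representation $G\hookrightarrow \mathrm{GL}_n(\mathbb{C})$. Put $R=\mathbb{C}[x_1,\dots,x_n]$ with the action $(g.f)(v)=f(g^{-1}v)$, $X=\operatorname{Spec} R^G$, $q:\mathbb{C}^n\to X$ the quotient map, $K(\mathbb{C}^n)=\operatorname{Frac} R$, and $G^\vee=\operatorname{Hom}(G,\mathbb{C}^*)$. For $\chi\in G^\vee$, a function $f\in K(\mathbb{C}^n)$ is called homogeneous of weight $\chi$ if $g.f=\chi(g^{-1})f$ for all $g\in G$. Let $\pi:Y\to X$ be a resolution: $Y$ is integral and smooth over $\mathbb{C}$, and $\pi$ is proper and birational. Via $\pi$, identify $K(Y)$ with $K(\mathbb{C}^n)^G$, and regard $K(\mathbb{C}^n)$ as a constant sheaf of $\mathcal{O}_Y$-modules on $Y$. For a prime Weil divisor $P$ on $Y$ and a nonzero homogeneous $f\in K(\mathbb{C}^n)$ set $v_P(f)=\frac{1}{|G|}v_P(f^{|G|})\in\mathbb{Q}$, where $f^{|G|}\in K(Y)$. For $\chi\in G^\vee$ let $v(P,\chi)\in[0,1)$ be the fractional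 part of $v_P(f)$ for any nonzero homogeneous $f$ of weight $\chi$, and put $C_\chi=\sum_P v(P,\chi)P$. For a $\mathbb{Q}$-Weil divisor $D$ of weight $\lambda\in G^\vee$, let $\mathcal{L}(D)\subset K(\mathbb{C}^n)$ be the sub-$\mathcal{O}_Y$-module generated locally by the inverses of the local equations of $D$; a local equation of $D$ on an open set $V$ is a nonzero homogeneous function $f$ of weight $\lambda$ such that $v_P(f)$ is the coefficient of $D$ at $P$ for all prime divisors $P$ meeting $V$. The canonical family on $Y$ is $$\bigoplus_{\chi\in G^\vee}\mathcal{L}(-C_\chi)\subset K(\mathbb{C}^n),$$ where $-C_\chi$ has weight $\chi^{-1}$, with the actions of $R$ and $G$ inherited from $K(\mathbb{C}^n)$. **Proposition 3.8.** The reduced fibre product $(Y\times_X\mathbb{C}^n)_{\mathrm{red}}$ is integral. Let $N$ be its normalisation, with the induced $G$-action. Then the pushforward of $\mathcal{O}_N$ to $Y$ is isomorphic to the canonical family as a sheaf of $(R\rtimes G)\otimes_{\mathbb{C}}\mathcal{O}_Y$-modules, that is, by an isomorphism of $\mathcal{O}_Y$-modules which is $R$-linear and $G$-equivariant. In particular,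 the canonical family is stable under $R$ and $G$. -/

import Mathlib

open CategoryTheory CategoryTheory.Limits AlgebraicGeometry TopologicalSpace Opposite

noncomputable section

namespace GConst

/-! ### Reduction and normalisation of schemes -/

section Schemes

/-- The reduced closed subscheme `Z_red` of a scheme `Z`, cut out by the nilradical. -/
abbrev reduction (Z : Scheme.{0}) : Scheme.{0} := Z.nilradical.subscheme

/-- The closed immersion `Z_red ⟶ Z`. -/
def reductionι (Z : Scheme.{0}) : reduction Z ⟶ Z := Z.nilradical.subschemeι

instance (Z : Scheme.{0}) : IsClosedImmersion (reductionι Z) :=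
  inferInstanceAs (IsClosedImmersion Z.nilradical.subschemeι)

lemma nilradical_le_ker {Z W : Scheme.{0}} [IsReduced Z] (f : Z ⟶ W) [QuasiCompact f] :
    W.nilradical ≤ f.ker := by
  intro U x hx
  rw [Scheme.Hom.ker_apply, RingHom.mem_ker]
  obtain ⟨k, hk⟩ := hx
  have h0 : x ^ k = 0 := by simpa using hk
  have : IsNilpotent ((f.app U).hom x) := ⟨k, by rw [← map_pow, h0, map_zero]⟩
  exact this.eq_zero

/-- A morphism `Z ⟶ W` with `Z_red` reduced induces `Z_red ⟶ W_red`. -/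
def reductionMap {Z W : Scheme.{0}} [IsReduced (reduction Z)] (f : Z ⟶ W) [QuasiCompact f] :
    reduction Z ⟶ reduction W :=
  IsClosedImmersion.lift (reductionι W) (reductionι Z ≫ f) (by
    have : (reductionι W).ker = W.nilradical := Scheme.IdealSheafData.ker_subschemeι _
    rw [this]
    exact nilradical_le_ker _)

lemma reductionMap_ι {Z W : Scheme.{0}} [IsReduced (reduction Z)] (f : Z ⟶ W) [QuasiCompact f] :
    reductionMap f ≫ reductionι W = reductionι Z ≫ f :=
  IsClosedImmersion.lift_fac _ _ _

instance {Z W : Scheme.{0}} [IsReduced (reduction Z)] [IsReduced (reduction W)]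
    (f : Z ⟶ W) [IsIso f] : IsIso (reductionMap f) := by
  refine ⟨reductionMap (inv f), ?_, ?_⟩
  · rw [← cancel_mono (reductionι Z)]
    simp [reductionMap_ι, reassoc_of% reductionMap_ι]
  · rw [← cancel_mono (reductionι W)]
    simp [reductionMap_ι, reassoc_of% reductionMap_ι]

/-- The inclusion `Spec K(Z) ⟶ Z` of the generic point of an integral scheme. -/
def genericInclusion (Z : Scheme.{0}) [IsIntegral Z] : Spec Z.functionField ⟶ Z :=
  Z.fromSpecStalk (genericPoint Z)

instance (Z : Scheme.{0}) [IsIntegral Z] : QuasiCompact (genericInclusion Z) where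
  isCompact_preimage _ _ _ := (Set.toFinite _).isCompact

instance (Z : Scheme.{0}) [IsIntegral Z] : QuasiSeparated (genericInclusion Z) :=
  inferInstance

/-- The normalisation of an integral scheme `Z`, i.e. the normalisation of `Z` in its function
field. -/
abbrev normalisation (Z : Scheme.{0}) [IsIntegral Z] : Scheme.{0} :=
  (genericInclusion Z).normalization

/-- The (integral) normalisation morphism. -/
def normalisationπ (Z : Scheme.{0}) [IsIntegral Z] : normalisation Z ⟶ Z :=
  (genericInclusion Z).fromNormalization

instance (Z : Scheme.{0}) [IsIntegral Z] : IsIntegralHom (normalisationπ Z) :=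
  inferInstanceAs (IsIntegralHom (genericInclusion Z).fromNormalization)

lemma map_genericPoint_of_isIso {Z W : Scheme.{0}} [IsIntegral Z] [IsIntegral W] (f : Z ⟶ W)
    [IsIso f] : f (genericPoint Z) = genericPoint W :=
  genericPoint_eq_of_isOpenImmersion f

/-- The morphism of generic points induced by an isomorphism of integral schemes. -/
def genericMap {Z W : Scheme.{0}} [IsIntegral Z] [IsIntegral W] (f : Z ⟶ W) [IsIso f] :
    Spec Z.functionField ⟶ Spec W.functionField :=
  Spec.map (f.stalkMap (genericPoint Z)) ≫
    Spec.map (W.presheaf.stalkSpecializes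
      (specializes_of_eq (map_genericPoint_of_isIso f)))

lemma genericMap_comp {Z W : Scheme.{0}} [IsIntegral Z] [IsIntegral W] (f : Z ⟶ W) [IsIso f] :
    genericMap f ≫ genericInclusion W = genericInclusion Z ≫ f := by
  simp [genericMap, genericInclusion]

/-- The isomorphism `f` of integral schemes lifts to the normalisations. -/
def normalisationMap {Z W : Scheme.{0}} [IsIntegral Z] [IsIntegral W] (f : Z ⟶ W) [IsIso f] :
    normalisation Z ⟶ normalisation W :=
  (genericInclusion Z).normalizationDesc
    (genericMap f ≫ (genericInclusion W).toNormalization) (normalisationπ W ≫ inv f) (by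
      have h : (genericInclusion W).toNormalization ≫ normalisationπ W = genericInclusion W :=
        (genericInclusion W).toNormalization_fromNormalization
      rw [Category.assoc, reassoc_of% h, ← Category.assoc, genericMap_comp, Category.assoc,
        IsIso.hom_inv_id, Category.comp_id])

lemma normalisationMap_π {Z W : Scheme.{0}} [IsIntegral Z] [IsIntegral W] (f : Z ⟶ W) [IsIso f] :
    normalisationMap f ≫ normalisationπ W = normalisationπ Z ≫ f := by
  have h : normalisationMap f ≫ normalisationπ W ≫ inv f = normalisationπ Z :=
    (genericInclusion Z).normalizationDesc_comp _ _ _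
  rw [← h]; simp

end Schemes

/-! ### The linear action of `G` on `ℂⁿ` -/

section Action

variable {G : Type*} [CommGroup G] {n : ℕ} (ρ : G →* GL (Fin n) ℂ)

/-- The action of `g` on `R = ℂ[x₁, …, xₙ]`, `(g.f)(v) = f(g⁻¹ v)`. -/
def actHom (g : G) : MvPolynomial (Fin n) ℂ →ₐ[ℂ] MvPolynomial (Fin n) ℂ :=
  MvPolynomial.aeval fun i => ∑ j, MvPolynomial.C ((ρ g⁻¹).val i j) * MvPolynomial.X j

lemma eval_actHom (g : G) (f : MvPolynomial (Fin n) ℂ) (v : Fin n → ℂ) :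
    MvPolynomial.eval v (actHom ρ g f) = MvPolynomial.eval ((ρ g⁻¹).val.mulVec v) f := by
  induction f using MvPolynomial.induction_on with
  | C a => simp [actHom]
  | add p q hp hq => simp [hp, hq]
  | mul_X p i hp => simp [hp]; simp [actHom, Matrix.mulVec, dotProduct]

lemma actHom_mul (g h : G) (f : MvPolynomial (Fin n) ℂ) :
    actHom ρ (g * h) f = actHom ρ g (actHom ρ h f) := by
  apply MvPolynomial.funext
  intro v
  simp only [eval_actHom, Matrix.mulVec_mulVec, mul_inv_rev, map_mul, Units.val_mul]

lemma actHom_one (f : MvPolynomial (Fin n) ℂ) : actHom ρ 1 f = f := by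
  apply MvPolynomial.funext
  intro v
  simp [eval_actHom]

/-- The action of `g` on `R` as an automorphism. -/
def act (g : G) : MvPolynomial (Fin n) ℂ ≃+* MvPolynomial (Fin n) ℂ :=
  RingEquiv.ofRingHom (actHom ρ g).toRingHom (actHom ρ g⁻¹).toRingHom
    (RingHom.ext fun f => by
      change actHom ρ g (actHom ρ g⁻¹ f) = f
      rw [← actHom_mul, mul_inv_cancel, actHom_one])
    (RingHom.ext fun f => by
      change actHom ρ g⁻¹ (actHom ρ g f) = f
      rw [← actHom_mul, inv_mul_cancel, actHom_one])

/-- The ring `R^G` of invariant polynomials. -/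
def invariants : Subalgebra ℂ (MvPolynomial (Fin n) ℂ) :=
  ⨅ g : G, AlgHom.equalizer (actHom ρ g) (AlgHom.id ℂ _)

lemma mem_invariants (f : MvPolynomial (Fin n) ℂ) :
    f ∈ invariants ρ ↔ ∀ g, actHom ρ g f = f := by
  simp [invariants, Algebra.mem_iInf, AlgHom.mem_equalizer]

/-- Affine space `ℂⁿ = Spec R`. -/
abbrev affineSpace (n : ℕ) : Scheme.{0} := Spec (.of (MvPolynomial (Fin n) ℂ))

/-- The quotient `X = Spec R^G`. -/
abbrev quotient : Scheme.{0} := Spec (.of (invariants ρ))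

/-- The quotient map `q : ℂⁿ ⟶ X`. -/
def quotientMap : affineSpace n ⟶ quotient ρ :=
  Spec.map (CommRingCat.ofHom (invariants ρ).val.toRingHom)

/-- The structure morphism `X ⟶ Spec ℂ`. -/
def quotientStr : quotient ρ ⟶ Spec (.of ℂ) :=
  Spec.map (CommRingCat.ofHom (algebraMap ℂ (invariants ρ)))

/-- The automorphism of `ℂⁿ` along which functions are pulled back by `f ↦ g.f`
(on points it is `v ↦ g⁻¹ v`). -/
def spaceMap (g : G) : affineSpace n ⟶ affineSpace n :=
  Spec.map (act ρ g).toCommRingCatIso.hom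

instance (g : G) : IsIso (spaceMap ρ g) := by unfold spaceMap; infer_instance

lemma spaceMap_quotientMap (g : G) : spaceMap ρ g ≫ quotientMap ρ = quotientMap ρ := by
  unfold spaceMap quotientMap
  rw [← Spec.map_comp]
  congr 1
  apply CommRingCat.hom_ext
  refine RingHom.ext fun f => ?_
  exact (mem_invariants ρ f.1).1 f.2 g

/-- The function field `K(ℂⁿ)`. -/
abbrev K (n : ℕ) : Type := FractionRing (MvPolynomial (Fin n) ℂ)

/-- The action of `g` on `K(ℂⁿ)`. -/
def actK (g : G) : K n ≃+* K n := IsFractionRing.ringEquivOfRingEquiv (act ρ g)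

/-- A rational function is homogeneous of weight `χ ∈ G^∨` if `g.f = χ(g⁻¹) f` for all `g`. -/
def IsHomogeneous (χ : G →* ℂˣ) (f : K n) : Prop :=
  ∀ g : G, actK ρ g f = algebraMap ℂ (K n) ((χ g⁻¹ : ℂˣ) : ℂ) * f

/-- A resolution of `X = ℂⁿ/G`: a proper birational morphism `π : Y ⟶ X` with `Y` an integral
scheme which is smooth over `ℂ`. -/
structure Resolution where
  /-- the underlying scheme -/
  Y : Scheme.{0}
  /-- the morphism to the quotient -/
  π : Y ⟶ quotient ρ
  integral : IsIntegral Y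
  smooth : Smooth (π ≫ quotientStr ρ)
  proper : IsProper π
  birational : Scheme.BirationalOver π (𝟙 (quotient ρ))

end Action

namespace Resolution

variable {G : Type*} [CommGroup G] {n : ℕ} {ρ : G →* GL (Fin n) ℂ} (𝒴 : Resolution ρ)

instance : IsIntegral 𝒴.Y := 𝒴.integral

instance : IsLocallyNoetherian 𝒴.Y :=
  haveI := 𝒴.smooth
  LocallyOfFiniteType.isLocallyNoetherian (𝒴.π ≫ quotientStr ρ)

/-! ### The identification of `K(Y)` with a subfield of `K(ℂⁿ)` -/

/-- The map `R^G ⟶ K(Y)`, pulling back along `π`. -/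
def toFunctionField : invariants ρ →+* 𝒴.Y.functionField :=
  (𝒴.π.stalkMap (genericPoint 𝒴.Y)).hom.comp
    (StructureSheaf.toStalk (CommRingCat.of (invariants ρ)) (𝒴.π (genericPoint 𝒴.Y))).hom

lemma isOpenImmersion_aux : ∃ V : 𝒴.Y.Opens, genericPoint 𝒴.Y ∈ V ∧ IsOpenImmersion (V.ι ≫ 𝒴.π) := by
  obtain ⟨e, he⟩ := 𝒴.birational
  refine ⟨e.source, ?_, ?_⟩
  · refine ((genericPoint_spec 𝒴.Y).mem_open_set_iff e.source.isOpen).2 ?_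
    simpa using e.dense_source.nonempty
  · rw [← show _ = _ from he]
    simp only [Category.comp_id]
    infer_instance

lemma map_genericPoint : 𝒴.π (genericPoint 𝒴.Y) = genericPoint (quotient ρ) := by
  obtain ⟨V, hV, h⟩ := 𝒴.isOpenImmersion_aux
  have : Nonempty V := ⟨⟨_, hV⟩⟩
  rw [← genericPoint_eq_of_isOpenImmersion (V.ι ≫ 𝒴.π), ← genericPoint_eq_of_isOpenImmersion V.ι]
  rfl

lemma isIso_stalkMap : IsIso (𝒴.π.stalkMap (genericPoint 𝒴.Y)) := by
  obtain ⟨V, hV, h⟩ := 𝒴.isOpenImmersion_aux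
  let v : V.toScheme := ⟨_, hV⟩
  have h1 : IsIso ((V.ι ≫ 𝒴.π).stalkMap v) := inferInstance
  rw [Scheme.Hom.stalkMap_comp] at h1
  have h2 : IsIso (V.ι.stalkMap v) := inferInstance
  exact @IsIso.of_isIso_comp_right _ _ _ _ _ (𝒴.π.stalkMap (V.ι v)) (V.ι.stalkMap v) h2 h1

/-- As `π` is birational, `K(Y)` is the fraction field of `R^G`. -/
lemma isFractionRing : letI := 𝒴.toFunctionField.toAlgebra
    IsFractionRing (invariants ρ) 𝒴.Y.functionField := by
  let := 𝒴.toFunctionField.toAlgebra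
  have := 𝒴.isIso_stalkMap
  let x : quotient ρ := 𝒴.π (genericPoint 𝒴.Y)
  let p : PrimeSpectrum (invariants ρ) := x
  let : Algebra (invariants ρ) ((quotient ρ).presheaf.stalk x) :=
    StructureSheaf.stalkAlgebra (CommRingCat.of (invariants ρ)) x
  have h : IsLocalization.AtPrime ((quotient ρ).presheaf.stalk x) p.asIdeal :=
    StructureSheaf.IsLocalization.to_stalk (CommRingCat.of (invariants ρ)) x
  have hp : p.asIdeal = ⊥ := by
    have : p = ⊥ := 𝒴.map_genericPoint.trans (genericPoint_eq_bot_of_affine _)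
    rw [this]; rfl
  have hM : p.asIdeal.primeCompl = nonZeroDivisors (invariants ρ) := by
    ext y
    rw [Ideal.mem_primeCompl_iff, hp, mem_nonZeroDivisors_iff_ne_zero]; rfl
  unfold IsLocalization.AtPrime at h
  rw [hM] at h
  exact IsLocalization.isLocalization_of_algEquiv (nonZeroDivisors (invariants ρ))
    (AlgEquiv.ofRingEquiv (R := invariants ρ)
      (f := (asIso (𝒴.π.stalkMap (genericPoint 𝒴.Y))).commRingCatIsoToRingEquiv) (fun r => rfl))

/-- The inclusion `R^G ⊆ K(ℂⁿ)`. -/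
def invariantsToK (ρ : G →* GL (Fin n) ℂ) : invariants ρ →+* K n :=
  (algebraMap (MvPolynomial (Fin n) ℂ) (K n)).comp (invariants ρ).val.toRingHom

lemma invariantsToK_injective : Function.Injective (invariantsToK ρ) :=
  (IsFractionRing.injective (MvPolynomial (Fin n) ℂ) (K n)).comp Subtype.val_injective

/-- The embedding `K(Y) = K(X) ⊆ K(ℂⁿ)` given by the birational map `π`: the unique one which
extends the inclusion `R^G ⊆ K(ℂⁿ)`. -/
def embed : 𝒴.Y.functionField →+* K n :=
  letI := 𝒴.toFunctionField.toAlgebra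
  haveI := 𝒴.isFractionRing
  IsFractionRing.lift (A := invariants ρ) (K := 𝒴.Y.functionField)
    (invariantsToK_injective (ρ := ρ))

lemma embed_toFunctionField (r : invariants ρ) :
    𝒴.embed (𝒴.toFunctionField r) = algebraMap (MvPolynomial (Fin n) ℂ) (K n) r := by
  let := 𝒴.toFunctionField.toAlgebra
  have := 𝒴.isFractionRing
  exact IsFractionRing.lift_algebraMap (A := invariants ρ) (K := 𝒴.Y.functionField)
    (invariantsToK_injective (ρ := ρ)) r

/-! ### Valuations at prime divisors and `G`-Weil divisors -/

/-- Prime Weil divisors of `Y`, represented by their generic points. -/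
abbrev PrimeDivisor : Type := {P : 𝒴.Y // Order.coheight P = 1}

open Classical in
/-- The valuation `v_P(f) = v_P(f^|G|) / |G|` of a nonzero homogeneous `f ∈ K(ℂⁿ)`; for those
`f^|G|` is invariant and lies in `K(Y)`. (The value is not used for other `f`.) -/
def val (P : 𝒴.PrimeDivisor) (f : K n) : ℚ :=
  if h : ∃ a : 𝒴.Y.functionField, 𝒴.embed a = f ^ Nat.card G then
    (Scheme.ord h.choose P.1 : ℚ) / Nat.card G
  else 0

open Classical in
/-- The valuation `v(P, χ) ∈ [0, 1)` of a character: the fractional part of `v_P(f)`, where `f` is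
any nonzero homogeneous function of weight `χ`. -/
def charVal (P : 𝒴.PrimeDivisor) (χ : G →* ℂˣ) : ℚ :=
  if h : ∃ f : K n, f ≠ 0 ∧ IsHomogeneous ρ χ f then Int.fract (𝒴.val P h.choose) else 0

/-- The canonical divisors `C_χ = ∑_P v(P, χ) P`; a `ℚ`-Weil divisor is given by its
coefficients. -/
def canonicalDivisor (χ : G →* ℂˣ) : 𝒴.PrimeDivisor → ℚ := fun P => 𝒴.charVal P χ

/-! ### Subsheaves of the constant sheaf `K(ℂⁿ)` on `Y` -/

/-- Sections over `U` of the constant sheaf `K(ℂⁿ)` on `Y`. -/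
def KSec (U : 𝒴.Y.Opens) : Type := LocallyConstant U (K n)

instance (U : 𝒴.Y.Opens) : CommRing (𝒴.KSec U) :=
  inferInstanceAs (CommRing (LocallyConstant U (K n)))

variable {𝒴} in
/-- Restriction of sections of the constant sheaf. -/
def KSec.res {U V : 𝒴.Y.Opens} (h : V ≤ U) : 𝒴.KSec U →+* 𝒴.KSec V :=
  LocallyConstant.comapRingHom ⟨Set.inclusion h, continuous_inclusion h⟩

/-- The constant section with value `f ∈ K(ℂⁿ)`. -/
def constSec (U : 𝒴.Y.Opens) : K n →+* 𝒴.KSec U := LocallyConstant.constRingHom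

/-- The action of `g` on sections of the constant sheaf `K(ℂⁿ)`. -/
def actKSec (g : G) (U : 𝒴.Y.Opens) (s : 𝒴.KSec U) : 𝒴.KSec U :=
  LocallyConstant.map (actK ρ g) s

/-- The map `𝒪_Y ⟶ K(ℂⁿ)` to the constant sheaf, given by `K(Y) ⊆ K(ℂⁿ)`. -/
def scalar (U : 𝒴.Y.Opens) : Γ(𝒴.Y, U) →+* 𝒴.KSec U where
  toFun a := (⟨fun y => haveI : Nonempty U := ⟨y⟩
    𝒴.embed ((𝒴.Y.germToFunctionField U).hom a),
      IsLocallyConstant.of_constant _ fun _ _ => rfl⟩ : LocallyConstant U (K n))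
  map_one' := by apply LocallyConstant.ext; intro y; simp; rfl
  map_zero' := by apply LocallyConstant.ext; intro y; simp; rfl
  map_mul' a b := by apply LocallyConstant.ext; intro y; simp; rfl
  map_add' a b := by apply LocallyConstant.ext; intro y; simp; rfl

instance (U : 𝒴.Y.Opens) : Algebra Γ(𝒴.Y, U) (𝒴.KSec U) := (𝒴.scalar U).toAlgebra

lemma smul_def {U : 𝒴.Y.Opens} (a : Γ(𝒴.Y, U)) (s : 𝒴.KSec U) : a • s = 𝒴.scalar U a * s := rfl

lemma res_smul {U V : 𝒴.Y.Opens} (h : V ≤ U) (a : Γ(𝒴.Y, U)) (s : 𝒴.KSec U) :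
    KSec.res h (a • s) = (𝒴.Y.presheaf.map (homOfLE h).op).hom a • KSec.res h s := by
  rw [smul_def, smul_def, map_mul]
  congr 1
  apply LocallyConstant.ext
  intro y
  have : Nonempty V := ⟨y⟩
  have : Nonempty U := ⟨⟨y.1, h y.2⟩⟩
  change 𝒴.embed ((𝒴.Y.germToFunctionField U).hom a) =
    𝒴.embed ((𝒴.Y.germToFunctionField V).hom _)
  congr 1
  exact (𝒴.Y.presheaf.germ_res_apply (homOfLE h) _ _ a).symm

/-- `f` is a local equation on `V` of the `χ`-Weil divisor `D`: a nonzero homogeneous function of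
weight `χ` with `v_P(f) = D(P)` for all prime divisors `P` meeting `V`. -/
structure IsLocalEquation (χ : G →* ℂˣ) (D : 𝒴.PrimeDivisor → ℚ) (V : 𝒴.Y.Opens) (f : K n) :
    Prop where
  ne_zero : f ≠ 0
  homogeneous : IsHomogeneous ρ χ f
  val_eq : ∀ P : 𝒴.PrimeDivisor, P.1 ∈ V → 𝒴.val P f = D P

lemma span_res {U V : 𝒴.Y.Opens} (h : V ≤ U) {S T : Set (K n)} (hST : S ⊆ T) {s : 𝒴.KSec U}
    (hs : s ∈ Submodule.span Γ(𝒴.Y, U) (𝒴.constSec U '' S)) :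
    KSec.res h s ∈ Submodule.span Γ(𝒴.Y, V) (𝒴.constSec V '' T) := by
  induction hs using Submodule.span_induction with
  | mem x hx =>
    obtain ⟨f, hf, rfl⟩ := hx
    exact Submodule.subset_span ⟨f, hST hf, rfl⟩
  | zero => rw [map_zero]; exact zero_mem _
  | add x y _ _ hx hy => rw [map_add]; exact add_mem hx hy
  | smul a x _ hx => rw [res_smul]; exact Submodule.smul_mem _ _ hx

/-- The sheaf `ℒ(D)` of a `χ`-Weil divisor `D`: the sub-`𝒪_Y`-module of the constant sheaf `K(ℂⁿ)`
generated by the inverses `f⁻¹` of the local equations `f` of `D`. -/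
def divisorSheaf (χ : G →* ℂˣ) (D : 𝒴.PrimeDivisor → ℚ) (U : 𝒴.Y.Opens) :
    Submodule Γ(𝒴.Y, U) (𝒴.KSec U) where
  carrier := {s | ∀ p ∈ U, ∃ (V : 𝒴.Y.Opens) (h : V ≤ U), p ∈ V ∧
    KSec.res h s ∈ Submodule.span Γ(𝒴.Y, V)
      (𝒴.constSec V '' {k | ∃ f, 𝒴.IsLocalEquation χ D V f ∧ k = f⁻¹})}
  zero_mem' p hp := ⟨U, le_rfl, hp, by rw [map_zero]; exact zero_mem _⟩
  add_mem' := by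
    intro s t hs ht p hp
    obtain ⟨V, hV, hpV, hs⟩ := hs p hp
    obtain ⟨W, hW, hpW, ht⟩ := ht p hp
    refine ⟨V ⊓ W, inf_le_left.trans hV, ⟨hpV, hpW⟩, ?_⟩
    rw [map_add]
    refine add_mem ?_ ?_
    · refine 𝒴.span_res (inf_le_left : V ⊓ W ≤ V) ?_ hs
      rintro _ ⟨f, hf, rfl⟩
      exact ⟨f, ⟨hf.1, hf.2, fun P hP => hf.3 P hP.1⟩, rfl⟩
    · refine 𝒴.span_res (inf_le_right : V ⊓ W ≤ W) ?_ ht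
      rintro _ ⟨f, hf, rfl⟩
      exact ⟨f, ⟨hf.1, hf.2, fun P hP => hf.3 P hP.2⟩, rfl⟩
  smul_mem' := by
    intro a s hs p hp
    obtain ⟨V, hV, hpV, hs⟩ := hs p hp
    exact ⟨V, hV, hpV, by rw [res_smul]; exact Submodule.smul_mem _ _ hs⟩

/-- The canonical family `⨁_χ ℒ(-C_χ)`, a sub-`𝒪_Y`-module of the constant sheaf `K(ℂⁿ)`
(`-C_χ` is a `χ⁻¹`-Weil divisor). -/
def canonicalFamily (U : 𝒴.Y.Opens) : Submodule Γ(𝒴.Y, U) (𝒴.KSec U) :=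
  ⨆ χ : G →* ℂˣ, 𝒴.divisorSheaf χ⁻¹ (-𝒴.canonicalDivisor χ) U

/-! ### The normalised reduced fibre product -/

/-- The fibre product `Y ×_X ℂⁿ`. -/
abbrev fibreProduct : Scheme.{0} := pullback 𝒴.π (quotientMap ρ)

/-- The reduced fibre product `(Y ×_X ℂⁿ)_red`. -/
abbrev reducedFibreProduct : Scheme.{0} := reduction 𝒴.fibreProduct

/-- The automorphism of `Y ×_X ℂⁿ` induced by `spaceMap g` on `ℂⁿ` and the identity on `Y`. -/
def fibreProductMap (g : G) : 𝒴.fibreProduct ⟶ 𝒴.fibreProduct :=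
  pullback.map 𝒴.π (quotientMap ρ) 𝒴.π (quotientMap ρ) (𝟙 _) (spaceMap ρ g) (𝟙 _)
    (by simp) (by simp [spaceMap_quotientMap])

instance (g : G) : IsIso (𝒴.fibreProductMap g) :=
  pullback.map_isIso 𝒴.π (quotientMap ρ) 𝒴.π (quotientMap ρ) (𝟙 _) (spaceMap ρ g) (𝟙 _)
    (by simp) (by simp [spaceMap_quotientMap])

variable [IsIntegral 𝒴.reducedFibreProduct]

/-- The normalisation `N` of the reduced fibre product. -/
abbrev N : Scheme.{0} := normalisation 𝒴.reducedFibreProduct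

/-- The natural morphism `N ⟶ Y ×_X ℂⁿ`. -/
def NtoFibreProduct : 𝒴.N ⟶ 𝒴.fibreProduct :=
  normalisationπ 𝒴.reducedFibreProduct ≫ reductionι 𝒴.fibreProduct

/-- The natural morphism `N ⟶ Y`. -/
def NtoY : 𝒴.N ⟶ 𝒴.Y := 𝒴.NtoFibreProduct ≫ pullback.fst 𝒴.π (quotientMap ρ)

/-- The natural morphism `N ⟶ ℂⁿ`. -/
def NtoSpace : 𝒴.N ⟶ affineSpace n := 𝒴.NtoFibreProduct ≫ pullback.snd 𝒴.π (quotientMap ρ)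

/-- The lift of `fibreProductMap g` to `N`. -/
def NMap (g : G) : 𝒴.N ⟶ 𝒴.N := normalisationMap (reductionMap (𝒴.fibreProductMap g))

lemma NMap_fibreProduct (g : G) :
    𝒴.NMap g ≫ 𝒴.NtoFibreProduct = 𝒴.NtoFibreProduct ≫ 𝒴.fibreProductMap g := by
  unfold NMap NtoFibreProduct
  rw [reassoc_of% normalisationMap_π, reductionMap_ι, Category.assoc]

lemma NMap_Y (g : G) : 𝒴.NMap g ≫ 𝒴.NtoY = 𝒴.NtoY := by
  have h : 𝒴.fibreProductMap g ≫ pullback.fst 𝒴.π (quotientMap ρ) =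
      pullback.fst 𝒴.π (quotientMap ρ) := by
    exact (pullback.lift_fst _ _ _).trans (Category.comp_id _)
  unfold NtoY
  rw [← Category.assoc, NMap_fibreProduct, Category.assoc, h]

/-- Sections over `U` of the pushforward to `Y` of the structure sheaf of `N`. -/
abbrev NSec (U : 𝒴.Y.Opens) : CommRingCat.{0} := Γ(𝒴.N, 𝒴.NtoY ⁻¹ᵁ U)

instance (U : 𝒴.Y.Opens) : Algebra Γ(𝒴.Y, U) (𝒴.NSec U) := (𝒴.NtoY.app U).hom.toAlgebra

instance (U : 𝒴.Y.Opens) : Algebra (MvPolynomial (Fin n) ℂ) (𝒴.NSec U) :=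
  ((𝒴.NtoSpace.appLE ⊤ (𝒴.NtoY ⁻¹ᵁ U) le_top).hom.comp
    (Scheme.ΓSpecIso (.of (MvPolynomial (Fin n) ℂ))).inv.hom).toAlgebra

/-- Restriction of sections of the pushforward. -/
def NSec.res {U V : 𝒴.Y.Opens} (h : V ≤ U) : 𝒴.NSec U →+* 𝒴.NSec V :=
  (𝒴.N.presheaf.map (homOfLE (𝒴.NtoY.preimage_mono h)).op).hom

/-- The action of `g ∈ G` on sections of the pushforward. -/
def actNSec (g : G) (U : 𝒴.Y.Opens) : 𝒴.NSec U →+* 𝒴.NSec U :=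
  ((𝒴.NMap g).appLE (𝒴.NtoY ⁻¹ᵁ U) (𝒴.NtoY ⁻¹ᵁ U) (by
    rw [← Scheme.Hom.comp_preimage, NMap_Y])).hom

/-- An isomorphism of sheaves of `(R ⋊ G) ⊗ 𝒪_Y`-modules from the pushforward of `𝒪_N` to the
canonical family: an isomorphism of sheaves of `𝒪_Y`-modules which commutes with the actions of
`R` and `G`, those on the canonical family being the ones on `K(ℂⁿ)`. In particular the canonical
family is stable under `R` and `G`. -/
structure CanonicalIso where
  /-- the isomorphism on sections over `U` -/
  equiv (U : 𝒴.Y.Opens) : 𝒴.NSec U ≃ₗ[Γ(𝒴.Y, U)] 𝒴.canonicalFamily U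
  equiv_res {U V : 𝒴.Y.Opens} (h : V ≤ U) (s : 𝒴.NSec U) :
    (equiv V (NSec.res 𝒴 h s) : 𝒴.KSec V) = KSec.res h (equiv U s)
  equiv_poly (U : 𝒴.Y.Opens) (r : MvPolynomial (Fin n) ℂ) (s : 𝒴.NSec U) :
    (equiv U (r • s) : 𝒴.KSec U) = 𝒴.constSec U (algebraMap _ (K n) r) * equiv U s
  equiv_group (U : 𝒴.Y.Opens) (g : G) (s : 𝒴.NSec U) :
    (equiv U (𝒴.actNSec g U s) : 𝒴.KSec U) = 𝒴.actKSec g U (equiv U s)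

end Resolution

end GConst

end

noncomputable section
namespace GConst

/-! ### Formal power series rings over an infinite field are factorial -/

section PowerSeriesFactorial

/-! Inside the constant sheaf `K n`, both sheaves have the same description: over a nonempty open U
they consist of the h in K(ℂⁿ) that are integral over 𝒪_{Y,P} for every prime divisor P meeting U
(`IsRegularOn`). As Y is irreducible, sections of the constant sheaf over U are single elements of
K(ℂⁿ), so the isomorphism is "evaluate at the generic point", and compatibility with restriction, R
and G can be checked there.

Canonical family (`mem_canonicalFamily_iff`). G is abelian and |G| is invertible, so h is a sum of
isotypic components, which are again regular. A homogeneous f is integral at P exactly when v_P(f) ≥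
0, because f^|G| lies in K(Y) and 𝒪_{Y,P} is a discrete valuation ring (`val_nonneg_iff`). Since Y
is locally factorial, C_χ has near each point an equation e of weight χ, with v_P(e) = v(P,χ) in
[0,1). If f = a·e with a in K(Y), then v_P(f) ≥ 0 forces the integer ord_P(a) to exceed -1, so a has
no poles and is regular.

Normalisation (`mem_range_evalN_iff_isRegularOn`). The function field of the reduced fibre product
is K(ℂⁿ), and the fibre product is integral over Y. Over an affine U the functions on N are
therefore the integral closure of Γ(Y,U) in K(ℂⁿ). By the isotypic decomposition and local
factoriality, integrality in codimension one already implies integrality over Γ(Y,U)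
(`isIntegralElem_iff_isRegularOn`).

Integrality of the reduction (`denseRange_genericFibreProduct`). Over an affine U let B be the ring
of Y ×_X ℂⁿ. If b dies in K(ℂⁿ), so do its conjugates, and the polynomial ∏(T - g·b) has G-invariant
coefficients. Averaging shows that invariants of B come from Γ(Y,U), which embeds in K(ℂⁿ), so the
polynomial is T^|G| and b is nilpotent. Hence the K(ℂⁿ)-valued generic point is dense.

Local factoriality of the smooth scheme Y (`uniqueFactorizationMonoid_stalk`) is proved from the
ground up: power series rings are factorial by Weierstrass preparation, completions at closed points
are power series rings by formal smoothness, factoriality descends along the faithfully flat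
completion, and it passes to further localisations. -/

lemma maximalIdeal_mvPowerSeries (k : Type*) [Field k] (σ : Type*) [Finite σ] :
    IsLocalRing.maximalIdeal (MvPowerSeries σ k) =
      Ideal.span (Set.range (MvPowerSeries.X : σ → MvPowerSeries σ k)) := by
  apply le_antisymm
  · intro f hf
    have h0 : MvPowerSeries.constantCoeff f = 0 := by
      by_contra h
      exact hf (MvPowerSeries.isUnit_iff_constantCoeff.2 (isUnit_iff_ne_zero.2 h))
    classical
    have := Fintype.ofFinite σ
    -- `ι` assigns to each nonconstant monomial one variable dividing it. The series `g i` collects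
    -- the terms assigned to i, divided by X i, so that f = ∑ g i · X i.
    let ι : (σ →₀ ℕ) → Option σ := fun m => if h : ∃ i, m i ≠ 0 then some h.choose else none
    have hι : ∀ m i, ι m = some i → m i ≠ 0 := by
      intro m i h
      by_cases h' : ∃ i, m i ≠ 0
      · simp only [ι, dif_pos h', Option.some.injEq] at h
        exact h ▸ h'.choose_spec
      · simp [ι, dif_neg h'] at h
    let g : σ → MvPowerSeries σ k := fun i m =>
      if ι (m + Finsupp.single i 1) = some i then
        MvPowerSeries.coeff (m + Finsupp.single i 1) f else 0
    have hcoeff : ∀ i m, MvPowerSeries.coeff m (g i * MvPowerSeries.X i) =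
        if ι m = some i then MvPowerSeries.coeff m f else 0 := by
      intro i m
      by_cases hm : m i = 0
      · rw [if_neg fun h => hι m i h hm]
        exact MvPowerSeries.X_dvd_iff.1 (dvd_mul_left _ _) m hm
      · obtain ⟨m', rfl⟩ : ∃ m', m = m' + Finsupp.single i 1 :=
          ⟨m - Finsupp.single i 1, (tsub_add_cancel_of_le (by
            rw [Finsupp.single_le_iff]; omega)).symm⟩
        rw [MvPowerSeries.X_def, MvPowerSeries.coeff_add_mul_monomial, mul_one]
        rfl
    have hsum : f = ∑ i, g i * MvPowerSeries.X i := by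
      ext m
      rw [map_sum]
      simp only [hcoeff]
      by_cases h' : ∃ i, m i ≠ 0
      · simp [ι, dif_pos h']
      · have : m = 0 := by ext i; by_contra h; exact h' ⟨i, h⟩
        subst this
        simpa [ι] using h0
    rw [hsum]
    exact Ideal.sum_mem _ fun i _ => Ideal.mul_mem_left _ _ (Ideal.subset_span ⟨i, rfl⟩)
  · rw [Ideal.span_le]
    rintro _ ⟨i, rfl⟩
    simp [IsLocalRing.mem_maximalIdeal, MvPowerSeries.isUnit_iff_constantCoeff]

instance (k : Type*) [Field k] (σ : Type*) [Finite σ] :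
    IsAdicComplete (IsLocalRing.maximalIdeal (MvPowerSeries σ k)) (MvPowerSeries σ k) := by
  rw [maximalIdeal_mvPowerSeries]; infer_instance

open Polynomial in
/-- Over a complete local factorial ring, irreducible power series which do not vanish modulo the
maximal ideal are prime. -/
lemma prime_of_irreducible_of_map_residue_ne_zero {A : Type*} [CommRing A] [IsDomain A]
    [UniqueFactorizationMonoid A] [IsLocalRing A]
    [IsAdicComplete (IsLocalRing.maximalIdeal A) A] {f : PowerSeries A} (hf : Irreducible f)
    (h0 : f.map (IsLocalRing.residue A) ≠ 0) : Prime f := by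
  -- Weierstrass preparation: f is a unit times a distinguished polynomial g, so primality can be
  -- decided in the factorial ring A[X].
  obtain ⟨g, u, H⟩ := PowerSeries.exists_isWeierstrassFactorization h0
  have hg : Irreducible (g : PowerSeries A) := by
    rw [H.eq_mul] at hf
    rwa [irreducible_mul_isUnit H.isUnit] at hf
  have hmon := H.isDistinguishedAt.monic
  -- Modulo the maximal ideal g is a power of X, hence so is each monic factor. A factor that is a
  -- unit as a power series has a unit constant term, so this power is X⁰ and the factor is 1. Thus
  -- g remains irreducible in A[X].
  have key : ∀ a b : A[X], a.Monic → b.Monic → a * b = g → IsUnit (a : PowerSeries A) →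
      a = 1 := by
    intro a b ha hb hab hu
    have hmap : g.map (IsLocalRing.residue A) = X ^ g.natDegree :=
      H.isDistinguishedAt.map_eq_X_pow
    have hdvd : a.map (IsLocalRing.residue A) ∣ X ^ g.natDegree := by
      rw [← hmap, ← hab, Polynomial.map_mul]; exact dvd_mul_right _ _
    obtain ⟨i, hi, has⟩ := (dvd_prime_pow Polynomial.prime_X _).1 hdvd
    have heq : a.map (IsLocalRing.residue A) = X ^ i :=
      eq_of_monic_of_associated (ha.map _) (monic_X_pow i) has
    have hc : IsUnit (a.coeff 0) := by
      have := PowerSeries.isUnit_iff_constantCoeff.1 hu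
      simpa using this
    have hc' : (a.map (IsLocalRing.residue A)).coeff 0 ≠ 0 := by
      rw [coeff_map]; exact (hc.map _).ne_zero
    have hi0 : i = 0 := by
      by_contra hne
      rw [heq, coeff_X_pow, if_neg (Ne.symm hne)] at hc'
      exact hc' rfl
    have : a.natDegree = 0 := by
      rw [← ha.natDegree_map (IsLocalRing.residue A), heq, hi0]; simp
    exact ha.natDegree_eq_zero.1 this
  have hgirr : Irreducible g := by
    refine (Polynomial.irreducible_of_monic hmon ?_).2 ?_
    · rintro rfl
      exact hg.not_isUnit (by simp)
    · intro a b ha hb hab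
      have hab' : (g : PowerSeries A) = a * b := by rw [← hab]; simp
      rcases hg.isUnit_or_isUnit hab' with h | h
      · exact Or.inl (key a b ha hb hab h)
      · exact Or.inr (key b a hb ha (by rw [mul_comm]; exact hab) h)
  have hgp : Prime g := UniqueFactorizationMonoid.irreducible_iff_prime.1 hgirr
  have hdom : IsDomain (A[X] ⧸ Ideal.span {g}) := by
    rw [Ideal.Quotient.isDomain_iff_prime, Ideal.span_singleton_prime hgp.ne_zero]
    exact hgp
  -- Weierstrass division identifies A[X]/(g) with A⟦X⟧/(f).
  have hdom' : IsDomain (PowerSeries A ⧸ Ideal.span {f}) :=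
    H.algEquivQuotient.symm.toMulEquiv.isDomain _
  rwa [Ideal.Quotient.isDomain_iff_prime, Ideal.span_singleton_prime hf.ne_zero] at hdom'

end PowerSeriesFactorial

/-! ### Shears, and induction on the number of variables -/

section LinearChange
open MvPowerSeries

variable {k : Type*} [Field k] {d : ℕ}

/-- The linear substitution `X₀ ↦ c₀ X₀`, `X_{i+1} ↦ X_{i+1} + c_{i+1} X₀`. -/
def shear (c : Fin (d + 1) → k) (i : Fin (d + 1)) : MvPowerSeries (Fin (d + 1)) k :=
  Fin.cases (C (c 0) * X 0) (fun j => X j.succ + C (c j.succ) * X 0) i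

lemma hasSubst_shear (c : Fin (d + 1) → k) : HasSubst (shear c) := by
  apply hasSubst_of_constantCoeff_zero
  intro i
  refine Fin.cases ?_ (fun j => ?_) i <;> simp [shear]

/-- The conditions on b say that it gives the coefficients of the inverse linear substitution. -/
lemma shear_comp (c : Fin (d + 1) → k) (b : Fin (d + 1) → k) (h0 : b 0 * c 0 = 1)
    (h : ∀ j : Fin d, b j.succ = - c j.succ * b 0) (f : MvPowerSeries (Fin (d + 1)) k) :
    substAlgHom (hasSubst_shear b) (substAlgHom (hasSubst_shear c) f) = f := by
  rw [substAlgHom_comp_substAlgHom_apply]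
  have : (fun i => subst (shear b) (shear c i)) =
      (X : Fin (d + 1) → MvPowerSeries (Fin (d + 1)) k) := by
    funext i
    rw [← substAlgHom_apply (hasSubst_shear b)]
    have hC (a : k) : substAlgHom (hasSubst_shear b) (C a) = C a :=
      (substAlgHom (hasSubst_shear b)).commutes a
    refine Fin.cases ?_ (fun j => ?_) i
    · simp only [shear, Fin.cases_zero, map_mul, hC, substAlgHom_X]
      rw [← mul_assoc, ← map_mul, mul_comm (c 0), h0]; simp
    · simp only [shear, Fin.cases_succ, Fin.cases_zero, map_add, map_mul, hC, substAlgHom_X, h]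
      simp; ring
  have h2 := substAlgHom_apply ((hasSubst_shear c).comp (hasSubst_shear b)) f
  rw [h2]
  have h3 : (fun i => substAlgHom (hasSubst_shear b) (shear c i)) =
      (X : Fin (d + 1) → MvPowerSeries (Fin (d + 1)) k) := by
    rw [← this]; funext i; rw [substAlgHom_apply]
  rw [h3, subst_self]
  rfl

/-- The restriction of a power series to the first coordinate axis. -/
def toAxis : MvPowerSeries (Fin (d + 1)) k →+* PowerSeries k :=
  (PowerSeries.map (constantCoeff (σ := Fin d) (R := k))).comp
    (finSuccEquiv k d : _ →+* _)

lemma coeff_toAxis (f : MvPowerSeries (Fin (d + 1)) k) (n : ℕ) :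
    PowerSeries.coeff n (toAxis f) = coeff (Finsupp.cons n 0) f := by
  rw [← coeff_coeff_finSuccEquiv]
  simp [toAxis]

lemma toAxis_shear (c : Fin (d + 1) → k) (i : Fin (d + 1)) :
    toAxis (shear c i) = PowerSeries.C (c i) * PowerSeries.X := by
  refine Fin.cases ?_ (fun j => ?_) i <;> simp [shear, toAxis]

/-- On the first axis every variable X_i becomes c_i X, so the coefficient of degree n is the degree
n homogeneous part of f evaluated at c. -/
lemma coeff_shear (c : Fin (d + 1) → k) (f : MvPowerSeries (Fin (d + 1)) k) (n : ℕ) :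
    coeff (Finsupp.cons n 0) (substAlgHom (hasSubst_shear c) f) =
      ∑ᶠ m : Fin (d + 1) →₀ ℕ, coeff m f * (if n = m.degree then m.prod (fun i e => c i ^ e) else 0) := by
  rw [substAlgHom_apply, coeff_subst (hasSubst_shear c)]
  congr 1
  funext m
  rw [smul_eq_mul, ← coeff_toAxis]
  congr 1
  rw [Finsupp.prod, map_prod]
  simp only [map_pow, toAxis_shear, mul_pow]
  rw [Finset.prod_mul_distrib, Finset.prod_pow_eq_pow_sum]
  simp only [← map_pow]
  rw [← map_prod, PowerSeries.coeff_C_mul, PowerSeries.coeff_X_pow]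
  rw [Finsupp.degree_apply, mul_ite, mul_one, mul_zero]
  rfl

/-- After a linear change of coordinates, a nonzero power series does not vanish on the first
coordinate axis. -/
lemma exists_shear_toAxis_ne_zero [Infinite k] {f : MvPowerSeries (Fin (d + 1)) k} (hf : f ≠ 0) :
    ∃ c : Fin (d + 1) → k, c 0 ≠ 0 ∧ toAxis (substAlgHom (hasSubst_shear c) f) ≠ 0 := by
  obtain ⟨m₀, hm₀⟩ : ∃ m, coeff m f ≠ 0 := by
    by_contra! h
    exact hf (MvPowerSeries.ext h)
  let s : Finset (Fin (d + 1) →₀ ℕ) := (Finset.univ : Finset (Fin (d + 1))).finsuppAntidiag m₀.degree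
  have hs : ∀ m, m ∈ s ↔ m₀.degree = m.degree := by
    intro m
    simp [s, Finset.mem_finsuppAntidiag, Finsupp.degree_eq_sum, eq_comm]
  -- A nonzero homogeneous part of f.
  let p : MvPolynomial (Fin (d + 1)) k := ∑ m ∈ s, MvPolynomial.monomial m (coeff m f)
  have hp : p ≠ 0 := by
    intro h
    apply hm₀
    have : MvPolynomial.coeff m₀ p = 0 := by rw [h]; simp
    simpa [p, MvPolynomial.coeff_sum, MvPolynomial.coeff_monomial, hs] using this
  -- The extra factor X 0 forces c 0 ≠ 0, which makes the shear invertible. This is where k must be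
  -- infinite.
  obtain ⟨c, hc⟩ : ∃ c, MvPolynomial.eval c (p * MvPolynomial.X 0) ≠ 0 := by
    by_contra! h
    exact mul_ne_zero hp (MvPolynomial.X_ne_zero 0) (MvPolynomial.funext fun c => by simpa using h c)
  rw [map_mul, MvPolynomial.eval_X] at hc
  refine ⟨c, right_ne_zero_of_mul hc, fun h => left_ne_zero_of_mul hc ?_⟩
  have h1 : PowerSeries.coeff m₀.degree (toAxis (substAlgHom (hasSubst_shear c) f)) = 0 := by
    rw [h]; simp
  rw [coeff_toAxis, coeff_shear, finsum_eq_sum_of_support_subset (s := s)] at h1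
  · rw [← h1]
    simp only [p, map_sum, MvPolynomial.eval_monomial]
    refine Finset.sum_congr rfl fun m hm => ?_
    rw [if_pos ((hs m).1 hm)]
  · intro m hm
    rw [Finset.mem_coe, hs]
    by_contra hne
    exact hm (by simp [hne])

/-- Induction on d. After an invertible shear an irreducible f does not vanish on the first axis;
seen as a series in the first variable over the power series ring in the others, it is nonzero
modulo the maximal ideal, and Weierstrass preparation over the factorial coefficient ring shows that
it is prime. -/
instance uniqueFactorizationMonoid_mvPowerSeries [Infinite k] :
    UniqueFactorizationMonoid (MvPowerSeries (Fin d) k) := by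
  induction d with
  | zero =>
    exact (isEmptyEquiv (σ := Fin 0) (R := k)).symm.toMulEquiv.uniqueFactorizationMonoid inferInstance
  | succ d ih =>
    have : IsDomain (MvPowerSeries (Fin d) k) := NoZeroDivisors.to_isDomain _
    have : IsDomain (MvPowerSeries (Fin (d + 1)) k) := NoZeroDivisors.to_isDomain _
    have : WfDvdMonoid (MvPowerSeries (Fin (d + 1)) k) := inferInstance
    refine ⟨fun {f} => ⟨fun hf => ?_, Prime.irreducible⟩⟩
    obtain ⟨c, hc0, hc⟩ := exists_shear_toAxis_ne_zero hf.ne_zero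
    let b : Fin (d + 1) → k := Fin.cases (c 0)⁻¹ (fun j => - c j.succ * (c 0)⁻¹)
    let e : MvPowerSeries (Fin (d + 1)) k ≃ₐ[k] MvPowerSeries (Fin (d + 1)) k :=
      AlgEquiv.ofAlgHom (substAlgHom (hasSubst_shear c)) (substAlgHom (hasSubst_shear b))
        (AlgHom.ext fun x => shear_comp b c (by simp [b, hc0]) (fun j => by simp [b, hc0]) x)
        (AlgHom.ext fun x => shear_comp c b (by simp [b, hc0]) (fun j => by simp [b]) x)
    let e' := (e.trans (finSuccEquiv k d)).toMulEquiv
    rw [← MulEquiv.prime_iff e']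
    rw [← MulEquiv.irreducible_iff e'] at hf
    refine prime_of_irreducible_of_map_residue_ne_zero hf fun h => hc ?_
    ext n
    have hn := congrArg (PowerSeries.coeff n) h
    rw [PowerSeries.coeff_map, map_zero, IsLocalRing.residue_eq_zero_iff,
      IsLocalRing.mem_maximalIdeal, mem_nonunits_iff, isUnit_iff_constantCoeff,
      isUnit_iff_ne_zero, not_not] at hn
    rw [map_zero]
    exact hn

end LinearChange
end GConst
end

noncomputable section
namespace GConst

/-! ### Descent of factoriality along flat local extensions -/

section Descent

/-- A height one prime ideal of a noetherian domain is of the form `(a : b)`. -/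
lemma exists_mem_iff_dvd_mul_of_height_eq_one {B : Type*} [CommRing B] [IsDomain B]
    [IsNoetherianRing B] (p : Ideal B) [p.IsPrime] (hp : p.height = 1) :
    ∃ a b : B, a ≠ 0 ∧ ∀ x, x ∈ p ↔ a ∣ x * b := by
  obtain ⟨a, hap, ha⟩ := p.ne_bot_iff.1 (p.ne_bot_of_height_eq_one hp)
  -- A prime strictly between (a) and p would have height 0, hence be zero, and could not contain a.
  have hmin : p ∈ (Ideal.span {a}).minimalPrimes := by
    obtain ⟨q, hq, hqp⟩ := Ideal.exists_minimalPrimes_le ((Ideal.span_singleton_le_iff_mem p).2 hap)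
    have := hq.isPrime
    rcases hqp.eq_or_lt with h | h
    · exact h ▸ hq
    · exfalso
      have h2 := Ideal.height_add_one_le_of_lt_of_isPrime h
      rw [hp] at h2
      have h3 : q.height = 0 := by
        by_contra hne
        have : 1 ≤ q.height := Order.one_le_iff_ne_zero.2 hne
        have h4 : (1 : ℕ∞) + 1 ≤ 1 := (add_le_add_left this 1).trans h2
        exact absurd h4 (by decide)
      rw [Ideal.height_eq_zero_iff_eq_bot] at h3
      have : a ∈ q := hq.le (Ideal.mem_span_singleton_self a)
      rw [h3] at this
      exact ha this
  have hann : Module.annihilator B (B ⧸ Ideal.span {a}) = Ideal.span {a} :=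
    Ideal.annihilator_quotient
  rw [← hann] at hmin
  -- Minimal primes over the annihilator of B/(a) are associated primes, so p is the annihilator of
  -- the class of some b.
  have hass := Module.associatedPrimes.minimalPrimes_annihilator_subset_associatedPrimes B
    (B ⧸ Ideal.span {a}) hmin
  obtain ⟨-, z, hz⟩ := isAssociatedPrime_iff.1 hass
  obtain ⟨b, rfl⟩ := Ideal.Quotient.mk_surjective z
  refine ⟨a, b, ha, fun x => ?_⟩
  rw [hz, Submodule.mem_colon_singleton, Submodule.mem_bot, ← Ideal.mem_span_singleton,
    ← Ideal.Quotient.eq_zero_iff_mem, map_mul, Algebra.smul_def]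
  rfl

/-- A height one prime is a colon ideal p = (a : b). Flatness gives pC = (a : b) in C, and colon
ideals of this kind are principal in a factorial ring. Locality lets the generator be chosen in p,
and faithful flatness then shows that it generates p. -/
lemma uniqueFactorizationMonoid_of_flat (B C : Type*) [CommRing B] [IsDomain B]
    [IsNoetherianRing B] [IsLocalRing B] [CommRing C] [IsDomain C] [UniqueFactorizationMonoid C]
    [IsLocalRing C] [Algebra B C] [Module.Flat B C] [IsLocalHom (algebraMap B C)] :
    UniqueFactorizationMonoid B := by
  have hff : Module.FaithfullyFlat B C := Module.FaithfullyFlat.of_flat_of_isLocalHom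
  have hinj : Function.Injective (algebraMap B C) := FaithfulSMul.algebraMap_injective B C
  refine UniqueFactorizationMonoid.of_forall_isPrincipal_of_height_eq_one fun p hp h1 => ?_
  obtain ⟨a, b, ha, hab⟩ := exists_mem_iff_dvd_mul_of_height_eq_one p h1
  have hpC : ∀ c : C, c ∈ p.map (algebraMap B C) ↔ algebraMap B C a ∣ c * algebraMap B C b := by
    intro c
    constructor
    · intro hc
      refine Submodule.span_induction ?_ ?_ ?_ ?_ hc
      · rintro _ ⟨x, hx, rfl⟩
        rw [← map_mul]
        exact map_dvd _ ((hab x).1 hx)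
      · simp
      · intro x y _ _ hx hy
        rw [add_mul]
        exact dvd_add hx hy
      · intro r x _ hx
        rw [smul_eq_mul, mul_assoc]
        exact hx.mul_left r
    -- The relation b·c = a·c' over C is a consequence of relations over B, by the equational
    -- criterion for flatness; this writes c in terms of elements of (a : b).
    · rintro ⟨c', hc'⟩
      have hrel : ∑ i, (![b, -a] : Fin 2 → B) i • (![c, c'] : Fin 2 → C) i = 0 := by
        simp [Fin.sum_univ_two, Algebra.smul_def]
        rw [← hc']; ring
      obtain ⟨l, A, y, hA, hy⟩ := Module.Flat.isTrivialRelation_of_sum_smul_eq_zero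
        (R := B) (M := C) (f := ![b, -a]) (x := ![c, c']) hrel
      have h0 := hA 0
      simp only [Matrix.cons_val_zero] at h0
      rw [h0]
      refine Ideal.sum_mem _ fun j _ => ?_
      rw [Algebra.smul_def]
      refine Ideal.mul_mem_right _ _ (Ideal.mem_map_of_mem _ ((hab _).2 ⟨A 1 j, ?_⟩))
      have := hy j
      simp only [Fin.sum_univ_two, Matrix.cons_val_zero, Matrix.cons_val_one] at this
      linear_combination this
  have ha' : algebraMap B C a ≠ 0 := by rwa [Ne, map_eq_zero_iff _ hinj]
  obtain ⟨a', b', g, hrel, hga, hgb⟩ :=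
    UniqueFactorizationMonoid.exists_reduced_factors (algebraMap B C a) ha' (algebraMap B C b)
  have hg0 : g ≠ 0 := by rintro rfl; exact ha' (by rw [← hga, zero_mul])
  have ha'0 : a' ≠ 0 := by rintro rfl; exact ha' (by rw [← hga, mul_zero])
  have hpC' : p.map (algebraMap B C) = Ideal.span {a'} := by
    ext c
    rw [hpC, Ideal.mem_span_singleton, ← hga, ← hgb]
    rw [show c * (g * b') = g * (c * b') by ring, mul_dvd_mul_iff_left hg0]
    exact ⟨fun h => (hrel.dvd_of_dvd_mul_right h), fun h => h.mul_right _⟩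
  -- Otherwise all of p would map into a'·𝔪_C, so that a' would lie in a'·𝔪_C, and cancelling a'
  -- would put 1 in 𝔪_C.
  obtain ⟨x, hxp, hx⟩ : ∃ x ∈ p, ∃ u, IsUnit u ∧ algebraMap B C x = a' * u := by
    by_contra! hcon
    have hle : p.map (algebraMap B C) ≤ Ideal.span {a'} * IsLocalRing.maximalIdeal C := by
      rw [Ideal.map_le_iff_le_comap]
      intro x hx
      have := Ideal.mem_map_of_mem (algebraMap B C) hx
      rw [hpC', Ideal.mem_span_singleton] at this
      obtain ⟨u, hu⟩ := this
      rw [Ideal.mem_comap, Ideal.mem_span_singleton_mul]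
      exact ⟨u, fun h => hcon x hx u h hu, hu.symm⟩
    rw [hpC', Ideal.span_singleton_le_iff_mem, Ideal.mem_span_singleton_mul] at hle
    obtain ⟨z, hz, hz'⟩ := hle
    have : z = 1 := mul_left_cancel₀ ha'0 (by rw [hz', mul_one])
    rw [this] at hz
    exact hz isUnit_one
  obtain ⟨u, hu, hxu⟩ := hx
  refine ⟨x, ?_⟩
  rw [Ideal.submodule_span_eq]
  rw [← Ideal.comap_map_eq_self_of_faithfullyFlat (B := C) p, hpC',
    ← Ideal.comap_map_eq_self_of_faithfullyFlat (B := C) (Ideal.span {x}), Ideal.map_span,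
    Set.image_singleton, hxu, Ideal.span_singleton_mul_right_unit hu]

end Descent

/-! ### Completions of formally smooth local algebras are power series rings -/

section Completion
open MvPowerSeries IsLocalRing

variable {k : Type*} [Field k] {d : ℕ}

local notation "𝔫" => maximalIdeal (MvPowerSeries (Fin _) _)

/-- I and I² define the same topology. The lifting argument below starts from B/𝔪², for which the
kernel on the power series side is the square of the maximal ideal. -/
lemma isAdicComplete_sq {R : Type*} [CommRing R] (I : Ideal R) [IsAdicComplete I R] :
    IsAdicComplete (I ^ 2) R where
  haus' x hx := by
    refine IsHausdorff.haus (inferInstance : IsHausdorff I R) x fun n => ?_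
    refine (hx n).mono (Submodule.smul_mono_left ?_)
    rw [← pow_mul]
    exact Ideal.pow_le_pow_right (by omega)
  prec' f hf := by
    have h2 : ∀ n, ((I ^ 2) ^ n • ⊤ : Submodule R R) ≤ I ^ n • ⊤ := fun n =>
      Submodule.smul_mono_left (by rw [← pow_mul]; exact Ideal.pow_le_pow_right (by omega))
    obtain ⟨L, hL⟩ := IsPrecomplete.prec (inferInstance : IsPrecomplete I R)
      (f := f) (fun {m n} hmn => (hf hmn).mono (h2 m))
    refine ⟨L, fun n => ?_⟩
    have h3 := hL (2 * n)
    rw [pow_mul] at h3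
    exact (hf (by omega : n ≤ 2 * n)).trans h3

lemma X_mem_maximalIdeal (i : Fin d) : (X i : MvPowerSeries (Fin d) k) ∈ 𝔫 := by
  rw [maximalIdeal_mvPowerSeries]
  exact Ideal.subset_span ⟨i, rfl⟩

lemma sub_C_mem_maximalIdeal (p : MvPowerSeries (Fin d) k) : p - C (constantCoeff p) ∈ 𝔫 := by
  simp [mem_maximalIdeal, mem_nonunits_iff, isUnit_iff_constantCoeff]

/-- Endomorphisms of the ring of power series which are tangent to the identity are injective. -/
lemma injective_of_tangent_id (σ : MvPowerSeries (Fin d) k →ₐ[k] MvPowerSeries (Fin d) k)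
    (hσ : ∀ i, σ (X i) - X i ∈ 𝔫 ^ 2) : Function.Injective σ := by
  have hX : ∀ i, σ (X i) ∈ 𝔫 := fun i => by
    have := add_mem (Ideal.pow_le_self two_ne_zero (hσ i)) (X_mem_maximalIdeal i)
    simpa using this
  have hn : ∀ p ∈ 𝔫, σ p ∈ 𝔫 := by
    intro p hp
    have : 𝔫 ≤ (𝔫).comap σ := by
      conv_lhs => rw [maximalIdeal_mvPowerSeries]
      rw [Ideal.span_le]
      rintro _ ⟨i, rfl⟩
      exact hX i
    exact this hp
  have h0 : ∀ p, σ p - p ∈ 𝔫 := by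
    intro p
    have h := sub_mem (hn _ (sub_C_mem_maximalIdeal p)) (sub_C_mem_maximalIdeal p)
    have hC : σ (C (constantCoeff p)) = C (constantCoeff p) := σ.commutes _
    rw [map_sub, hC] at h
    simpa using h
  have h1 : ∀ p ∈ 𝔫, σ p - p ∈ 𝔫 ^ 2 := by
    intro p hp
    rw [maximalIdeal_mvPowerSeries] at hp
    refine Submodule.span_induction ?_ ?_ ?_ ?_ hp
    · rintro _ ⟨i, rfl⟩
      exact hσ i
    · simp
    · intro x y _ _ hx hy
      rw [map_add, add_sub_add_comm]
      exact add_mem hx hy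
    · intro r x hx0 hx
      rw [Ideal.submodule_span_eq, ← maximalIdeal_mvPowerSeries] at hx0
      rw [smul_eq_mul, map_mul,
        show σ r * σ x - r * x = σ r * (σ x - x) + (σ r - r) * x by ring]
      refine add_mem (Ideal.mul_mem_left _ _ hx) ?_
      rw [pow_two]
      exact Ideal.mul_mem_mul (h0 r) hx0
  have hpow : ∀ e, ∀ p ∈ 𝔫 ^ e, σ p - p ∈ 𝔫 ^ (e + 1) := by
    intro e
    induction e with
    | zero => intro p _; simpa using h0 p
    | succ e ih =>
      intro p hp
      rw [pow_succ] at hp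
      refine Submodule.mul_induction_on hp ?_ ?_
      · intro a ha b hb
        rw [map_mul, show σ a * σ b - a * b = σ a * (σ b - b) + (σ a - a) * b by ring]
        have hσa : σ a ∈ 𝔫 ^ e := by
          have := add_mem (Ideal.pow_le_pow_right (Nat.le_succ e) (ih a ha)) ha
          simpa using this
        refine add_mem ?_ ?_
        · have := Ideal.mul_mem_mul hσa (h1 b hb)
          rwa [← pow_add] at this
        · have := Ideal.mul_mem_mul (ih a ha) hb
          rwa [← pow_succ] at this
      · intro x y hx hy
        rw [map_add, add_sub_add_comm]
        exact add_mem hx hy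
  rw [injective_iff_map_eq_zero]
  intro p hp
  have hall : ∀ e, p ∈ 𝔫 ^ e := by
    intro e
    induction e with
    | zero => simp
    | succ e ih =>
      have := hpow e p ih
      rw [hp, zero_sub] at this
      simpa using this
  refine IsHausdorff.haus
    (inferInstance : IsHausdorff (maximalIdeal (MvPowerSeries (Fin d) k)) _) p fun n => ?_
  rw [SModEq.zero]
  simpa using hall n

variable {B : Type*} [CommRing B] [IsLocalRing B] [Algebra k B]

local notation "𝔪" => maximalIdeal B

lemma exists_C_sub_mem (hk : Function.Surjective (algebraMap k (ResidueField B))) (b : B) :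
    ∃ a : k, b - algebraMap k B a ∈ 𝔪 := by
  obtain ⟨a, ha⟩ := hk (residue B b)
  refine ⟨a, ?_⟩
  rw [← residue_eq_zero_iff, map_sub, ← ha, sub_eq_zero]
  rfl

/-- An algebra map into a complete ring extends to the completion. -/
lemma exists_algHom_adicCompletion {k B S : Type*} [CommRing k] [CommRing B] [CommRing S]
    [Algebra k B] [Algebra k S] (I : Ideal B) (J : Ideal S) [IsAdicComplete J S] (g : B →ₐ[k] S)
    (hg : ∀ n, I ^ n ≤ (J ^ n).comap g) :
    ∃ α : AdicCompletion I B →ₐ[k] S, ∀ (n : ℕ) (x : AdicCompletion I B) (b : B),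
      AdicCompletion.evalₐ I n x = Ideal.Quotient.mk _ b →
        Ideal.Quotient.mk (J ^ n) (α x) = Ideal.Quotient.mk (J ^ n) (g b) := by
  have hcompat : ∀ {m n : ℕ} (h : m ≤ n),
      (Ideal.Quotient.factorₐ k (Ideal.pow_le_pow_right h)).comp
        ((Ideal.quotientMapₐ (J ^ n) g (hg n)).comp
          ((AdicCompletion.evalₐ I n).restrictScalars k)) =
        (Ideal.quotientMapₐ (J ^ m) g (hg m)).comp
          ((AdicCompletion.evalₐ I m).restrictScalars k) := by
    intro m n h
    ext x
    obtain ⟨u, rfl⟩ := AdicCompletion.mk_surjective I B x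
    have hu : Ideal.Quotient.mk (I ^ m) (u n) = Ideal.Quotient.mk (I ^ m) (u m) := by
      rw [Ideal.Quotient.mk_eq_mk_iff_sub_mem]
      have := (SModEq.sub_mem).1 (u.2 h).symm
      simpa using this
    have hu2 := congrArg (Ideal.quotientMapₐ (J ^ m) g (hg m)) hu
    simp only [AlgHom.comp_apply, AlgHom.restrictScalars_apply, AdicCompletion.evalₐ_mk]
    exact hu2
  refine ⟨IsAdicComplete.liftAlgHom J _ hcompat, fun n x b hb => ?_⟩
  refine (IsAdicComplete.mk_liftAlgHom _ _ hcompat _ _).trans ?_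
  simp only [AlgHom.comp_apply, AlgHom.restrictScalars_apply, hb]
  rfl

/-- Linear approximation modulo the square of the maximal ideal. -/
lemma exists_linear_sub_mem {B : Type*} [CommRing B] [IsLocalRing B] [Algebra k B] {t : Fin d → B}
    (ht : Ideal.span (Set.range t) = maximalIdeal B)
    (hk : ∀ b : B, ∃ a : k, b - algebraMap k B a ∈ maximalIdeal B) (b : B) :
    ∃ (c : k) (a : Fin d → k),
      b - (algebraMap k B c + ∑ i, algebraMap k B (a i) * t i) ∈ maximalIdeal B ^ 2 := by
  obtain ⟨c, hc⟩ := hk b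
  rw [← ht, Ideal.mem_span_range_iff_exists_fun] at hc
  obtain ⟨u, hu⟩ := hc
  choose a ha using fun i => hk (u i)
  refine ⟨c, a, ?_⟩
  have : b - (algebraMap k B c + ∑ i, algebraMap k B (a i) * t i) =
      ∑ i, (u i - algebraMap k B (a i)) * t i := by
    rw [← sub_sub, ← hu, ← Finset.sum_sub_distrib]
    simp [sub_mul]
  rw [this, pow_two]
  exact sum_mem fun i _ => Ideal.mul_mem_mul (ha i) (ht ▸ Ideal.subset_span ⟨i, rfl⟩)

/-- Minimal generators of the maximal ideal, which are linearly independent modulo its square. -/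
lemma exists_parameters (k : Type*) [Field k] (B : Type*) [CommRing B] [IsLocalRing B]
    [IsNoetherianRing B] [Algebra k B] :
    ∃ (d : ℕ) (t : Fin d → B), Ideal.span (Set.range t) = maximalIdeal B ∧
      ∀ a : Fin d → k, ∑ i, algebraMap k B (a i) * t i ∈ maximalIdeal B ^ 2 → a = 0 := by
  let b := Module.finBasis (ResidueField B) (CotangentSpace B)
  choose t ht using fun i => (maximalIdeal B).toCotangent_surjective (b i)
  refine ⟨_, fun i => (t i : B), ?_, fun a ha => ?_⟩
  · have h1 : Submodule.span (ResidueField B) ((maximalIdeal B).toCotangent '' (Set.range t)) = ⊤ := by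
      rw [← Set.range_comp]
      convert b.span_eq
      funext i
      exact ht i
    have h2 := CotangentSpace.span_image_eq_top_iff.1 h1
    have h3 := congrArg (Submodule.map (maximalIdeal B).subtype) h2
    rw [Submodule.map_span, ← Set.range_comp, Submodule.map_top, Submodule.range_subtype] at h3
    exact h3
  · have h1 : ∑ i, algebraMap k (ResidueField B) (a i) • b i = 0 := by
      have h2 : (maximalIdeal B).toCotangent (∑ i, algebraMap k B (a i) • t i) = 0 := by
        rw [Ideal.toCotangent_eq_zero]
        simpa [Algebra.smul_def] using ha
      rw [map_sum] at h2
      rw [← h2]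
      refine Finset.sum_congr rfl fun i _ => ?_
      rw [map_smul, ht, IsScalarTower.algebraMap_apply k B (ResidueField B), algebraMap_smul]
    have h2 := Fintype.linearIndependent_iff.1 b.linearIndependent _ h1
    funext i
    simpa using h2 i

section
variable (t : Fin d → B)

lemma idealOfVars_pow_le_comap (ht : ∀ i, t i ∈ 𝔪) (n : ℕ) :
    MvPolynomial.idealOfVars (Fin d) k ^ n ≤ (𝔪 ^ n).comap (MvPolynomial.aeval (R := k) t) := by
  rw [← Ideal.map_le_iff_le_comap, Ideal.map_pow]
  refine Ideal.pow_right_mono ?_ n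
  rw [MvPolynomial.idealOfVars, Ideal.map_span, Ideal.span_le]
  rintro _ ⟨_, ⟨i, rfl⟩, rfl⟩
  simpa using ht i

/-- The map `k⟦X⟧ → B / 𝔪ⁿ` which sends `X i` to the class of `t i ∈ 𝔪`. -/
def powerSeriesToQuotient (ht : ∀ i, t i ∈ 𝔪) (n : ℕ) :
    MvPowerSeries (Fin d) k →ₐ[k] B ⧸ 𝔪 ^ n :=
  (Ideal.quotientMapₐ (𝔪 ^ n) (MvPolynomial.aeval (R := k) t)
    (idealOfVars_pow_le_comap t ht n)).comp ((truncTotalAlgHom (Fin d) k n).restrictScalars k)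

lemma powerSeriesToQuotient_X (ht : ∀ i, t i ∈ 𝔪) (n : ℕ) (i : Fin d) :
    powerSeriesToQuotient (k := k) t ht n (X i) = Ideal.Quotient.mk _ (t i) := by
  have h := (truncTotalAlgHom (Fin d) k n).commutes (MvPolynomial.X i)
  have h2 : algebraMap (MvPolynomial (Fin d) k) (MvPowerSeries (Fin d) k) (MvPolynomial.X i) =
      X i := by
    exact MvPolynomial.coe_X i
  rw [h2] at h
  simp only [powerSeriesToQuotient, AlgHom.comp_apply, AlgHom.restrictScalars_apply, h]
  rw [Ideal.Quotient.algebraMap_eq]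
  simp

lemma factor_powerSeriesToQuotient (ht : ∀ i, t i ∈ 𝔪) {m n : ℕ} (h : m ≤ n) :
    (Ideal.Quotient.factorₐ k (Ideal.pow_le_pow_right h)).comp (powerSeriesToQuotient t ht n) =
      powerSeriesToQuotient (k := k) t ht m := by
  ext p
  have h1 := truncTotal_sub_truncTotal_mem_pow_idealOfVars h le_rfl p
  rw [← Ideal.Quotient.mk_eq_mk_iff_sub_mem] at h1
  have h2 := congrArg (Ideal.quotientMapₐ (𝔪 ^ m) (MvPolynomial.aeval (R := k) t)
    (idealOfVars_pow_le_comap t ht m)) h1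
  exact h2

end

/-- Sending X i to minimal generators t i of 𝔪 defines ψ from the power series ring to the
completion, and ψ turns out to be an isomorphism. Surjectivity is completeness; injectivity comes
from formal smoothness, which provides a map back whose composite with ψ is tangent to the identity.
-/
theorem uniqueFactorizationMonoid_adicCompletion [IsNoetherianRing B] [Infinite k] [Algebra.FormallySmooth k B]
    (hk : Function.Surjective (algebraMap k (ResidueField B))) :
    IsDomain (AdicCompletion 𝔪 B) ∧ UniqueFactorizationMonoid (AdicCompletion 𝔪 B) := by
  obtain ⟨d, t, htspan, htind⟩ := exists_parameters k B
  have ht : ∀ i, t i ∈ 𝔪 := fun i => htspan ▸ Ideal.subset_span ⟨i, rfl⟩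
  let f := powerSeriesToQuotient (k := k) t ht
  let ψ : MvPowerSeries (Fin d) k →ₐ[k] AdicCompletion 𝔪 B :=
    AdicCompletion.liftAlgHom 𝔪 f (fun h => factor_powerSeriesToQuotient t ht h)
  have hfX (n : ℕ) (i : Fin d) : f n (X i) = Ideal.Quotient.mk _ (t i) :=
    powerSeriesToQuotient_X t ht n i
  have hlin (c : k) (a : Fin d → k) : f 2 (algebraMap k _ c + ∑ i, algebraMap k _ (a i) * X i) =
      Ideal.Quotient.mk (𝔪 ^ 2) (algebraMap k B c + ∑ i, algebraMap k B (a i) * t i) := by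
    simp only [map_add, map_sum, map_mul, hfX, AlgHom.commutes]
    rfl
  have hsurj2 : Function.Surjective (f 2) := by
    intro y
    obtain ⟨b, rfl⟩ := Ideal.Quotient.mk_surjective y
    obtain ⟨c, a, h⟩ := exists_linear_sub_mem htspan (exists_C_sub_mem hk) b
    exact ⟨_, (hlin c a).trans ((Ideal.Quotient.mk_eq_mk_iff_sub_mem _ _).2 h).symm⟩
  -- Independence of the t i modulo 𝔪² is what prevents the kernel from being larger.
  have hker2 : RingHom.ker (f 2) = maximalIdeal (MvPowerSeries (Fin d) k) ^ 2 := by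
    have hle : maximalIdeal (MvPowerSeries (Fin d) k) ^ 2 ≤ RingHom.ker (f 2) := by
      have h1 : maximalIdeal (MvPowerSeries (Fin d) k) ≤
          ((𝔪).map (Ideal.Quotient.mk (𝔪 ^ 2))).comap (f 2) := by
        conv_lhs => rw [maximalIdeal_mvPowerSeries]
        rw [Ideal.span_le]
        rintro _ ⟨i, rfl⟩
        simp only [SetLike.mem_coe, Ideal.mem_comap, hfX]
        exact Ideal.mem_map_of_mem _ (ht i)
      refine (Ideal.pow_right_mono h1 2).trans ((Ideal.le_comap_pow _ 2).trans ?_)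
      rw [← Ideal.map_pow, Ideal.map_quotient_self]
      exact le_rfl
    refine le_antisymm (fun p hp => ?_) hle
    have hX : maximalIdeal (MvPowerSeries (Fin d) k) = Ideal.span (Set.range X) := by
      rw [maximalIdeal_mvPowerSeries]
    obtain ⟨c, a, h⟩ := exists_linear_sub_mem (k := k) hX.symm
      (fun b => ⟨constantCoeff b, sub_C_mem_maximalIdeal b⟩) p
    have h1 := hle h
    rw [RingHom.mem_ker, map_sub, hlin, (RingHom.mem_ker).1 hp, zero_sub, neg_eq_zero,
      Ideal.Quotient.eq_zero_iff_mem] at h1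
    have hc : c = 0 := by
      by_contra hc
      have hm : ∑ i, algebraMap k B (a i) * t i ∈ 𝔪 :=
        sum_mem fun i _ => Ideal.mul_mem_left _ _ (ht i)
      have h2 := sub_mem (Ideal.pow_le_self two_ne_zero h1) hm
      rw [add_sub_cancel_right] at h2
      exact h2 ((IsUnit.mk0 c hc).map (algebraMap k B))
    rw [hc, map_zero, zero_add] at h1
    rw [hc, htind a h1] at h
    simpa using h
  have hcomplete : IsAdicComplete (RingHom.ker (f 2)) (MvPowerSeries (Fin d) k) := by
    rw [hker2]; exact isAdicComplete_sq _
  -- Formal smoothness lifts B → B/𝔪² ≅ k⟦X⟧/𝔫² to a map g from B to the complete ring k⟦X⟧.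
  obtain ⟨g, hg⟩ := Algebra.FormallySmooth.exists_mkₐ_comp_eq_of_isAdicComplete
    ((Ideal.quotientKerAlgEquivOfSurjective hsurj2).symm.toAlgHom.comp (Ideal.Quotient.mkₐ k (𝔪 ^ 2)))
  have hg2 : ∀ b, f 2 (g b) = Ideal.Quotient.mk _ b := by
    intro b
    have := congrArg (Ideal.quotientKerAlgEquivOfSurjective hsurj2) (DFunLike.congr_fun hg b)
    simpa using this
  have hgt : ∀ i, g (t i) - X i ∈ 𝔫 ^ 2 := by
    intro i
    rw [← hker2, RingHom.mem_ker, map_sub, hg2, hfX, sub_self]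
  have hgm : 𝔪 ≤ (𝔫).comap g := by
    rw [← htspan, Ideal.span_le]
    rintro _ ⟨i, rfl⟩
    have := add_mem (Ideal.pow_le_self two_ne_zero (hgt i)) (X_mem_maximalIdeal i)
    simpa using this
  have hgmn (n : ℕ) : 𝔪 ^ n ≤ (𝔫 ^ n).comap g :=
    (Ideal.pow_right_mono hgm n).trans (Ideal.le_comap_pow _ n)
  obtain ⟨α, hα⟩ := exists_algHom_adicCompletion 𝔪 (maximalIdeal (MvPowerSeries (Fin d) k)) g hgmn
  have hψX : ∀ i, ψ (X i) = algebraMap B _ (t i) := by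
    intro i
    refine AdicCompletion.ext_evalₐ fun n => ?_
    rw [AdicCompletion.evalₐ_liftAlgHom, hfX]
    exact (AdicCompletion.evalₐ_of _ _ _).symm
  have hinj : Function.Injective ψ := by
    have : Function.Injective (α.comp ψ) := by
      refine injective_of_tangent_id _ fun i => ?_
      have h1 := hα 2 (ψ (X i)) (t i) (by rw [AdicCompletion.evalₐ_liftAlgHom, hfX])
      rw [Ideal.Quotient.mk_eq_mk_iff_sub_mem] at h1
      have h2 := add_mem h1 (hgt i)
      rwa [sub_add_sub_cancel] at h2
    exact Function.Injective.of_comp (f := α) this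
  have hmap : (𝔫).map ψ = maximalIdeal (AdicCompletion 𝔪 B) := by
    have h1 := congrArg (Ideal.map (algebraMap B (AdicCompletion 𝔪 B))) htspan
    rw [AdicCompletion.maximalIdeal_eq_map, maximalIdeal_mvPowerSeries, ← h1, Ideal.map_span,
      Ideal.map_span, ← Set.range_comp, ← Set.range_comp]
    congr 2
    funext i
    exact hψX i
  -- By completeness it is enough to be surjective modulo 𝔫, which generates the maximal ideal of
  -- the completion; there the constants suffice, since the residue field is k.
  have hsurj : Function.Surjective ψ := by
    have hH : IsHausdorff ((𝔫).map (ψ : MvPowerSeries (Fin d) k →+* AdicCompletion 𝔪 B))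
        (AdicCompletion 𝔪 B) := by
      have : (𝔫).map (ψ : MvPowerSeries (Fin d) k →+* AdicCompletion 𝔪 B) = _ := hmap
      rw [this]
      infer_instance
    refine surjective_of_mk_map_comp_surjective (I := 𝔫)
      (ψ : MvPowerSeries (Fin d) k →+* AdicCompletion 𝔪 B) fun y => ?_
    obtain ⟨h, rfl⟩ := Ideal.Quotient.mk_surjective y
    obtain ⟨u, rfl⟩ := AdicCompletion.mk_surjective 𝔪 B h
    obtain ⟨a, ha⟩ := exists_C_sub_mem hk (u 1)
    refine ⟨algebraMap k _ a, ?_⟩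
    refine (Ideal.Quotient.mk_eq_mk_iff_sub_mem _ _).2 ?_
    have h3 : (𝔫).map (ψ : MvPowerSeries (Fin d) k →+* AdicCompletion 𝔪 B) = _ := hmap
    rw [h3, ← neg_mem_iff, neg_sub, AdicCompletion.mem_maximalIdeal_iff_eval_one_eq_zero]
    have h4 : ψ (algebraMap k _ a) = algebraMap B _ (algebraMap k B a) := ψ.commutes a
    change (AdicCompletion.mk 𝔪 B u - ψ (algebraMap k _ a)).1 1 = 0
    rw [h4]
    change (Submodule.Quotient.mk (u 1) : B ⧸ (𝔪 ^ 1 • ⊤ : Submodule B B)) -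
      Submodule.Quotient.mk (algebraMap k B a) = 0
    rw [← Submodule.Quotient.mk_sub, Submodule.Quotient.mk_eq_zero]
    simpa using ha
  let e : MvPowerSeries (Fin d) k ≃+* AdicCompletion 𝔪 B :=
    RingEquiv.ofBijective ψ ⟨hinj, hsurj⟩
  have : IsDomain (MvPowerSeries (Fin d) k) := NoZeroDivisors.to_isDomain _
  exact ⟨e.symm.toMulEquiv.isDomain _, e.toMulEquiv.uniqueFactorizationMonoid inferInstance⟩

theorem uniqueFactorizationMonoid_of_formallySmooth [IsNoetherianRing B] [Infinite k] [IsDomain B]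
    [Algebra.FormallySmooth k B] (hk : Function.Surjective (algebraMap k (ResidueField B))) :
    UniqueFactorizationMonoid B := by
  obtain ⟨h1, h2⟩ := uniqueFactorizationMonoid_adicCompletion hk
  exact uniqueFactorizationMonoid_of_flat B (AdicCompletion 𝔪 B)

end Completion
end GConst
end

noncomputable section
namespace GConst
open IsLocalRing

/-! ### Local factoriality of smooth algebras, and its algebraic consequences -/

section Factorial

/-- The local rings of a smooth algebra over an algebraically closed field are factorial. -/
theorem uniqueFactorizationMonoid_localization_of_smooth (k : Type*) [Field k] [IsAlgClosed k]
    {A : Type*} [CommRing A] [IsDomain A] [Algebra k A] [Algebra.FormallySmooth k A]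
    [Algebra.FiniteType k A] (p : Ideal A) [p.IsPrime] :
    UniqueFactorizationMonoid (Localization.AtPrime p) := by
  -- The completion argument needs residue field k, which the Nullstellensatz gives only at maximal
  -- ideals. The local ring at p is a localisation of the one at m.
  obtain ⟨m, hm, hpm⟩ := p.exists_le_maximal (Ideal.IsPrime.ne_top inferInstance)
  have : IsNoetherianRing A := Algebra.FiniteType.isNoetherianRing k A
  let B := Localization.AtPrime m
  have : IsNoetherianRing B := IsLocalization.isNoetherianRing m.primeCompl _ inferInstance
  have : IsDomain B := IsLocalization.isDomain_localization m.primeCompl_le_nonZeroDivisors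
  have : Algebra.FormallySmooth A B := Algebra.FormallySmooth.of_isLocalization m.primeCompl
  have : Algebra.FormallySmooth k B := Algebra.FormallySmooth.comp k A B
  have : Infinite k := IsAlgClosed.instInfinite
  have hk : Function.Surjective (algebraMap k (ResidueField B)) := by
    let : Field (A ⧸ m) := Ideal.Quotient.field m
    have : Module.Finite k (A ⧸ m) := finite_of_finite_type_of_isJacobsonRing k (A ⧸ m)
    have h1 : Function.Surjective (algebraMap k (A ⧸ m)) :=
      (IsAlgClosed.algebraMap_bijective_of_isIntegral (k := k) (K := A ⧸ m)).2
    have h2 : Function.Surjective (algebraMap A (ResidueField B)) :=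
      Ideal.algebraMap_residueField_surjective m
    intro z
    obtain ⟨a, rfl⟩ := h2 z
    obtain ⟨c, hc⟩ := h1 (Ideal.Quotient.mk m a)
    refine ⟨c, ?_⟩
    have h3 : algebraMap k A c - a ∈ m := (Ideal.Quotient.mk_eq_mk_iff_sub_mem _ _).1 hc
    rw [IsScalarTower.algebraMap_apply k A, ← sub_eq_zero, ← map_sub]
    exact (Ideal.algebraMap_residueField_eq_zero (I := m)).2 h3
  have hB : UniqueFactorizationMonoid B := uniqueFactorizationMonoid_of_formallySmooth hk
  have hle : m.primeCompl ≤ p.primeCompl := fun x hx hxp => hx (hpm hxp)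
  let := IsLocalization.localizationAlgebraOfSubmonoidLe B (Localization.AtPrime p) _ _ hle
  have := IsLocalization.localization_isScalarTower_of_submonoid_le B (Localization.AtPrime p) _ _ hle
  have := IsLocalization.isLocalization_of_submonoid_le B (Localization.AtPrime p) _ _ hle
  exact UniqueFactorizationMonoid.of_isLocalization
    (p.primeCompl.map (algebraMap A B)) (Localization.AtPrime p)

variable {A F : Type*} [CommRing A] [IsDomain A] [Field F] [Algebra A F] [IsFractionRing A F]

/-- In a locally factorial domain, fractions which are regular in codimension one are regular. -/
theorem mem_range_algebraMap_of_height_one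
    (hA : ∀ (p : Ideal A) [p.IsPrime], UniqueFactorizationMonoid (Localization.AtPrime p))
    [IsNoetherianRing A] (a : F)
    (ha : ∀ (q : Ideal A) [q.IsPrime], q.height = 1 →
      ∃ s ∉ q, ∃ r, algebraMap A F s * a = algebraMap A F r) :
    a ∈ (algebraMap A F).range := by
  -- The ideal of denominators of a. If it is proper, work at a maximal ideal p containing it.
  let I : Ideal A := 
    { carrier := {s | ∃ r, algebraMap A F s * a = algebraMap A F r}
      zero_mem' := ⟨0, by simp⟩
      add_mem' := by
        rintro s t ⟨r, hr⟩ ⟨r', hr'⟩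
        exact ⟨r + r', by simp [add_mul, hr, hr']⟩
      smul_mem' := by
        rintro c s ⟨r, hr⟩
        exact ⟨c * r, by simp [mul_assoc, hr]⟩ }
  by_cases hI : I = ⊤
  · have : (1 : A) ∈ I := hI ▸ Submodule.mem_top
    obtain ⟨r, hr⟩ := this
    exact ⟨r, by simpa using hr.symm⟩
  exfalso
  obtain ⟨p, hp, hIp⟩ := I.exists_le_maximal hI
  let O := Localization.AtPrime p
  let : Algebra O F := IsLocalization.localizationAlgebraOfSubmonoidLe O F p.primeCompl
    (nonZeroDivisors A) p.primeCompl_le_nonZeroDivisors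
  have : IsScalarTower A O F := IsLocalization.localization_isScalarTower_of_submonoid_le O F
    p.primeCompl (nonZeroDivisors A) p.primeCompl_le_nonZeroDivisors
  have : IsDomain O := IsLocalization.isDomain_localization p.primeCompl_le_nonZeroDivisors
  have : IsNoetherianRing O := IsLocalization.isNoetherianRing p.primeCompl _ inferInstance
  have : IsFractionRing O F :=
    IsFractionRing.isFractionRing_of_isDomain_of_isLocalization p.primeCompl O F
  have := hA p
  have hinj : Function.Injective (algebraMap O F) := IsFractionRing.injective O F
  obtain ⟨b, c, hbc, hac⟩ := IsFractionRing.exists_reduced_fraction (A := O) a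
  have hac : a * algebraMap O F c = algebraMap O F b := by
    rw [← hac, IsFractionRing.mk'_eq_div, div_mul_cancel₀]
    exact IsFractionRing.to_map_ne_zero_of_mem_nonZeroDivisors c.2
  by_cases hc : IsUnit (c : O)
  · obtain ⟨u, hu⟩ := hc
    obtain ⟨⟨r, s⟩, hrs⟩ := IsLocalization.surj p.primeCompl (b * ↑u⁻¹)
    refine s.2 (hIp ⟨r, ?_⟩)
    have h1 : a = algebraMap O F (b * ↑u⁻¹) := by
      rw [map_mul, ← hac, ← hu, mul_assoc, ← map_mul]
      simp
    rw [h1, IsScalarTower.algebraMap_apply A O F, IsScalarTower.algebraMap_apply A O F, ← map_mul,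
      ← hrs, mul_comm]
  · have hc0 : (c : O) ≠ 0 := nonZeroDivisors.ne_zero c.2
    -- An irreducible factor t of the reduced denominator generates a prime of height one by Krull's
    -- theorem. A denominator s of a outside this prime would make t divide the numerator b.
    obtain ⟨t, ht, htc⟩ := WfDvdMonoid.exists_irreducible_factor hc hc0
    have htp : Prime t := UniqueFactorizationMonoid.irreducible_iff_prime.1 ht
    let Q : Ideal O := Ideal.span {t}
    have hQ : Q.IsPrime := (Ideal.span_singleton_prime htp.ne_zero).2 htp
    have hQ1 : Q.height = 1 := by
      refine le_antisymm ?_ ?_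
      · refine Ideal.height_le_one_of_isPrincipal_of_mem_minimalPrimes Q Q ?_
        rw [Ideal.minimalPrimes_eq_subsingleton_self]
        rfl
      · rw [Order.one_le_iff_ne_zero, Ne, Ideal.height_eq_zero_iff_eq_bot]
        simpa [Q] using htp.ne_zero
    have hq1 : (Q.comap (algebraMap A O)).height = 1 := by
      exact (IsLocalization.height_under p.primeCompl Q).trans hQ1
    obtain ⟨s, hs, r, hsr⟩ := ha _ hq1
    apply hs
    have h1 : algebraMap A O s * b = algebraMap A O r * c := by
      apply hinj
      rw [map_mul, map_mul, ← hac, ← IsScalarTower.algebraMap_apply,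
        ← IsScalarTower.algebraMap_apply, ← mul_assoc, hsr]
    have h2 : t ∣ algebraMap A O s * b := h1 ▸ Dvd.dvd.mul_left htc _
    rcases htp.dvd_or_dvd h2 with h3 | h3
    · exact Ideal.mem_span_singleton.2 h3
    · exact absurd (hbc h3 htc) ht.not_isUnit

/-- In a locally factorial domain, a prime of height one is principal near any other prime. -/
lemma exists_local_generator (p q : Ideal A) [p.IsPrime] [q.IsPrime] [IsNoetherianRing A]
    (hp : UniqueFactorizationMonoid (Localization.AtPrime p)) (hq : q.height = 1) (hqp : q ≤ p) :
    ∃ t ∈ q, ∃ s ∉ p, ∀ x ∈ q, t ∣ s * x := by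
  let O := Localization.AtPrime p
  have : IsDomain O := IsLocalization.isDomain_localization p.primeCompl_le_nonZeroDivisors
  let Q : Ideal O := q.map (algebraMap A O)
  have hdisj : Disjoint (p.primeCompl : Set A) q :=
    Set.disjoint_left.2 fun x hx hxq => hx (hqp hxq)
  have hQ : Q.IsPrime := IsLocalization.isPrime_of_isPrime_disjoint p.primeCompl O q inferInstance hdisj
  have hcomap : Q.comap (algebraMap A O) = q :=
    IsLocalization.under_map_of_isPrime_disjoint p.primeCompl O inferInstance hdisj
  have hQ1 : Q.height = 1 := by
    rw [← IsLocalization.height_under p.primeCompl Q]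
    exact (congrArg Ideal.height hcomap).trans hq
  obtain ⟨g, hg⟩ := UniqueFactorizationMonoid.isPrincipal_of_height_eq_one hQ1
  obtain ⟨⟨t, u⟩, htu⟩ := IsLocalization.surj p.primeCompl g
  have hu : IsUnit (algebraMap A O u) := IsLocalization.map_units O u
  have hQt : Q = Ideal.span {algebraMap A O t} := by
    rw [hg, ← htu, Ideal.submodule_span_eq, Ideal.span_singleton_mul_right_unit hu]
  have htq : t ∈ q := by
    rw [← hcomap, Ideal.mem_comap, hQt]
    exact Ideal.mem_span_singleton_self _
  have key : ∀ x ∈ q, ∃ s ∉ p, t ∣ s * x := by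
    intro x hx
    have : algebraMap A O x ∈ Q := Ideal.mem_map_of_mem _ hx
    rw [hQt, Ideal.mem_span_singleton] at this
    obtain ⟨y, hy⟩ := this
    obtain ⟨⟨r, v⟩, hrv⟩ := IsLocalization.surj p.primeCompl y
    refine ⟨v, v.2, r, ?_⟩
    apply IsLocalization.injective O p.primeCompl_le_nonZeroDivisors
    rw [map_mul, map_mul, hy, mul_left_comm, mul_comm _ y, hrv]
  obtain ⟨T, hT⟩ := IsNoetherian.noetherian q
  have hTq : ∀ x ∈ T, x ∈ q := fun x hx => hT ▸ Ideal.subset_span hx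
  choose! σ hσp hσ using key
  -- Each generator of q has its own denominator; their product over a finite generating set serves
  -- all of q.
  refine ⟨t, htq, ∏ x ∈ T, σ x, ?_, ?_⟩
  · rw [Ideal.IsPrime.prod_mem_iff]
    push Not
    exact fun x hx => hσp x (hTq x hx)
  · intro x hx
    rw [← hT] at hx
    refine Submodule.span_induction ?_ ?_ ?_ ?_ hx
    · intro y hy
      exact (hσ y (hTq y hy)).trans (mul_dvd_mul_right (Finset.dvd_prod_of_mem σ hy) y)
    · simp
    · intro y z _ _ hy hz
      rw [mul_add]
      exact dvd_add hy hz
    · intro r y _ hy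
      rw [smul_eq_mul, mul_left_comm]
      exact hy.mul_left r

end Factorial
end GConst
end

noncomputable section
namespace GConst
open IsLocalRing

/-! ### Points of an affine open subset as prime ideals -/

section AffineOpen

variable {X : Scheme.{0}} {V : X.Opens} (hV : IsAffineOpen V)

include hV in
lemma exists_primeIdealOf_eq (q : PrimeSpectrum Γ(X, V)) :
    ∃ x : V, hV.primeIdealOf x = q := by
  have h : hV.fromSpec q ∈ V := by
    have := Set.mem_range_self (f := hV.fromSpec) q
    rwa [hV.range_fromSpec] at this
  refine ⟨⟨_, h⟩, ?_⟩
  apply hV.fromSpec.isOpenEmbedding.injective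
  rw [hV.fromSpec_primeIdealOf]

lemma primeIdealOf_injective : Function.Injective hV.primeIdealOf := by
  intro x y h
  apply Subtype.ext
  rw [← hV.fromSpec_primeIdealOf x, h, hV.fromSpec_primeIdealOf]

lemma mem_basicOpen_iff_primeIdealOf (f : Γ(X, V)) (x : V) :
    (x : X) ∈ X.basicOpen f ↔ f ∉ (hV.primeIdealOf x).asIdeal := by
  have h : hV.primeIdealOf x ∈ hV.fromSpec ⁻¹ᵁ X.basicOpen f ↔
      hV.primeIdealOf x ∈ PrimeSpectrum.basicOpen f := by
    rw [hV.fromSpec_preimage_basicOpen]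
    rfl
  rw [← PrimeSpectrum.mem_basicOpen, ← h]
  change _ ↔ hV.fromSpec (hV.primeIdealOf x) ∈ X.basicOpen f
  rw [hV.fromSpec_primeIdealOf]

lemma isUnit_germ_iff (f : Γ(X, V)) (x : V) :
    IsUnit (X.presheaf.germ V x x.2 f) ↔ f ∉ (hV.primeIdealOf x).asIdeal := by
  rw [← mem_basicOpen_iff_primeIdealOf hV, Scheme.mem_basicOpen X f x.1 x.2]

/-- Both sides are the Krull dimension of the local ring at x. -/
lemma height_primeIdealOf (x : V) :
    (hV.primeIdealOf x).asIdeal.height = Order.coheight (x : X) := by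
  let := X.presheaf.algebra_section_stalk x
  have := hV.isLocalization_stalk x
  have h := IsLocalization.AtPrime.ringKrullDim_eq_height (hV.primeIdealOf x).asIdeal
    (X.presheaf.stalk (x : X))
  rw [ringKrullDim_stalk_eq_coheight] at h
  exact_mod_cast h.symm

lemma uniqueFactorizationMonoid_localization {V : X.Opens} (hV : IsAffineOpen V)
    (hX : ∀ x : X, UniqueFactorizationMonoid (X.presheaf.stalk x))
    (p : Ideal Γ(X, V)) [hp : p.IsPrime] :
    UniqueFactorizationMonoid (Localization.AtPrime p) := by
  obtain ⟨x, hx⟩ := exists_primeIdealOf_eq hV ⟨p, hp⟩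
  let := X.presheaf.algebra_section_stalk x
  have h := hV.isLocalization_stalk x
  rw [hx] at h
  have e := IsLocalization.algEquiv p.primeCompl (X.presheaf.stalk (x : X)) (Localization.AtPrime p)
  exact e.toMulEquiv.uniqueFactorizationMonoid (hX x)

end AffineOpen

/-! ### Orders of rational functions on locally factorial schemes -/

section LocallyFactorial

variable {X : Scheme.{0}} [IsIntegral X]

/-- The regular functions on a nonempty open subset as rational functions, in terms of germs. -/
lemma exists_mul_eq_of_mem_range_stalk {V : X.Opens} (hV : IsAffineOpen V) [Nonempty V] (x : V)
    {a : X.functionField} (ha : a ∈ (algebraMap (X.presheaf.stalk (x : X)) X.functionField).range) :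
    ∃ s ∉ (hV.primeIdealOf x).asIdeal, ∃ r : Γ(X, V),
      algebraMap Γ(X, V) X.functionField s * a = algebraMap Γ(X, V) X.functionField r := by
  obtain ⟨b, rfl⟩ := ha
  let := X.presheaf.algebra_section_stalk x
  have := hV.isLocalization_stalk x
  have := functionField_isScalarTower X V x
  obtain ⟨⟨r, s⟩, hrs⟩ := IsLocalization.surj (hV.primeIdealOf x).asIdeal.primeCompl b
  refine ⟨s, s.2, r, ?_⟩
  rw [IsScalarTower.algebraMap_apply Γ(X, V) (X.presheaf.stalk (x : X)),
    IsScalarTower.algebraMap_apply Γ(X, V) (X.presheaf.stalk (x : X)) _ r, ← map_mul, ← hrs, mul_comm]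

variable [IsLocallyNoetherian X]

/-- Height one primes of a factorial domain are principal, and here the maximal ideal is one. -/
lemma isDiscreteValuationRing_stalk (hX : ∀ x : X, UniqueFactorizationMonoid (X.presheaf.stalk x))
    {P : X} (hP : Order.coheight P = 1) : IsDiscreteValuationRing (X.presheaf.stalk P) := by
  have hd : ringKrullDim (X.presheaf.stalk P) = 1 := by
    rw [ringKrullDim_stalk_eq_coheight, hP]; rfl
  have hf : ¬ IsField (X.presheaf.stalk P) := fun h => by
    rw [ringKrullDim_eq_zero_of_isField h] at hd
    exact zero_ne_one hd
  have hm : (maximalIdeal (X.presheaf.stalk P)).height = 1 := by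
    have := IsLocalRing.maximalIdeal_height_eq_ringKrullDim (R := X.presheaf.stalk P)
    rw [hd] at this
    exact_mod_cast this
  have := hX P
  exact ((IsDiscreteValuationRing.TFAE _ hf).out 0 4).2
    (UniqueFactorizationMonoid.isPrincipal_of_height_eq_one hm)

lemma ord_nonneg_iff (hX : ∀ x : X, UniqueFactorizationMonoid (X.presheaf.stalk x))
    {P : X} (hP : Order.coheight P = 1) {a : X.functionField} (ha : a ≠ 0) :
    0 ≤ Scheme.ord a P ↔ a ∈ (algebraMap (X.presheaf.stalk P) X.functionField).range := by
  have := isDiscreteValuationRing_stalk hX hP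
  rw [Scheme.le_ord_iff hP ha, ofAdd_zero, Scheme.ordHom]
  constructor
  · intro h
    rw [Ring.ordFrac_eq_valuation_inv] at h
    apply IsDiscreteValuationRing.exists_lift_of_le_one
    exact (one_le_inv₀ (by simpa [zero_lt_iff] using ha)).1 h
  · rintro ⟨b, rfl⟩
    have : Ring.KrullDimLE 1 (X.presheaf.stalk P) := krullDimLE_of_coheight_le hP.le
    exact Ring.ordFrac_ge_one_of_ne_zero (fun h => ha (by rw [h, map_zero]))

lemma ord_eq_zero_of_isUnit {P : X} (hP : Order.coheight P = 1) {b : X.presheaf.stalk P}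
    (hb : IsUnit b) : Scheme.ord (algebraMap _ X.functionField b) P = 0 := by
  have : Ring.KrullDimLE 1 (X.presheaf.stalk P) := krullDimLE_of_coheight_le hP.le
  rw [Scheme.ord_eq_iff hP (hb.map _).ne_zero]
  exact Ring.ordFrac_of_isUnit hb

lemma ord_eq_one_of_maximalIdeal_eq
    (hX : ∀ x : X, UniqueFactorizationMonoid (X.presheaf.stalk x))
    {P : X} (hP : Order.coheight P = 1) {b : X.presheaf.stalk P}
    (hb : maximalIdeal (X.presheaf.stalk P) = Ideal.span {b}) :
    Scheme.ord (algebraMap _ X.functionField b) P = 1 := by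
  have := isDiscreteValuationRing_stalk hX hP
  have hirr : Irreducible b := (IsDiscreteValuationRing.irreducible_iff_uniformizer b).2 hb
  rw [Scheme.ord_eq_iff hP]
  · exact Ring.ordFrac_irreducible hirr
  · exact (map_ne_zero_iff _ (IsFractionRing.injective _ _)).2 hirr.ne_zero

lemma ord_one (P : X) : Scheme.ord (1 : X.functionField) P = 0 := by
  have := Scheme.ord_mul (x := P) (one_ne_zero (α := X.functionField)) one_ne_zero
  rw [one_mul] at this
  omega

lemma ord_pow {a : X.functionField} (ha : a ≠ 0) (P : X) (k : ℕ) :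
    Scheme.ord (a ^ k) P = k * Scheme.ord a P := by
  induction k with
  | zero => simp [ord_one]
  | succ k ih => rw [pow_succ, Scheme.ord_mul (pow_ne_zero _ ha) ha, ih]; push_cast; ring

lemma ord_inv {a : X.functionField} (ha : a ≠ 0) (P : X) :
    Scheme.ord a⁻¹ P = - Scheme.ord a P := by
  have := Scheme.ord_mul (x := P) ha (inv_ne_zero ha)
  rw [mul_inv_cancel₀ ha, ord_one] at this
  omega

lemma ord_zpow {a : X.functionField} (ha : a ≠ 0) (P : X) (k : ℤ) :
    Scheme.ord (a ^ k) P = k * Scheme.ord a P := by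
  obtain ⟨k, rfl | rfl⟩ := k.eq_nat_or_neg
  · simp [ord_pow ha]
  · simp [ord_inv (pow_ne_zero k ha), ord_pow ha]

/-- On a locally factorial scheme, rational functions without poles are regular. -/
theorem mem_range_of_ord_nonneg (hX : ∀ x : X, UniqueFactorizationMonoid (X.presheaf.stalk x))
    {V : X.Opens} (hV : IsAffineOpen V) [Nonempty V] {a : X.functionField} (ha : a ≠ 0)
    (h : ∀ P ∈ V, Order.coheight P = 1 → 0 ≤ Scheme.ord a P) :
    a ∈ (algebraMap Γ(X, V) X.functionField).range := by
  have := functionField_isFractionRing_of_isAffineOpen X V hV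
  have : IsNoetherianRing Γ(X, V) := IsLocallyNoetherian.component_noetherian ⟨V, hV⟩
  refine mem_range_algebraMap_of_height_one
    (fun p _ => uniqueFactorizationMonoid_localization hV hX p) a fun q hq hq1 => ?_
  obtain ⟨x, hx⟩ := exists_primeIdealOf_eq hV ⟨q, hq⟩
  have hx1 : Order.coheight (x : X) = 1 := by
    rw [← height_primeIdealOf hV, hx, hq1]
  have := exists_mul_eq_of_mem_range_stalk hV x
    ((ord_nonneg_iff hX hx1 ha).1 (h x x.2 hx1))
  rwa [hx] at this

lemma ord_algebraMap_eq_zero {V : X.Opens} (hV : IsAffineOpen V) [Nonempty V] {P : X}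
    (hP : Order.coheight P = 1) (hPV : P ∈ V) {t : Γ(X, V)}
    (ht : t ∉ (hV.primeIdealOf ⟨P, hPV⟩).asIdeal) :
    Scheme.ord (algebraMap Γ(X, V) X.functionField t) P = 0 := by
  have h := ord_eq_zero_of_isUnit hP ((isUnit_germ_iff hV t ⟨P, hPV⟩).2 ht)
  rwa [Scheme.algebraMap_germ_eq_germToFunctionField] at h

lemma eq_of_le_of_height_eq_one {R : Type*} [CommRing R] [IsDomain R] {p q : Ideal R} [p.IsPrime]
    [q.IsPrime] (hp : p ≠ ⊥) (hpq : p ≤ q) (hq : q.height = 1) : p = q := by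
  by_contra hne
  have h1 := Ideal.height_add_one_le_of_lt_of_isPrime (lt_of_le_of_ne hpq hne)
  rw [hq] at h1
  have h2 : p.height ≤ 0 := by
    rwa [← ENat.add_le_add_iff_right ENat.one_ne_top, zero_add]
  exact hp (Ideal.height_eq_zero_iff_eq_bot.1 (le_antisymm h2 bot_le))

/-- A rational function has nonzero order at finitely many prime divisors of an affine open. -/
lemma finite_ord_ne_zero {V : X.Opens} (hV : IsAffineOpen V) {a : X.functionField} (ha : a ≠ 0) :
    {P | P ∈ V ∧ Order.coheight P = 1 ∧ Scheme.ord a P ≠ 0}.Finite := by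
  rcases isEmpty_or_nonempty V with hE | hE
  · convert Set.finite_empty (α := X)
    ext P
    simp only [Set.mem_ofPred_eq, Set.mem_empty_iff_false, iff_false, not_and]
    exact fun h => (hE.false ⟨P, h⟩).elim
  have := functionField_isFractionRing_of_isAffineOpen X V hV
  have : IsNoetherianRing Γ(X, V) := IsLocallyNoetherian.component_noetherian ⟨V, hV⟩
  obtain ⟨r, s, hs, rfl⟩ := IsFractionRing.div_surjective (A := Γ(X, V)) a
  have hs0 : s ≠ 0 := nonZeroDivisors.ne_zero hs
  have hr0 : r ≠ 0 := by rintro rfl; simp at ha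
  have hinj := IsFractionRing.injective Γ(X, V) X.functionField
  have hr1 : algebraMap Γ(X, V) X.functionField r ≠ 0 := (map_ne_zero_iff _ hinj).2 hr0
  have hs1 : algebraMap Γ(X, V) X.functionField s ≠ 0 := (map_ne_zero_iff _ hinj).2 hs0
  -- The order of r/s vanishes at P unless rs lies in the prime of P. Having height one, that prime
  -- is then minimal over (rs).
  have hfin := (Ideal.finite_minimalPrimes_of_isNoetherianRing _ (Ideal.span {r * s}))
  refine ((hfin.preimage (f := fun x : V => (hV.primeIdealOf x).asIdeal) ?_).image
    Subtype.val).subset ?_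
  · exact fun x _ y _ h => primeIdealOf_injective hV (PrimeSpectrum.ext h)
  · rintro P ⟨hPV, hP, hord⟩
    refine ⟨⟨P, hPV⟩, ?_, rfl⟩
    have hmem : r * s ∈ (hV.primeIdealOf ⟨P, hPV⟩).asIdeal := by
      by_contra hrs
      apply hord
      have hzero : ∀ t : Γ(X, V), t ∉ (hV.primeIdealOf ⟨P, hPV⟩).asIdeal →
          Scheme.ord (algebraMap Γ(X, V) X.functionField t) P = 0 := fun t ht =>
        ord_algebraMap_eq_zero hV hP hPV ht
      rw [div_eq_mul_inv, Scheme.ord_mul hr1 (inv_ne_zero hs1), ord_inv hs1,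
        hzero r fun h => hrs (Ideal.mul_mem_right _ _ h),
        hzero s fun h => hrs (Ideal.mul_mem_left _ _ h)]
      rfl
    obtain ⟨q, hq, hqP⟩ := Ideal.exists_minimalPrimes_le
      ((Ideal.span_singleton_le_iff_mem _).2 hmem)
    have : q = (hV.primeIdealOf ⟨P, hPV⟩).asIdeal := by
      have := hq.1.1
      refine eq_of_le_of_height_eq_one ?_ hqP ?_
      · rintro rfl
        have : r * s ∈ (⊥ : Ideal Γ(X, V)) := hq.1.2 (Ideal.mem_span_singleton_self _)
        exact mul_ne_zero hr0 hs0 this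
      · rw [height_primeIdealOf, hP]
    change (hV.primeIdealOf ⟨P, hPV⟩).asIdeal ∈ (Ideal.span {r * s}).minimalPrimes
    rw [← this]
    exact hq

/-- On a locally factorial scheme, a prime divisor is principal near every point. -/
lemma exists_ord_eq_single (hX : ∀ x : X, UniqueFactorizationMonoid (X.presheaf.stalk x))
    {P : X} (hP : Order.coheight P = 1) {V : X.Opens} (hV : IsAffineOpen V) {y : X} (hy : y ∈ V) :
    ∃ W ≤ V, IsAffineOpen W ∧ y ∈ W ∧ ∃ t : X.functionField, t ≠ 0 ∧
      ∀ Q ∈ W, Order.coheight Q = 1 → (Q = P → Scheme.ord t Q = 1) ∧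
        (Q ≠ P → Scheme.ord t Q = 0) := by
  have : Nonempty V := ⟨⟨y, hy⟩⟩
  -- On a neighbourhood of y that avoids P, the function 1 will do.
  have hrefl : ∀ W ≤ V, IsAffineOpen W → y ∈ W → P ∉ W → ∃ W ≤ V, IsAffineOpen W ∧ y ∈ W ∧
      ∃ t : X.functionField, t ≠ 0 ∧ ∀ Q ∈ W, Order.coheight Q = 1 →
        (Q = P → Scheme.ord t Q = 1) ∧ (Q ≠ P → Scheme.ord t Q = 0) :=
    fun W hWV hW hyW hPW => ⟨W, hWV, hW, hyW, 1, one_ne_zero, fun Q hQ _ =>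
      ⟨fun h => (hPW (h ▸ hQ)).elim, fun _ => ord_one Q⟩⟩
  by_cases hPV : P ∈ V
  swap
  · exact hrefl V le_rfl hV hy hPV
  let q := (hV.primeIdealOf ⟨P, hPV⟩).asIdeal
  let p := (hV.primeIdealOf ⟨y, hy⟩).asIdeal
  have hq1 : q.height = 1 := (height_primeIdealOf hV _).trans hP
  by_cases hqp : q ≤ p
  swap
  · obtain ⟨s, hsq, hsp⟩ := SetLike.not_le_iff_exists.1 hqp
    refine hrefl (X.basicOpen s) (X.basicOpen_le s) (hV.basicOpen s) ?_ ?_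
    · exact (mem_basicOpen_iff_primeIdealOf hV s ⟨y, hy⟩).2 hsp
    · exact fun h => (mem_basicOpen_iff_primeIdealOf hV s ⟨P, hPV⟩).1 h hsq
  have : IsNoetherianRing Γ(X, V) := IsLocallyNoetherian.component_noetherian ⟨V, hV⟩
  obtain ⟨t, htq, s, hsp, hst⟩ := exists_local_generator p q
    (uniqueFactorizationMonoid_localization hV hX p) hq1 hqp
  have ht0 : t ≠ 0 := by
    rintro rfl
    have hq0 : q = ⊥ := by
      rw [eq_bot_iff]
      intro x hx
      have := zero_dvd_iff.1 (hst x hx)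
      exact (mul_eq_zero.1 this).resolve_left fun h => hsp (h ▸ zero_mem _)
    rw [Ideal.height_eq_zero_iff_eq_bot.2 hq0] at hq1
    exact zero_ne_one hq1
  refine ⟨X.basicOpen s, X.basicOpen_le s, hV.basicOpen s,
    (mem_basicOpen_iff_primeIdealOf hV s ⟨y, hy⟩).2 hsp, algebraMap Γ(X, V) X.functionField t,
    (map_ne_zero_iff _ (X.germToFunctionField_injective V)).2 ht0, fun Q hQ hQ1 => ?_⟩
  have hQV : Q ∈ V := X.basicOpen_le s hQ
  have hsQ := (mem_basicOpen_iff_primeIdealOf hV s ⟨Q, hQV⟩).1 hQ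
  constructor
  · rintro rfl
    let := X.presheaf.algebra_section_stalk ⟨Q, hPV⟩
    have := hV.isLocalization_stalk ⟨Q, hPV⟩
    have := functionField_isScalarTower X V ⟨Q, hPV⟩
    rw [IsScalarTower.algebraMap_apply Γ(X, V) (X.presheaf.stalk Q)]
    refine ord_eq_one_of_maximalIdeal_eq hX hP ?_
    rw [← IsLocalization.AtPrime.map_eq_maximalIdeal q (X.presheaf.stalk Q)]
    refine le_antisymm ?_ ?_
    · rw [Ideal.map_le_iff_le_comap]
      intro x hx
      rw [Ideal.mem_comap, Ideal.mem_span_singleton]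
      have h1 := map_dvd (algebraMap Γ(X, V) (X.presheaf.stalk Q)) (hst x hx)
      rw [map_mul] at h1
      exact ((IsLocalization.map_units (X.presheaf.stalk Q)
        (⟨s, hsQ⟩ : q.primeCompl)).dvd_mul_left).1 h1
    · rw [Ideal.span_singleton_le_iff_mem]
      exact Ideal.mem_map_of_mem _ htq
  · intro hQP
    refine ord_algebraMap_eq_zero hV hQ1 hQV fun htQ => hQP ?_
    -- Since s is invertible at Q and t divides s·x for all x in q, vanishing of t at Q forces q
    -- into the prime of Q; equal heights give Q = P.
    have hle : q ≤ (hV.primeIdealOf ⟨Q, hQV⟩).asIdeal := by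
      intro x hx
      have := Ideal.mem_of_dvd _ (hst x hx) htQ
      exact ((hV.primeIdealOf ⟨Q, hQV⟩).2.mem_or_mem this).resolve_left hsQ
    have heq := eq_of_le_of_height_eq_one (p := q) (fun h => by
      rw [Ideal.height_eq_zero_iff_eq_bot.2 h] at hq1
      exact zero_ne_one hq1) hle ((height_primeIdealOf hV _).trans hQ1)
    exact congrArg Subtype.val (primeIdealOf_injective hV (PrimeSpectrum.ext heq)).symm

/-- On a locally factorial scheme, Weil divisors are locally principal. -/
lemma exists_ord_eq_of_finset (hX : ∀ x : X, UniqueFactorizationMonoid (X.presheaf.stalk x))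
    (m : X → ℤ) {V : X.Opens} (hV : IsAffineOpen V) {y : X} (hy : y ∈ V) (S : Finset X)
    (hS : ∀ P ∈ S, Order.coheight P = 1) :
    ∃ W ≤ V, IsAffineOpen W ∧ y ∈ W ∧ ∃ t : X.functionField, t ≠ 0 ∧
      ∀ Q ∈ W, Order.coheight Q = 1 → (Q ∈ S → Scheme.ord t Q = m Q) ∧
        (Q ∉ S → Scheme.ord t Q = 0) := by
  classical
  induction S using Finset.induction_on with
  | empty => exact ⟨V, le_rfl, hV, hy, 1, one_ne_zero, fun Q _ _ => ⟨by simp, fun _ => ord_one Q⟩⟩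
  | insert P S hPS ih =>
    obtain ⟨W, hWV, hW, hyW, t, ht, h⟩ := ih fun Q hQ => hS Q (Finset.mem_insert_of_mem hQ)
    obtain ⟨W', hWW', hW', hyW', u, hu, h'⟩ :=
      exists_ord_eq_single hX (hS P (Finset.mem_insert_self _ _)) hW hyW
    refine ⟨W', hWW'.trans hWV, hW', hyW', t * u ^ m P, mul_ne_zero ht (zpow_ne_zero _ hu),
      fun Q hQ hQ1 => ?_⟩
    rw [Scheme.ord_mul ht (zpow_ne_zero _ hu), ord_zpow hu]
    obtain ⟨h1, h2⟩ := h Q (hWW' hQ) hQ1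
    obtain ⟨h3, h4⟩ := h' Q hQ hQ1
    by_cases hQP : Q = P
    · subst hQP
      simp [h2 hPS, h3 rfl]
    · simp only [Finset.mem_insert, hQP, false_or, h4 hQP, mul_zero, add_zero]
      exact ⟨h1, h2⟩

/-- Locally, there is a rational function `b` with `ord b = ⌊ord a / N⌋`. -/
theorem exists_ord_eq_floor (hX : ∀ x : X, UniqueFactorizationMonoid (X.presheaf.stalk x))
    {a : X.functionField} (ha : a ≠ 0) (N : ℕ) {U : X.Opens} {y : X} (hy : y ∈ U) :
    ∃ W ≤ U, IsAffineOpen W ∧ y ∈ W ∧ ∃ b : X.functionField, b ≠ 0 ∧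
      ∀ Q ∈ W, Order.coheight Q = 1 → Scheme.ord b Q = Scheme.ord a Q / N := by
  obtain ⟨_, ⟨V, hV, rfl⟩, hyV, hVU⟩ := X.isBasis_affineOpens.exists_subset_of_mem_open hy U.isOpen
  have hfin := finite_ord_ne_zero hV ha
  obtain ⟨W, hWV, hW, hyW, b, hb, h⟩ := exists_ord_eq_of_finset hX (fun Q => Scheme.ord a Q / N)
    hV hyV hfin.toFinset (fun P hP => by simp at hP; exact hP.2.1)
  refine ⟨W, hWV.trans hVU, hW, hyW, b, hb, fun Q hQ hQ1 => ?_⟩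
  obtain ⟨h1, h2⟩ := h Q hQ hQ1
  -- Outside the finite set where a has nonzero order, the required floor is 0 as well.
  by_cases h0 : Scheme.ord a Q = 0
  · rw [h0, Int.zero_ediv, h2]
    simp [h0]
  · exact h1 (by simpa using ⟨hWV hQ, hQ1, h0⟩)

end LocallyFactorial
end GConst
end

noncomputable section
namespace GConst

/-! ### Weights: the isotypic decomposition of K(ℂⁿ) -/

section Action

variable {G : Type*} [CommGroup G] {n : ℕ} (ρ : G →* Matrix.GeneralLinearGroup (Fin n) ℂ)

lemma actK_algebraMap (g : G) (f : MvPolynomial (Fin n) ℂ) :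
    actK ρ g (algebraMap _ (K n) f) = algebraMap _ (K n) (actHom ρ g f) :=
  IsFractionRing.ringEquivOfRingEquiv_algebraMap _ _

lemma actK_mul (g h : G) (x : K n) : actK ρ (g * h) x = actK ρ g (actK ρ h x) := by
  obtain ⟨p, q, -, rfl⟩ := IsFractionRing.div_surjective (A := MvPolynomial (Fin n) ℂ) x
  simp only [map_div₀, actK_algebraMap, actHom_mul]

lemma actK_one (x : K n) : actK ρ 1 x = x := by
  obtain ⟨p, q, -, rfl⟩ := IsFractionRing.div_surjective (A := MvPolynomial (Fin n) ℂ) x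
  simp only [map_div₀, actK_algebraMap, actHom_one]

lemma actK_const (g : G) (c : ℂ) : actK ρ g (algebraMap ℂ (K n) c) = algebraMap ℂ (K n) c := by
  rw [IsScalarTower.algebraMap_apply ℂ (MvPolynomial (Fin n) ℂ) (K n), actK_algebraMap,
    AlgHom.commutes]

/-- The action on the coordinate functions recovers the matrix of ρ g⁻¹. Distinctness of the
automorphisms is the hypothesis of Dedekind's theorem in `exists_isHomogeneous_ne_zero`. -/
lemma actK_injective (hρ : Function.Injective ρ) :
    Function.Injective fun g : G => (actK ρ g : K n →* K n) := by
  intro g h hgh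
  have h1 : ∀ f, actHom ρ g f = actHom ρ h f := fun f => by
    apply IsFractionRing.injective (MvPolynomial (Fin n) ℂ) (K n)
    rw [← actK_algebraMap, ← actK_algebraMap]
    exact DFunLike.congr_fun hgh _
  have h2 : (ρ g⁻¹).val = (ρ h⁻¹).val := by
    apply Matrix.mulVec_injective
    funext v i
    have := congrArg (MvPolynomial.eval v) (h1 (MvPolynomial.X i))
    rwa [eval_actHom, eval_actHom, MvPolynomial.eval_X, MvPolynomial.eval_X] at this
  exact inv_injective (hρ (Units.ext h2))

variable {ρ}

namespace IsHomogeneous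

variable {χ ψ : G →* ℂˣ} {f f' : K n}

lemma mul_of_invariant (hf : IsHomogeneous ρ χ f) (hf' : ∀ g, actK ρ g f' = f') :
    IsHomogeneous ρ χ (f' * f) := fun g => by rw [map_mul, hf, hf', mul_left_comm]

lemma inv (hf : IsHomogeneous ρ χ f) : IsHomogeneous ρ χ⁻¹ f⁻¹ := fun g => by
  rw [map_inv₀, hf, mul_inv]
  congr 1
  rw [← map_inv₀, MonoidHom.inv_apply, Units.val_inv_eq_inv_val]

lemma div_invariant (hf : IsHomogeneous ρ χ f) (hf' : IsHomogeneous ρ χ f') (g : G) :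
    actK ρ g (f / f') = f / f' := by
  rw [map_div₀, hf, hf', mul_div_mul_left]
  exact (map_ne_zero _).2 (Units.ne_zero _)

lemma pow_invariant [Finite G] (hf : IsHomogeneous ρ χ f) (g : G) :
    actK ρ g (f ^ Nat.card G) = f ^ Nat.card G := by
  rw [map_pow, hf, mul_pow, ← map_pow, ← Units.val_pow_eq_pow_val, ← map_pow, pow_card_eq_one',
    map_one, Units.val_one, map_one, one_mul]

end IsHomogeneous

variable [Fintype G] (ρ)

/-- The projection to the functions of weight `χ`, up to the factor `|G|`. -/
def isotypicSum (χ : G →* ℂˣ) (x : K n) : K n :=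
  ∑ g, algebraMap ℂ (K n) (χ g : ℂˣ) * actK ρ g x

lemma isHomogeneous_isotypicSum (χ : G →* ℂˣ) (x : K n) :
    IsHomogeneous ρ χ (isotypicSum ρ χ x) := by
  intro h
  rw [isotypicSum, map_sum, Finset.mul_sum]
  refine Fintype.sum_equiv (Equiv.mulLeft h) _ _ fun g => ?_
  rw [map_mul, actK_const, Equiv.coe_mulLeft, actK_mul, ← mul_assoc, ← map_mul, ← Units.val_mul,
    ← map_mul, inv_mul_cancel_left]

/-- If every `isotypicSum` for χ vanished, the distinct automorphisms `actK ρ g` would satisfy a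
linear relation with coefficients χ g, against Dedekind's independence theorem. -/
lemma exists_isHomogeneous_ne_zero (hρ : Function.Injective ρ) (χ : G →* ℂˣ) :
    ∃ f : K n, f ≠ 0 ∧ IsHomogeneous ρ χ f := by
  by_contra! h
  have h0 : ∀ x, isotypicSum ρ χ x = 0 := fun x => by
    by_contra hx
    exact h _ hx (isHomogeneous_isotypicSum ρ χ x)
  have hli := (linearIndependent_monoidHom (K n) (K n)).comp _ (actK_injective ρ hρ)
  have := Fintype.linearIndependent_iff.1 hli (fun g => algebraMap ℂ (K n) (χ g : ℂˣ)) (by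
    funext x
    rw [Finset.sum_apply]
    exact h0 x) 1
  simp at this

/-- Orthogonality: ∑ χ(g) over all χ is zero for g ≠ 1, because characters separate the elements of
a finite abelian group. -/
lemma sum_isotypicSum [Fintype (G →* ℂˣ)] (x : K n) :
    ∑ χ : G →* ℂˣ, isotypicSum ρ χ x = (Fintype.card (G →* ℂˣ) : K n) * x := by
  simp only [isotypicSum]
  rw [Finset.sum_comm, Finset.sum_eq_single 1]
  · simp [actK_one]
  · intro g _ hg
    rw [← Finset.sum_mul, ← map_sum]
    obtain ⟨φ, hφ⟩ := CommGroup.exists_apply_ne_one_of_hasEnoughRootsOfUnity G ℂ hg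
    let e : (G →* ℂˣ) →* ℂ := (Units.coeHom ℂ).comp (MonoidHom.eval g)
    have he : e ≠ 1 := fun h => hφ (Units.ext (DFunLike.congr_fun h φ))
    have := sum_hom_units_eq_zero e he
    rw [show ∑ χ : G →* ℂˣ, ((χ g : ℂˣ) : ℂ) = 0 from this]
    simp
  · simp

end Action

instance nonempty_top (X : Scheme.{0}) [Nonempty X] : Nonempty (⊤ : X.Opens) :=
  ⟨⟨Classical.arbitrary X, trivial⟩⟩

/-! ### K(Y) as the field of invariants, and valuations of homogeneous functions -/

namespace Resolution

variable {G : Type*} [CommGroup G] {n : ℕ} {ρ : G →* Matrix.GeneralLinearGroup (Fin n) ℂ}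
  (𝒴 : Resolution ρ)

/-- Resolutions are locally factorial. -/
theorem uniqueFactorizationMonoid_stalk (y : 𝒴.Y) :
    UniqueFactorizationMonoid (𝒴.Y.presheaf.stalk y) := by
  obtain ⟨_, ⟨V, hV, rfl⟩, hyV, -⟩ :=
    𝒴.Y.isBasis_affineOpens.exists_subset_of_mem_open (Set.mem_univ y) isOpen_univ
  have := 𝒴.smooth
  have : Nonempty V := ⟨⟨y, hyV⟩⟩
  let φ : ℂ →+* Γ(𝒴.Y, V) := ((𝒴.π ≫ quotientStr ρ).appLE ⊤ V le_top).hom.comp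
    (Scheme.ΓSpecIso (.of ℂ)).inv.hom
  have hφ : φ.Smooth := RingHom.Smooth.comp
    (RingHom.Smooth.of_bijective (ConcreteCategory.bijective_of_isIso (Scheme.ΓSpecIso (.of ℂ)).inv))
    (Scheme.Hom.smooth_appLE (𝒴.π ≫ quotientStr ρ) (isAffineOpen_top _) hV le_top)
  let := φ.toAlgebra
  have : Algebra.Smooth ℂ Γ(𝒴.Y, V) := hφ
  let := 𝒴.Y.presheaf.algebra_section_stalk ⟨y, hyV⟩
  have h := hV.isLocalization_stalk ⟨y, hyV⟩
  have e := IsLocalization.algEquiv (hV.primeIdealOf ⟨y, hyV⟩).asIdeal.primeCompl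
    (𝒴.Y.presheaf.stalk y) (Localization.AtPrime (hV.primeIdealOf ⟨y, hyV⟩).asIdeal)
  exact e.symm.toMulEquiv.uniqueFactorizationMonoid
    (uniqueFactorizationMonoid_localization_of_smooth ℂ _)

lemma toFunctionField_eq (r : invariants ρ) :
    𝒴.toFunctionField r = (𝒴.Y.germToFunctionField ⊤).hom
      (𝒴.π.appTop.hom ((Scheme.ΓSpecIso (.of (invariants ρ))).inv.hom r)) := by
  have h := 𝒴.π.germ_stalkMap_apply ⊤ (genericPoint 𝒴.Y) trivial
    ((Scheme.ΓSpecIso (.of (invariants ρ))).inv.hom r)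
  exact h

lemma actK_embed (g : G) (a : 𝒴.Y.functionField) : actK ρ g (𝒴.embed a) = 𝒴.embed a := by
  let := 𝒴.toFunctionField.toAlgebra
  have := 𝒴.isFractionRing
  obtain ⟨r, s, -, rfl⟩ := IsFractionRing.div_surjective (A := invariants ρ) a
  have h : ∀ r, actK ρ g (𝒴.embed (algebraMap (invariants ρ) 𝒴.Y.functionField r)) =
      𝒴.embed (algebraMap (invariants ρ) 𝒴.Y.functionField r) := fun r => by
    change actK ρ g (𝒴.embed (𝒴.toFunctionField r)) = 𝒴.embed (𝒴.toFunctionField r)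
    rw [embed_toFunctionField, actK_algebraMap, (mem_invariants ρ r.1).1 r.2 g]
  simp only [map_div₀, h]

/-- The function field of `Y` is the field of invariants. -/
lemma exists_embed_eq [Finite G] {x : K n} (hx : ∀ g, actK ρ g x = x) : ∃ a, 𝒴.embed a = x := by
  cases nonempty_fintype G
  obtain ⟨p, q, hq, hpq⟩ := IsFractionRing.div_surjective (A := MvPolynomial (Fin n) ℂ) x
  have hinj := IsFractionRing.injective (MvPolynomial (Fin n) ℂ) (K n)
  have hq0 : q ≠ 0 := nonZeroDivisors.ne_zero hq
  -- Replacing the denominator q by its norm makes it invariant, and then the numerator x·N is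
  -- invariant too.
  let N : MvPolynomial (Fin n) ℂ := ∏ g, actHom ρ g q
  have hN : N ∈ invariants ρ := by
    rw [mem_invariants]
    intro h
    simp only [N, map_prod]
    exact Fintype.prod_equiv (Equiv.mulLeft h) _ _ fun g => by simp [actHom_mul]
  have hN0 : N ≠ 0 := Finset.prod_ne_zero_iff.2 fun g _ =>
    (map_ne_zero_iff _ (act ρ g).injective).2 hq0
  obtain ⟨c, hc⟩ : q ∣ N := by
    have := Finset.dvd_prod_of_mem (fun g => actHom ρ g q) (Finset.mem_univ 1)
    rwa [actHom_one] at this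
  have hxN : x * algebraMap _ (K n) N = algebraMap _ (K n) (p * c) := by
    rw [← hpq, hc, map_mul, map_mul, ← mul_assoc, div_mul_cancel₀]
    exact (map_ne_zero_iff _ hinj).2 hq0
  have hpc : p * c ∈ invariants ρ := by
    rw [mem_invariants]
    intro g
    apply hinj
    rw [← actK_algebraMap, ← hxN, map_mul, hx, actK_algebraMap, (mem_invariants ρ N).1 hN]
  refine ⟨𝒴.toFunctionField ⟨p * c, hpc⟩ / 𝒴.toFunctionField ⟨N, hN⟩, ?_⟩
  rw [map_div₀, embed_toFunctionField, embed_toFunctionField, ← hxN, mul_div_assoc, div_self,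
    mul_one]
  exact (map_ne_zero_iff _ hinj).2 hN0

/-- The inclusion of a local ring of `Y` in `K(ℂⁿ)`. -/
def stalkToK (y : 𝒴.Y) : 𝒴.Y.presheaf.stalk y →+* K n :=
  𝒴.embed.comp (algebraMap (𝒴.Y.presheaf.stalk y) 𝒴.Y.functionField)

/-- The inclusion of the regular functions on an open subset of `Y` in `K(ℂⁿ)`. -/
def sectionToK (U : 𝒴.Y.Opens) [Nonempty U] : Γ(𝒴.Y, U) →+* K n :=
  𝒴.embed.comp (𝒴.Y.germToFunctionField U).hom

lemma stalkToK_germ (U : 𝒴.Y.Opens) [Nonempty U] (y : 𝒴.Y) (hy : y ∈ U) (a : Γ(𝒴.Y, U)) :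
    𝒴.stalkToK y ((𝒴.Y.presheaf.germ U y hy).hom a) = 𝒴.sectionToK U a := by
  have := Scheme.algebraMap_germ_eq_germToFunctionField 𝒴.Y hy a
  exact congrArg 𝒴.embed this

lemma sectionToK_invariants (r : invariants ρ) :
    𝒴.sectionToK ⊤ (𝒴.π.appTop.hom ((Scheme.ΓSpecIso (.of (invariants ρ))).inv.hom r)) =
      algebraMap (MvPolynomial (Fin n) ℂ) (K n) r := by
  rw [← embed_toFunctionField, toFunctionField_eq]
  rfl

/-- Constants belong to R^G and so come from Y. They occur as coefficients in the isotypic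
projections. -/
lemma isIntegralElem_const (y : 𝒴.Y) (c : ℂ) :
    (𝒴.stalkToK y).IsIntegralElem (algebraMap ℂ (K n) c) := by
  have h : algebraMap ℂ (K n) c =
      algebraMap (MvPolynomial (Fin n) ℂ) (K n) (algebraMap ℂ (invariants ρ) c : invariants ρ) :=
    IsScalarTower.algebraMap_apply ℂ (MvPolynomial (Fin n) ℂ) (K n) c
  rw [h, ← sectionToK_invariants 𝒴 (algebraMap ℂ (invariants ρ) c),
    ← 𝒴.stalkToK_germ ⊤ y trivial]
  exact RingHom.isIntegralElem_map _

variable {𝒴}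

/-- `embed` is injective, so the element chosen in `val` is the only possible one. -/
lemma val_eq {P : 𝒴.PrimeDivisor} {f : K n} {a : 𝒴.Y.functionField}
    (h : 𝒴.embed a = f ^ Nat.card G) : 𝒴.val P f = (Scheme.ord a P.1 : ℚ) / Nat.card G := by
  have hex : ∃ a, 𝒴.embed a = f ^ Nat.card G := ⟨a, h⟩
  rw [val, dif_pos hex, 𝒴.embed.injective (hex.choose_spec.trans h.symm)]

variable [Finite G]

lemma val_embed_mul {P : 𝒴.PrimeDivisor} {χ : G →* ℂˣ} {f : K n} (hf : IsHomogeneous ρ χ f)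
    (hf0 : f ≠ 0) {a : 𝒴.Y.functionField} (ha : a ≠ 0) :
    𝒴.val P (𝒴.embed a * f) = Scheme.ord a P.1 + 𝒴.val P f := by
  obtain ⟨b, hb⟩ := 𝒴.exists_embed_eq hf.pow_invariant
  have hb0 : b ≠ 0 := by
    rintro rfl
    rw [map_zero] at hb
    exact pow_ne_zero _ hf0 hb.symm
  have h : 𝒴.embed (a ^ Nat.card G * b) = (𝒴.embed a * f) ^ Nat.card G := by
    rw [map_mul, map_pow, hb, mul_pow]
  have hN : (Nat.card G : ℚ) ≠ 0 := Nat.cast_ne_zero.2 Nat.card_pos.ne'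
  rw [val_eq h, val_eq hb, Scheme.ord_mul (pow_ne_zero _ ha) hb0, ord_pow ha]
  push_cast
  field_simp

lemma val_inv {P : 𝒴.PrimeDivisor} {χ : G →* ℂˣ} {f : K n} (hf : IsHomogeneous ρ χ f)
    (hf0 : f ≠ 0) : 𝒴.val P f⁻¹ = - 𝒴.val P f := by
  obtain ⟨b, hb⟩ := 𝒴.exists_embed_eq hf.pow_invariant
  have hb0 : b ≠ 0 := by
    rintro rfl
    rw [map_zero] at hb
    exact pow_ne_zero _ hf0 hb.symm
  have h : 𝒴.embed b⁻¹ = f⁻¹ ^ Nat.card G := by rw [map_inv₀, hb, inv_pow]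
  rw [val_eq h, val_eq hb, ord_inv hb0]
  push_cast
  ring

lemma exists_embed_mul_eq {χ : G →* ℂˣ} {f f' : K n} (hf : IsHomogeneous ρ χ f)
    (hf' : IsHomogeneous ρ χ f') (hf0' : f' ≠ 0) : ∃ a, 𝒴.embed a * f' = f := by
  obtain ⟨a, ha⟩ := 𝒴.exists_embed_eq (hf.div_invariant hf')
  exact ⟨a, by rw [ha, div_mul_cancel₀ _ hf0']⟩

/-- Two nonzero homogeneous functions of the same weight differ by a factor in K(Y), whose order is
an integer; the fractional part does not depend on the choice. -/
lemma charVal_eq {P : 𝒴.PrimeDivisor} {χ : G →* ℂˣ} {f : K n} (hf : IsHomogeneous ρ χ f)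
    (hf0 : f ≠ 0) : 𝒴.charVal P χ = Int.fract (𝒴.val P f) := by
  have hex : ∃ f : K n, f ≠ 0 ∧ IsHomogeneous ρ χ f := ⟨f, hf0, hf⟩
  rw [charVal, dif_pos hex]
  obtain ⟨a, ha⟩ := exists_embed_mul_eq (𝒴 := 𝒴) hex.choose_spec.2 hf hf0
  have ha0 : a ≠ 0 := by
    rintro rfl
    rw [map_zero, zero_mul] at ha
    exact hex.choose_spec.1 ha.symm
  rw [← ha, val_embed_mul hf hf0 ha0, Int.fract_intCast_add]

/-- f is integral over 𝒪_{Y,P} if and only if f^|G| is. The latter lies in K(Y), where integral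
means regular because 𝒪_{Y,P} is a discrete valuation ring. -/
lemma val_nonneg_iff {P : 𝒴.PrimeDivisor} {χ : G →* ℂˣ} {f : K n} (hf : IsHomogeneous ρ χ f)
    (hf0 : f ≠ 0) : 0 ≤ 𝒴.val P f ↔ (𝒴.stalkToK P.1).IsIntegralElem f := by
  obtain ⟨b, hb⟩ := 𝒴.exists_embed_eq hf.pow_invariant
  have hb0 : b ≠ 0 := by
    rintro rfl
    rw [map_zero] at hb
    exact pow_ne_zero _ hf0 hb.symm
  have hN : (0 : ℚ) < Nat.card G := Nat.cast_pos.2 Nat.card_pos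
  rw [val_eq hb, le_div_iff₀ hN, zero_mul, Int.cast_nonneg_iff,
    ord_nonneg_iff 𝒴.uniqueFactorizationMonoid_stalk P.2 hb0]
  constructor
  · rintro ⟨c, rfl⟩
    let := (𝒴.stalkToK P.1).toAlgebra
    have h : _root_.IsIntegral (𝒴.Y.presheaf.stalk P.1) (f ^ Nat.card G) := by
      rw [← hb]
      exact isIntegral_algebraMap (R := 𝒴.Y.presheaf.stalk P.1) (A := K n) (x := c)
    exact h.of_pow Nat.card_pos
  · intro h
    have h1 : (𝒴.stalkToK P.1).IsIntegralElem (𝒴.embed b) := by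
      rw [hb]
      let := (𝒴.stalkToK P.1).toAlgebra
      have h : _root_.IsIntegral (𝒴.Y.presheaf.stalk P.1) f := h
      exact h.pow _
    have h2 : _root_.IsIntegral (𝒴.Y.presheaf.stalk P.1) b := by
      obtain ⟨p, hp, hpb⟩ := h1
      refine ⟨p, hp, 𝒴.embed.injective ?_⟩
      rw [Polynomial.hom_eval₂, map_zero]
      exact hpb
    have := isDiscreteValuationRing_stalk 𝒴.uniqueFactorizationMonoid_stalk P.2
    exact IsIntegrallyClosed.isIntegral_iff.1 h2

end Resolution
end GConst
end

noncomputable section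
namespace GConst
-- The canonical family as the functions integral in codimension one
namespace Resolution

variable {G : Type*} [CommGroup G] {n : ℕ} {ρ : G →* Matrix.GeneralLinearGroup (Fin n) ℂ}
  {𝒴 : Resolution ρ}

variable (𝒴) in
/-- Elements of `K(ℂⁿ)` which are integral over the local rings of `Y` at all prime divisors
meeting `U`. -/
def IsRegularOn (U : 𝒴.Y.Opens) (h : K n) : Prop :=
  ∀ P : 𝒴.PrimeDivisor, P.1 ∈ U → (𝒴.stalkToK P.1).IsIntegralElem h

namespace IsRegularOn

variable {U V : 𝒴.Y.Opens} {h h' : K n}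

lemma mono (hV : V ≤ U) (hh : 𝒴.IsRegularOn U h) : 𝒴.IsRegularOn V h :=
  fun P hP => hh P (hV hP)

lemma zero : 𝒴.IsRegularOn U 0 := fun _ _ => RingHom.isIntegralElem_zero _

lemma add (hh : 𝒴.IsRegularOn U h) (hh' : 𝒴.IsRegularOn U h') : 𝒴.IsRegularOn U (h + h') :=
  fun P hP => (hh P hP).add _ (hh' P hP)

lemma mul (hh : 𝒴.IsRegularOn U h) (hh' : 𝒴.IsRegularOn U h') : 𝒴.IsRegularOn U (h * h') :=
  fun P hP => (hh P hP).mul _ (hh' P hP)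

lemma const (c : ℂ) : 𝒴.IsRegularOn U (algebraMap ℂ (K n) c) :=
  fun P _ => 𝒴.isIntegralElem_const P.1 c

lemma sum {ι : Type*} (s : Finset ι) (f : ι → K n) (hf : ∀ i ∈ s, 𝒴.IsRegularOn U (f i)) :
    𝒴.IsRegularOn U (∑ i ∈ s, f i) :=
  Finset.sum_induction f _ (fun _ _ => add) zero hf

lemma section_ [Nonempty U] (a : Γ(𝒴.Y, U)) : 𝒴.IsRegularOn U (𝒴.sectionToK U a) :=
  fun P hP => by
    rw [← 𝒴.stalkToK_germ U P.1 hP]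
    exact RingHom.isIntegralElem_map _

/-- `actK` fixes K(Y), so it carries an integral equation over a local ring of Y to another one. -/
lemma actK (hh : 𝒴.IsRegularOn U h) (g : G) : 𝒴.IsRegularOn U (GConst.actK ρ g h) := by
  intro P hP
  have h1 := (hh P hP).map (GConst.actK ρ g : K n →+* K n)
  have h2 : (GConst.actK ρ g : K n →+* K n).comp (𝒴.stalkToK P.1) = 𝒴.stalkToK P.1 :=
    RingHom.ext fun a => 𝒴.actK_embed g _
  rwa [h2] at h1

lemma isotypicSum [Fintype G] (hh : 𝒴.IsRegularOn U h) (χ : G →* ℂˣ) :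
    𝒴.IsRegularOn U (GConst.isotypicSum ρ χ h) :=
  sum _ _ fun g _ => (const _).mul (hh.actK g)

end IsRegularOn

/-- Nonempty open subsets of the irreducible space Y are connected. -/
lemma KSec.ext_const {U : 𝒴.Y.Opens} [Nonempty U] (s : 𝒴.KSec U) :
    ∃ h, s = 𝒴.constSec U h := by
  have : PreconnectedSpace U := Subtype.preconnectedSpace
    (PreirreducibleSpace.isPreirreducible_univ.open_subset U.isOpen (Set.subset_univ _)).isPreconnected
  refine ⟨s.1 (Classical.arbitrary U), LocallyConstant.ext fun y => ?_⟩
  exact s.2.apply_eq_of_preconnectedSpace _ _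

lemma constSec_injective (U : 𝒴.Y.Opens) [Nonempty U] : Function.Injective (𝒴.constSec U) :=
  fun _ _ h => DFunLike.congr_fun (F := LocallyConstant U (K n)) h (Classical.arbitrary U)

lemma res_constSec {U V : 𝒴.Y.Opens} (h : V ≤ U) (x : K n) :
    KSec.res h (𝒴.constSec U x) = 𝒴.constSec V x := rfl

lemma smul_constSec {U : 𝒴.Y.Opens} [Nonempty U] (a : Γ(𝒴.Y, U)) (x : K n) :
    a • 𝒴.constSec U x = 𝒴.constSec U (𝒴.sectionToK U a * x) := rfl

variable [Finite G]

/-- The isotypic decomposition. -/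
lemma exists_sum_isHomogeneous {U : 𝒴.Y.Opens} {h : K n} (hh : 𝒴.IsRegularOn U h) :
    ∃ f : (G →* ℂˣ) → K n, (∀ χ, IsHomogeneous ρ χ (f χ)) ∧ (∀ χ, 𝒴.IsRegularOn U (f χ)) ∧
      ∑ᶠ χ, f χ = h := by
  cases nonempty_fintype G
  cases nonempty_fintype (G →* ℂˣ)
  let c : ℂ := (Fintype.card (G →* ℂˣ) : ℂ)⁻¹
  have hc : algebraMap ℂ (K n) c * (Fintype.card (G →* ℂˣ) : K n) = 1 := by
    rw [← map_natCast (algebraMap ℂ (K n)), ← map_mul, inv_mul_cancel₀, map_one]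
    exact Nat.cast_ne_zero.2 Fintype.card_ne_zero
  refine ⟨fun χ => algebraMap ℂ (K n) c * GConst.isotypicSum ρ χ h, fun χ => ?_, fun χ => ?_, ?_⟩
  · exact (isHomogeneous_isotypicSum ρ χ h).mul_of_invariant fun g => actK_const ρ g c
  · exact (IsRegularOn.const c).mul (hh.isotypicSum χ)
  · rw [finsum_eq_sum_of_fintype, ← Finset.mul_sum, sum_isotypicSum, ← mul_assoc, hc, one_mul]

/-- Regularity in codimension one means integrality over the regular functions. -/
theorem isIntegralElem_iff_isRegularOn {V : 𝒴.Y.Opens} (hV : IsAffineOpen V) [Nonempty V]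
    {h : K n} : (𝒴.sectionToK V).IsIntegralElem h ↔ 𝒴.IsRegularOn V h := by
  constructor
  · rintro ⟨p, hp, hph⟩ P hP
    refine ⟨p.map (𝒴.Y.presheaf.germ V P.1 hP).hom, hp.map _, ?_⟩
    rw [Polynomial.eval₂_map]
    have : (𝒴.stalkToK P.1).comp (𝒴.Y.presheaf.germ V P.1 hP).hom = 𝒴.sectionToK V :=
      RingHom.ext fun a => 𝒴.stalkToK_germ V P.1 hP a
    rw [this, hph]
  · intro hh
    -- For homogeneous f the power f^|G| is a rational function on Y without poles on V, hence
    -- regular there. The general case follows by isotypic decomposition.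
    have key : ∀ (χ : G →* ℂˣ) (f : K n), IsHomogeneous ρ χ f → 𝒴.IsRegularOn V f →
        (𝒴.sectionToK V).IsIntegralElem f := by
      intro χ f hf hfV
      by_cases hf0 : f = 0
      · rw [hf0]; exact RingHom.isIntegralElem_zero _
      obtain ⟨b, hb⟩ := 𝒴.exists_embed_eq hf.pow_invariant
      have hb0 : b ≠ 0 := by
        rintro rfl
        rw [map_zero] at hb
        exact pow_ne_zero _ hf0 hb.symm
      obtain ⟨r, hr⟩ := mem_range_of_ord_nonneg 𝒴.uniqueFactorizationMonoid_stalk hV hb0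
        fun P hP hP1 => by
          have h1 := (val_nonneg_iff (P := ⟨P, hP1⟩) hf hf0).2 (hfV ⟨P, hP1⟩ hP)
          rwa [val_eq hb, le_div_iff₀ (Nat.cast_pos.2 Nat.card_pos), zero_mul,
            Int.cast_nonneg_iff] at h1
      let := (𝒴.sectionToK V).toAlgebra
      have h : _root_.IsIntegral Γ(𝒴.Y, V) (f ^ Nat.card G) := by
        rw [← hb, ← hr]
        exact isIntegral_algebraMap (R := Γ(𝒴.Y, V)) (A := K n) (x := r)
      exact h.of_pow Nat.card_pos
    obtain ⟨f, hf, hfV, rfl⟩ := exists_sum_isHomogeneous hh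
    cases nonempty_fintype (G →* ℂˣ)
    rw [finsum_eq_sum_of_fintype]
    exact Finset.sum_induction f _ (fun _ _ h h' => h.add _ h') (RingHom.isIntegralElem_zero _)
      fun χ _ => key χ _ (hf χ) (hfV χ)

/-- The divisors `C_χ` are locally principal. -/
lemma exists_local_equation (hρ : Function.Injective ρ) (χ : G →* ℂˣ) {U : 𝒴.Y.Opens} {y : 𝒴.Y}
    (hy : y ∈ U) : ∃ W ≤ U, IsAffineOpen W ∧ y ∈ W ∧ ∃ e : K n, e ≠ 0 ∧ IsHomogeneous ρ χ e ∧
      ∀ P : 𝒴.PrimeDivisor, P.1 ∈ W → 𝒴.val P e = 𝒴.charVal P χ := by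
  cases nonempty_fintype G
  obtain ⟨f, hf0, hf⟩ := exists_isHomogeneous_ne_zero ρ hρ χ
  obtain ⟨a, ha⟩ := 𝒴.exists_embed_eq hf.pow_invariant
  have ha0 : a ≠ 0 := by
    rintro rfl
    rw [map_zero] at ha
    exact pow_ne_zero _ hf0 ha.symm
  -- Here b has order ⌊v_P(f)⌋ at each P meeting W, so dividing f by b leaves the fractional part.
  obtain ⟨W, hWU, hW, hyW, b, hb0, hb⟩ :=
    exists_ord_eq_floor 𝒴.uniqueFactorizationMonoid_stalk ha0 (Nat.card G) hy
  have hb1 : 𝒴.embed b⁻¹ ≠ 0 := (map_ne_zero _).2 (inv_ne_zero hb0)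
  refine ⟨W, hWU, hW, hyW, 𝒴.embed b⁻¹ * f, mul_ne_zero hb1 hf0,
    hf.mul_of_invariant fun g => 𝒴.actK_embed g _, fun P hP => ?_⟩
  rw [val_embed_mul hf hf0 (inv_ne_zero hb0), ord_inv hb0, hb P.1 hP P.2, charVal_eq hf hf0,
    val_eq ha, Int.fract, Rat.floor_intCast_div_natCast]
  push_cast
  ring

/-- `divisorSheaf` is generated by inverses of local equations, and -C_χ has weight χ⁻¹. So e
itself, of weight χ with divisor C_χ, is a generator. -/
lemma isLocalEquation_inv {χ : G →* ℂˣ} {W : 𝒴.Y.Opens} {e : K n} (he0 : e ≠ 0)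
    (he : IsHomogeneous ρ χ e)
    (hval : ∀ P : 𝒴.PrimeDivisor, P.1 ∈ W → 𝒴.val P e = 𝒴.charVal P χ) :
    𝒴.IsLocalEquation χ⁻¹ (-𝒴.canonicalDivisor χ) W e⁻¹ where
  ne_zero := inv_ne_zero he0
  homogeneous := he.inv
  val_eq P hP := by
    rw [val_inv he he0, hval P hP]
    rfl

/-- Near y write h = a·e with e of divisor C_χ and a in K(Y). Regularity of h forces a to be
regular, so h is a multiple of the generator e. -/
lemma constSec_mem_divisorSheaf (hρ : Function.Injective ρ) {χ : G →* ℂˣ} {U : 𝒴.Y.Opens} {h : K n}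
    (hh : IsHomogeneous ρ χ h) (hU : 𝒴.IsRegularOn U h) :
    𝒴.constSec U h ∈ 𝒴.divisorSheaf χ⁻¹ (-𝒴.canonicalDivisor χ) U := by
  by_cases hh0 : h = 0
  · rw [hh0, map_zero]; exact zero_mem _
  intro y hy
  obtain ⟨W, hWU, hW, hyW, e, he0, he, hval⟩ := exists_local_equation (𝒴 := 𝒴) hρ χ hy
  refine ⟨W, hWU, hyW, ?_⟩
  have : Nonempty W := ⟨⟨y, hyW⟩⟩
  obtain ⟨a, ha⟩ := exists_embed_mul_eq (𝒴 := 𝒴) hh he he0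
  have ha0 : a ≠ 0 := by
    rintro rfl
    rw [map_zero, zero_mul] at ha
    exact hh0 ha.symm
  obtain ⟨r, hr⟩ := mem_range_of_ord_nonneg 𝒴.uniqueFactorizationMonoid_stalk hW ha0
    fun P hP hP1 => by
      have h1 := (val_nonneg_iff (P := ⟨P, hP1⟩) hh hh0).2 (hU ⟨P, hP1⟩ (hWU hP))
      rw [← ha, val_embed_mul he he0 ha0, hval _ hP, charVal_eq he he0] at h1
      have h2 := Int.fract_lt_one (𝒴.val ⟨P, hP1⟩ e)
      -- 0 ≤ ord_P(a) + v(P,χ) and v(P,χ) < 1; since the order is an integer, it is nonnegative.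
      have h3 : (-1 : ℚ) < Scheme.ord a P := by linarith
      have h4 : -1 < Scheme.ord a P := by exact_mod_cast h3
      omega
  rw [res_constSec, ← ha]
  have h1 : 𝒴.constSec W (𝒴.embed a * e) = r • 𝒴.constSec W e := by
    rw [smul_constSec, ← hr]
    rfl
  rw [h1]
  exact Submodule.smul_mem _ _ (Submodule.subset_span ⟨e, ⟨e⁻¹, isLocalEquation_inv he0 he hval,
    (inv_inv e).symm⟩, rfl⟩)

/-- A generator f⁻¹ has valuation v(P,χ) ≥ 0 and so is integral in codimension one. This property is
stable under sums and under multiplication by regular functions. -/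
lemma exists_of_mem_divisorSheaf {χ : G →* ℂˣ} {U : 𝒴.Y.Opens} [Nonempty U] {s : 𝒴.KSec U}
    (hs : s ∈ 𝒴.divisorSheaf χ⁻¹ (-𝒴.canonicalDivisor χ) U) :
    ∃ h, 𝒴.IsRegularOn U h ∧ s = 𝒴.constSec U h := by
  obtain ⟨h, rfl⟩ := KSec.ext_const s
  refine ⟨h, fun P hP => ?_, rfl⟩
  obtain ⟨V, hVU, hPV, hV⟩ := hs P.1 hP
  have : Nonempty V := ⟨⟨P.1, hPV⟩⟩
  have key : ∀ t ∈ Submodule.span Γ(𝒴.Y, V) (𝒴.constSec V ''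
      {k | ∃ f, 𝒴.IsLocalEquation χ⁻¹ (-𝒴.canonicalDivisor χ) V f ∧ k = f⁻¹}),
      ∃ h', 𝒴.IsRegularOn V h' ∧ t = 𝒴.constSec V h' := by
    intro t ht
    induction ht using Submodule.span_induction with
    | mem x hx =>
      obtain ⟨_, ⟨f, hf, rfl⟩, rfl⟩ := hx
      refine ⟨f⁻¹, fun Q hQ => ?_, rfl⟩
      rw [← val_nonneg_iff hf.homogeneous.inv (inv_ne_zero hf.ne_zero),
        val_inv hf.homogeneous hf.ne_zero, hf.val_eq Q hQ, Pi.neg_apply, neg_neg]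
      -- The default value 0 of `charVal` is nonnegative too, so faithfulness is not needed here.
      unfold canonicalDivisor charVal
      split_ifs
      · exact Int.fract_nonneg _
      · exact le_rfl
    | zero => exact ⟨0, IsRegularOn.zero, (map_zero _).symm⟩
    | add x y _ _ hx hy =>
      obtain ⟨h1, hh1, rfl⟩ := hx
      obtain ⟨h2, hh2, rfl⟩ := hy
      exact ⟨h1 + h2, hh1.add hh2, (map_add _ _ _).symm⟩
    | smul a x _ hx =>
      obtain ⟨h1, hh1, rfl⟩ := hx
      exact ⟨𝒴.sectionToK V a * h1, (IsRegularOn.section_ a).mul hh1, rfl⟩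
  obtain ⟨h', hh', heq⟩ := key _ hV
  rw [res_constSec] at heq
  rw [constSec_injective V heq]
  exact hh' P hPV

/-- The canonical family consists of the functions which are integral in codimension one. -/
theorem mem_canonicalFamily_iff (hρ : Function.Injective ρ) {U : 𝒴.Y.Opens} [Nonempty U]
    {s : 𝒴.KSec U} :
    s ∈ 𝒴.canonicalFamily U ↔ ∃ h, 𝒴.IsRegularOn U h ∧ s = 𝒴.constSec U h := by
  constructor
  · intro hs
    refine Submodule.iSup_induction _ (motive := fun s => ∃ h, 𝒴.IsRegularOn U h ∧
      s = 𝒴.constSec U h) hs (fun χ x hx => exists_of_mem_divisorSheaf hx)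
      ⟨0, IsRegularOn.zero, (map_zero _).symm⟩ ?_
    rintro _ _ ⟨h1, hh1, rfl⟩ ⟨h2, hh2, rfl⟩
    exact ⟨h1 + h2, hh1.add hh2, (map_add _ _ _).symm⟩
  · rintro ⟨h, hh, rfl⟩
    obtain ⟨f, hf, hfU, rfl⟩ := exists_sum_isHomogeneous hh
    cases nonempty_fintype (G →* ℂˣ)
    rw [finsum_eq_sum_of_fintype, map_sum]
    exact sum_mem fun χ _ => Submodule.mem_iSup_of_mem χ
      (constSec_mem_divisorSheaf hρ (hf χ) (hfU χ))

end Resolution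
end GConst
end

noncomputable section
namespace GConst

/-! ### Invariants in the ring of the fibre product -/

section Generation

lemma ringHom_ext_of_closure_union {A R B S : Type*} [CommRing A] [CommRing R] [CommRing B]
    [CommRing S] {φ : A →+* B} {ψ : R →+* B}
    (hgen : Subring.closure (Set.range φ ∪ Set.range ψ) = ⊤) {f f' : B →+* S}
    (h1 : ∀ a, f (φ a) = f' (φ a)) (h2 : ∀ r, f (ψ r) = f' (ψ r)) : f = f' := by
  refine RingHom.eq_of_eqOn_set_dense hgen ?_
  rintro _ (⟨a, rfl⟩ | ⟨r, rfl⟩)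
  · exact h1 a
  · exact h2 r

variable {G : Type*} [CommGroup G] [Finite G] {n : ℕ} {ρ : G →* Matrix.GeneralLinearGroup (Fin n) ℂ}

/-- If `B` is generated by a ring `A` of invariants and by `R`, and `A` contains `R^G`, then the
kernel of an equivariant map `B ⟶ K(ℂⁿ)` which is injective on `A` is nil. -/
lemma isNilpotent_of_map_eq_zero {A B : Type*} [CommRing A] [CommRing B] {φ : A →+* B}
    {ψ : MvPolynomial (Fin n) ℂ →+* B} (hgen : Subring.closure (Set.range φ ∪ Set.range ψ) = ⊤)
    {σ : G → B →+* B} (hσφ : ∀ g a, σ g (φ a) = φ a) (hσψ : ∀ g r, σ g (ψ r) = ψ (actHom ρ g r))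
    (hinv : ∀ r ∈ invariants ρ, ψ r ∈ φ.range) {j : B →+* K n}
    (hjφ : ∀ g a, actK ρ g (j (φ a)) = j (φ a)) (hinj : Function.Injective (j.comp φ))
    (hjψ : ∀ r, j (ψ r) = algebraMap _ (K n) r) {b : B} (hb : j b = 0) : IsNilpotent b := by
  classical
  cases nonempty_fintype G
  have hσmul : ∀ g h b, σ g (σ h b) = σ (g * h) b := fun g h b =>
    DFunLike.congr_fun (ringHom_ext_of_closure_union hgen (f := (σ g).comp (σ h)) (f' := σ (g * h))
      (fun a => by simp [hσφ])
      (fun r => by simp [hσψ, actHom_mul])) b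
  have hσone : ∀ b, σ 1 b = b := fun b =>
    DFunLike.congr_fun (ringHom_ext_of_closure_union hgen (f := σ 1) (f' := RingHom.id B)
      (fun a => by simp [hσφ])
      (fun r => by simp [hσψ, actHom_one])) b
  have hjσ : ∀ g b, j (σ g b) = actK ρ g (j b) := fun g b =>
    DFunLike.congr_fun (ringHom_ext_of_closure_union hgen (f := j.comp (σ g))
      (f' := (actK ρ g : K n →+* K n).comp j)
      (fun a => by simp [hσφ, hjφ]) (fun r => by simp [hσψ, hjψ, actK_algebraMap])) b
  -- the trace maps to `A`
  have htrace : ∀ b, ∑ g, σ g b ∈ φ.range := by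
    let := φ.toAlgebra
    have hadj : Algebra.adjoin A (Set.range ψ) = ⊤ := by
      rw [eq_top_iff]
      intro x _
      have hx : x ∈ Subring.closure (Set.range φ ∪ Set.range ψ) := hgen ▸ Subring.mem_top x
      refine (Subring.closure_le (t := (Algebra.adjoin A (Set.range ψ)).toSubring)).2 ?_ hx
      rintro _ (⟨a, rfl⟩ | ⟨r, rfl⟩)
      · exact (Algebra.adjoin A (Set.range ψ)).algebraMap_mem a
      · exact Algebra.subset_adjoin ⟨r, rfl⟩
    -- The range of ψ is closed under products, so the A-algebra it generates is just its A-span;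
    -- the trace is then computed on the elements ψ r.
    have hspan : Submodule.span A (Set.range ψ) = ⊤ := by
      have h := Algebra.adjoin_eq_span A (Set.range ψ)
      have hcl : (Submonoid.closure (Set.range ψ) : Set B) = Set.range ψ := by
        have := Submonoid.closure_eq (MonoidHom.mrange (ψ : MvPolynomial (Fin n) ℂ →* B))
        exact congrArg (fun S : Submonoid B => (S : Set B)) this
      rw [hadj, hcl] at h
      rw [← h]
      rfl
    intro b
    have hb : b ∈ Submodule.span A (Set.range ψ) := hspan ▸ Submodule.mem_top
    induction hb using Submodule.span_induction with
    | mem x hx =>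
      obtain ⟨r, rfl⟩ := hx
      simp only [hσψ]
      rw [← map_sum]
      refine hinv _ ((mem_invariants ρ _).2 fun h => ?_)
      rw [map_sum]
      exact Fintype.sum_equiv (Equiv.mulLeft h) _ _ fun g => by simp [actHom_mul]
    | zero => simp
    | add x y _ _ hx hy =>
      simp only [map_add, Finset.sum_add_distrib]
      exact add_mem hx hy
    | smul a x _ hx =>
      have : ∀ g, σ g (a • x) = φ a * σ g x := fun g => by
        rw [Algebra.smul_def, map_mul]
        exact congrArg (· * _) (hσφ g a)
      simp only [this, ← Finset.mul_sum]
      exact mul_mem ⟨a, rfl⟩ hx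
  -- invariant elements of the kernel vanish
  have hzero : ∀ d, (∀ g, σ g d = d) → j d = 0 → d = 0 := by
    intro d hd hjd
    obtain ⟨a, ha⟩ := htrace d
    simp only [hd, Finset.sum_const, Finset.card_univ, nsmul_eq_mul] at ha
    have ha0 : a = 0 := by
      apply hinj
      rw [map_zero, RingHom.comp_apply, ha, map_mul, hjd, mul_zero]
    rw [ha0, map_zero] at ha
    -- B receives ℂ through ψ, so |G| is invertible.
    have hunit : IsUnit ((Fintype.card G : ℕ) : B) := by
      have h1 : IsUnit ((Fintype.card G : ℕ) : ℂ) :=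
        IsUnit.mk0 _ (Nat.cast_ne_zero.2 Fintype.card_ne_zero)
      have := h1.map (ψ.comp (algebraMap ℂ (MvPolynomial (Fin n) ℂ)))
      rwa [map_natCast] at this
    exact (hunit.mul_right_eq_zero).1 ha.symm
  -- Its coefficients are invariant and agree with those of X^|G| under j, so the vanishing of
  -- invariants in the kernel gives p = X^|G|. Evaluating at the root b yields b^|G| = 0.
  let p : Polynomial B := ∏ g, (Polynomial.X - Polynomial.C (σ g b))
  have hpσ : ∀ h, p.map (σ h) = p := by
    intro h
    simp only [p, Polynomial.map_prod, Polynomial.map_sub, Polynomial.map_X, Polynomial.map_C,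
      hσmul]
    exact Fintype.prod_equiv (Equiv.mulLeft h) _ _ fun g => rfl
  have hpj : p.map j = Polynomial.X ^ Fintype.card G := by
    simp only [p, Polynomial.map_prod, Polynomial.map_sub, Polynomial.map_X, Polynomial.map_C,
      hjσ, hb, map_zero, sub_zero, Finset.prod_const, Finset.card_univ]
  have hp : p = Polynomial.X ^ Fintype.card G := by
    ext i
    rw [← sub_eq_zero]
    apply hzero
    · intro g
      have h1 := congrArg (fun q => Polynomial.coeff q i) (hpσ g)
      simp only [Polynomial.coeff_map] at h1
      rw [map_sub, h1, Polynomial.coeff_X_pow]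
      congr 1
      split_ifs <;> simp
    · have h1 := congrArg (fun q => Polynomial.coeff q i) hpj
      simp only [Polynomial.coeff_map] at h1
      rw [map_sub, h1, Polynomial.coeff_X_pow, Polynomial.coeff_X_pow]
      split_ifs <;> simp
  refine ⟨Fintype.card G, ?_⟩
  have h1 := congrArg (Polynomial.eval b) hp
  rw [Polynomial.eval_pow, Polynomial.eval_X] at h1
  rw [← h1, Polynomial.eval_prod]
  refine Finset.prod_eq_zero (Finset.mem_univ 1) ?_
  simp [hσone]

end Generation

/-! ### Values of functions at field-valued points -/

section FieldPoints

variable {k k' : Type} [Field k] [Field k'] {X X' : Scheme.{0}}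

/-- The value in `k` of a function at a `k`-valued point. -/
def evalAt (f : Spec (.of k) ⟶ X) (U : X.Opens) (e : ⊤ ≤ f ⁻¹ᵁ U) : Γ(X, U) →+* k :=
  (f.appLE U ⊤ e ≫ (Scheme.ΓSpecIso (.of k)).hom).hom

lemma evalAt_comp (f : Spec (.of k) ⟶ X) (g : X ⟶ X') (U : X'.Opens) (V : X.Opens)
    (h : V ≤ g ⁻¹ᵁ U) (e : ⊤ ≤ f ⁻¹ᵁ V) (a : Γ(X', U)) :
    evalAt (f ≫ g) U (e.trans (f.preimage_mono h)) a = evalAt f V e ((g.appLE U V h).hom a) := by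
  have := Scheme.Hom.appLE_comp_appLE f g U V ⊤ h e
  unfold evalAt
  rw [← this]
  rfl

lemma evalAt_res (f : Spec (.of k) ⟶ X) {U V : X.Opens} (h : V ≤ U) (e : ⊤ ≤ f ⁻¹ᵁ V)
    (a : Γ(X, U)) :
    evalAt f V e ((X.presheaf.map (homOfLE h).op).hom a) =
      evalAt f U (e.trans (f.preimage_mono h)) a := by
  have := Scheme.Hom.map_appLE f e (homOfLE h).op
  unfold evalAt
  rw [← this]
  rfl

lemma evalAt_Spec_map_comp (f : Spec (.of k) ⟶ X) (τ : k →+* k') (U : X.Opens) (e : ⊤ ≤ f ⁻¹ᵁ U)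
    (e' : ⊤ ≤ (Spec.map (CommRingCat.ofHom τ) ≫ f) ⁻¹ᵁ U) (a : Γ(X, U)) :
    evalAt (Spec.map (CommRingCat.ofHom τ) ≫ f) U e' a = τ (evalAt f U e a) := by
  have h1 := Scheme.Hom.appLE_comp_appLE (Spec.map (CommRingCat.ofHom τ)) f U ⊤ ⊤ e le_top
  have h2 : (Spec.map (CommRingCat.ofHom τ)).appLE ⊤ ⊤ le_top ≫ (Scheme.ΓSpecIso (.of k')).hom =
      (Scheme.ΓSpecIso (.of k)).hom ≫ CommRingCat.ofHom τ := by
    rw [← Scheme.ΓSpecIso_naturality]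
    simp [Scheme.Hom.appTop, Scheme.Hom.app_eq_appLE]
  have h3 : (Spec.map (CommRingCat.ofHom τ) ≫ f).appLE U ⊤ e' ≫ (Scheme.ΓSpecIso (.of k')).hom =
      (f.appLE U ⊤ e ≫ (Scheme.ΓSpecIso (.of k)).hom) ≫ CommRingCat.ofHom τ := by
    rw [Category.assoc, ← h2, ← h1, Category.assoc]
  unfold evalAt
  rw [h3]
  rfl

lemma evalAt_Spec_map {R : Type} [CommRing R] (τ : R →+* k) (r : R) :
    evalAt (Spec.map (CommRingCat.ofHom τ)) ⊤ le_top ((Scheme.ΓSpecIso (.of R)).inv.hom r) = τ r := by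
  have h2 : (Scheme.ΓSpecIso (.of R)).inv ≫ (Spec.map (CommRingCat.ofHom τ)).appLE ⊤ ⊤ le_top ≫
      (Scheme.ΓSpecIso (.of k)).hom = CommRingCat.ofHom τ := by
    rw [Iso.inv_comp_eq, ← Scheme.ΓSpecIso_naturality]
    simp [Scheme.Hom.appTop, Scheme.Hom.app_eq_appLE]
  exact congrArg (fun f => f.hom r) h2

lemma evalAt_fromSpecStalk (x : X) (τ : X.presheaf.stalk x ⟶ .of k) (U : X.Opens) (hx : x ∈ U)
    (e : ⊤ ≤ (Spec.map τ ≫ X.fromSpecStalk x) ⁻¹ᵁ U) (a : Γ(X, U)) :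
    evalAt (Spec.map τ ≫ X.fromSpecStalk x) U e a =
      τ.hom ((X.presheaf.germ U x hx).hom a) := by
  have he : ⊤ ≤ X.fromSpecStalk x ⁻¹ᵁ U := by
    rintro z -
    have hz : X.fromSpecStalk x z ∈ {y | y ⤳ x} := Scheme.range_fromSpecStalk ▸ ⟨z, rfl⟩
    exact hz.mem_open U.isOpen hx
  have h1 : (X.fromSpecStalk x).appLE U ⊤ he =
      X.presheaf.germ U x hx ≫ (Scheme.ΓSpecIso (X.presheaf.stalk x)).inv := by
    rw [Scheme.Hom.appLE, Scheme.fromSpecStalk_app hx, Category.assoc, Category.assoc,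
      ← Functor.map_comp]
    congr 1
  have h2 : (Spec.map τ).appLE ⊤ ⊤ le_top ≫ (Scheme.ΓSpecIso (.of k)).hom =
      (Scheme.ΓSpecIso (X.presheaf.stalk x)).hom ≫ τ := by
    refine Eq.trans ?_ (Scheme.ΓSpecIso_naturality τ)
    simp [Scheme.Hom.appTop, Scheme.Hom.app_eq_appLE]
  have h3 : (Spec.map τ ≫ X.fromSpecStalk x).appLE U ⊤ e ≫
      (Scheme.ΓSpecIso (.of k)).hom = X.presheaf.germ U x hx ≫ τ := by
    refine Eq.trans (congrArg (· ≫ _) (Scheme.Hom.appLE_comp_appLE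
      (Spec.map τ) (X.fromSpecStalk x) U ⊤ ⊤ he le_top).symm) ?_
    refine (Category.assoc _ _ _).trans ?_
    rw [h2, h1, Category.assoc, Iso.inv_hom_id_assoc]
  unfold evalAt
  rw [h3]
  rfl

/-- The function `a` is invertible at a point where its value is nonzero. -/
lemma top_le_preimage_basicOpen (f : Spec (.of k) ⟶ X) {U : X.Opens} (e : ⊤ ≤ f ⁻¹ᵁ U) {a : Γ(X, U)}
    (ha : evalAt f U e a ≠ 0) : ⊤ ≤ f ⁻¹ᵁ X.basicOpen a := by
  have hu : IsUnit ((f.appLE U ⊤ e).hom a) := by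
    have h1 : IsUnit (evalAt f U e a) := IsUnit.mk0 _ ha
    have := h1.map (Scheme.ΓSpecIso (.of k)).inv.hom
    have h2 : (Scheme.ΓSpecIso (.of k)).inv.hom (evalAt f U e a) = (f.appLE U ⊤ e).hom a := by
      change ((f.appLE U ⊤ e ≫ (Scheme.ΓSpecIso (.of k)).hom) ≫ (Scheme.ΓSpecIso (.of k)).inv).hom a = _
      rw [Category.assoc, Iso.hom_inv_id, Category.comp_id]
    rwa [h2] at this
  have h3 := Scheme.basicOpen_appLE f ⊤ U e a
  rw [Scheme.basicOpen_of_isUnit _ hu] at h3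
  exact h3.le.trans inf_le_right

end FieldPoints
end GConst
end

noncomputable section
namespace GConst

/-! ### Reducedness, and density of the generic point of the fibre product -/

section Reduction

instance isReduced_reduction (Z : Scheme.{0}) : IsReduced (reduction Z) := by
  let 𝒰 := Z.nilradical.subschemeCover
  have hred : ∀ U : Z.affineOpens, _root_.IsReduced (Γ(Z, U) ⧸ Z.nilradical.ideal U) := fun U =>
    (Ideal.isRadical_iff_quotient_reduced _).1 (Ideal.radical_isRadical _)
  have : ∀ x : reduction Z, _root_.IsReduced ((reduction Z).presheaf.stalk x) := by
    intro x
    obtain ⟨i, y, rfl⟩ : ∃ i y, 𝒰.f i y = x := ⟨_, 𝒰.covers x⟩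
    have : _root_.IsReduced (𝒰.X i) := hred _
    exact isReduced_of_injective ((𝒰.f i).stalkMap y).hom
      (ConcreteCategory.bijective_of_isIso ((𝒰.f i).stalkMap y)).1
  exact isReduced_of_isReduced_stalk _

end Reduction

namespace Resolution

variable {G : Type*} [CommGroup G] {n : ℕ} {ρ : G →* Matrix.GeneralLinearGroup (Fin n) ℂ}
  (𝒴 : Resolution ρ)

/-- The generic point of `ℂⁿ`. -/
def genericSpace (n : ℕ) : Spec (.of (K n)) ⟶ affineSpace n :=
  Spec.map (CommRingCat.ofHom (algebraMap (MvPolynomial (Fin n) ℂ) (K n)))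

/-- The embedding of `K(Y)` in `K(ℂⁿ)`, as a morphism. -/
def embedHom : 𝒴.Y.presheaf.stalk (genericPoint 𝒴.Y) ⟶ .of (K n) :=
  CommRingCat.ofHom 𝒴.embed

/-- The generic point of `Y`, with values in `K(ℂⁿ)`. -/
def genericY : Spec (.of (K n)) ⟶ 𝒴.Y :=
  Spec.map 𝒴.embedHom ≫
    𝒴.Y.fromSpecStalk (genericPoint 𝒴.Y)

/-- On rings this is the defining property of `embed`: it restricts to the inclusion of R^G in
K(ℂⁿ). -/
lemma genericY_comp_π : 𝒴.genericY ≫ 𝒴.π = genericSpace n ≫ quotientMap ρ := by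
  unfold genericY genericSpace quotientMap
  rw [Category.assoc, ← Scheme.SpecMap_stalkMap_fromSpecStalk, Spec.fromSpecStalk_eq',
    ← Spec.map_comp]
  refine (congrArg (Spec.map 𝒴.embedHom ≫ ·) (Spec.map_comp _ _).symm).trans
    ((Spec.map_comp _ _).symm.trans (congrArg Spec.map ?_))
  apply CommRingCat.hom_ext
  exact RingHom.ext fun r => 𝒴.embed_toFunctionField r

/-- The generic point of `Y ×_X ℂⁿ`. -/
def genericFibreProduct : Spec (.of (K n)) ⟶ 𝒴.fibreProduct :=
  pullback.lift 𝒴.genericY (genericSpace n) 𝒴.genericY_comp_π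

lemma genericFibreProduct_fst :
    𝒴.genericFibreProduct ≫ pullback.fst 𝒴.π (quotientMap ρ) = 𝒴.genericY :=
  pullback.lift_fst _ _ _

lemma genericFibreProduct_snd :
    𝒴.genericFibreProduct ≫ pullback.snd 𝒴.π (quotientMap ρ) = genericSpace n :=
  pullback.lift_snd _ _ _

lemma top_le_genericY_preimage (U : 𝒴.Y.Opens) [hU : Nonempty U] : ⊤ ≤ 𝒴.genericY ⁻¹ᵁ U := by
  rintro z -
  have hη : genericPoint 𝒴.Y ∈ U :=
    ((genericPoint_spec 𝒴.Y).mem_open_set_iff U.isOpen).2 (by simpa using hU)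
  have hz : 𝒴.Y.fromSpecStalk (genericPoint 𝒴.Y) (Spec.map 𝒴.embedHom z) ∈ {y | y ⤳ genericPoint 𝒴.Y} :=
    Scheme.range_fromSpecStalk ▸ ⟨_, rfl⟩
  exact hz.mem_open U.isOpen hη

lemma evalAt_genericY (U : 𝒴.Y.Opens) [hU : Nonempty U] (e : ⊤ ≤ 𝒴.genericY ⁻¹ᵁ U)
    (a : Γ(𝒴.Y, U)) : evalAt 𝒴.genericY U e a = 𝒴.sectionToK U a :=
  evalAt_fromSpecStalk _ _ U
    (((genericPoint_spec 𝒴.Y).mem_open_set_iff U.isOpen).2 (by simpa using hU)) e a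

lemma evalAt_genericSpace (r : MvPolynomial (Fin n) ℂ) :
    evalAt (genericSpace n) ⊤ le_top ((Scheme.ΓSpecIso (.of _)).inv.hom r) =
      algebraMap _ (K n) r := evalAt_Spec_map _ r

lemma sectionToK_injective (U : 𝒴.Y.Opens) [Nonempty U] : Function.Injective (𝒴.sectionToK U) :=
  𝒴.embed.injective.comp (𝒴.Y.germToFunctionField_injective U)

lemma top_le_genericFibreProduct_preimage (U : 𝒴.Y.Opens) [Nonempty U] :
    ⊤ ≤ 𝒴.genericFibreProduct ⁻¹ᵁ (pullback.fst 𝒴.π (quotientMap ρ) ⁻¹ᵁ U) := by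
  rw [← Scheme.Hom.comp_preimage, genericFibreProduct_fst]
  exact 𝒴.top_le_genericY_preimage U

lemma fibreProductMap_fst (g : G) : 𝒴.fibreProductMap g ≫ pullback.fst 𝒴.π (quotientMap ρ) =
    pullback.fst 𝒴.π (quotientMap ρ) :=
  (pullback.lift_fst _ _ _).trans (Category.comp_id _)

lemma fibreProductMap_snd (g : G) : 𝒴.fibreProductMap g ≫ pullback.snd 𝒴.π (quotientMap ρ) =
    pullback.snd 𝒴.π (quotientMap ρ) ≫ spaceMap ρ g :=
  pullback.lift_snd _ _ _

lemma evalAt_fst (U : 𝒴.Y.Opens) [Nonempty U] (a : Γ(𝒴.Y, U)) :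
    evalAt 𝒴.genericFibreProduct (pullback.fst 𝒴.π (quotientMap ρ) ⁻¹ᵁ U)
      (𝒴.top_le_genericFibreProduct_preimage U)
      (((pullback.fst 𝒴.π (quotientMap ρ)).app U).hom a) = 𝒴.sectionToK U a := by
  have h := evalAt_comp 𝒴.genericFibreProduct (pullback.fst 𝒴.π (quotientMap ρ)) U _ le_rfl
    (𝒴.top_le_genericFibreProduct_preimage U) a
  rw [← Scheme.Hom.app_eq_appLE] at h
  rw [← h, ← 𝒴.evalAt_genericY U (𝒴.top_le_genericY_preimage U)]
  congr 1
  simp only [genericFibreProduct_fst]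

variable [Finite G]

/-- The functions on `U ×_X ℂⁿ` which vanish at the generic point are nilpotent. -/
lemma isNilpotent_of_evalAt_eq_zero {U : 𝒴.Y.Opens} (hU : IsAffineOpen U) [Nonempty U]
    {b : Γ(𝒴.fibreProduct, pullback.fst 𝒴.π (quotientMap ρ) ⁻¹ᵁ U)}
    (hb : evalAt 𝒴.genericFibreProduct _ (𝒴.top_le_genericFibreProduct_preimage U) b = 0) :
    IsNilpotent b := by
  let p₁ := pullback.fst 𝒴.π (quotientMap ρ)
  let p₂ := pullback.snd 𝒴.π (quotientMap ρ)
  let W := p₁ ⁻¹ᵁ U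
  -- X and ℂⁿ are affine, so over an affine U the ring of the fibre product is a pushout, generated
  -- by Γ(Y,U) and R.
  have hiso := isIso_pushoutSection_of_isAffineOpen (IsPullback.of_hasPullback 𝒴.π (quotientMap ρ))
    (US := ⊤) (UT := ⊤) (UX := U) (UY := W) le_top le_top (by simp [W, p₁])
    (isAffineOpen_top _) (isAffineOpen_top _) hU
  have hpush := (isIso_pushoutSection_iff (IsPullback.of_hasPullback 𝒴.π (quotientMap ρ))
    (US := ⊤) (UT := ⊤) (UX := U) (UY := W) le_top le_top (by simp [W, p₁])).1 hiso
  let ι : MvPolynomial (Fin n) ℂ →+* Γ(affineSpace n, ⊤) :=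
    (Scheme.ΓSpecIso (.of (MvPolynomial (Fin n) ℂ))).inv.hom
  have hι : Function.Surjective ι :=
    (ConcreteCategory.bijective_of_isIso (Scheme.ΓSpecIso (.of (MvPolynomial (Fin n) ℂ))).inv).2
  let φ : Γ(𝒴.Y, U) →+* Γ(𝒴.fibreProduct, W) := (p₁.appLE U W le_rfl).hom
  let ψ : MvPolynomial (Fin n) ℂ →+* Γ(𝒴.fibreProduct, W) := (p₂.appLE ⊤ W le_top).hom.comp ι
  have hgen : Subring.closure (Set.range φ ∪ Set.range ψ) = ⊤ := by
    have := CommRingCat.closure_range_union_range_eq_top_of_isPushout hpush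
    have hψ : Set.range ψ = Set.range (p₂.appLE ⊤ W le_top).hom :=
      hι.range_comp (p₂.appLE ⊤ W le_top).hom
    rw [hψ]
    exact this
  have hW : ∀ g, W ≤ 𝒴.fibreProductMap g ⁻¹ᵁ W := fun g => by
    rw [← Scheme.Hom.comp_preimage, fibreProductMap_fst]
  let σ : G → Γ(𝒴.fibreProduct, W) →+* Γ(𝒴.fibreProduct, W) := fun g =>
    ((𝒴.fibreProductMap g).appLE W W (hW g)).hom
  have hact : ∀ g r, ((spaceMap ρ g).appLE ⊤ ⊤ le_top).hom (ι r) = ι (actHom ρ g r) := fun g r => by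
    have h := Scheme.ΓSpecIso_inv_naturality (act ρ g).toCommRingCatIso.hom
    have h2 : (spaceMap ρ g).appLE ⊤ ⊤ le_top = (Spec.map (act ρ g).toCommRingCatIso.hom).appTop := by
      simp [spaceMap, Scheme.Hom.appTop, Scheme.Hom.app_eq_appLE]
    rw [h2]
    exact (congrArg (fun f => f.hom r) h).symm
  have hφ : ∀ a, evalAt 𝒴.genericFibreProduct W (𝒴.top_le_genericFibreProduct_preimage U) (φ a) =
      𝒴.sectionToK U a := fun a => by
    rw [← 𝒴.evalAt_fst U a]
    simp only [φ, Scheme.Hom.app_eq_appLE, p₁, W]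
  refine isNilpotent_of_map_eq_zero (ρ := ρ) (φ := φ) (ψ := ψ) (σ := σ) hgen ?_ ?_ ?_
    (j := evalAt 𝒴.genericFibreProduct W (𝒴.top_le_genericFibreProduct_preimage U)) ?_ ?_ ?_ hb
  · intro g a
    have h := Scheme.Hom.appLE_comp_appLE (𝒴.fibreProductMap g) p₁ U W W le_rfl (hW g)
    simp only [p₁, fibreProductMap_fst] at h
    exact congrArg (fun f => f.hom a) h
  · intro g r
    have h := Scheme.Hom.appLE_comp_appLE (𝒴.fibreProductMap g) p₂ ⊤ W W le_top (hW g)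
    simp only [p₂, fibreProductMap_snd] at h
    have h' := Scheme.Hom.appLE_comp_appLE p₂ (spaceMap ρ g) ⊤ ⊤ W le_top le_top
    have h2 := congrArg (fun f => f.hom (ι r)) (h.trans h'.symm)
    change _ = (p₂.appLE ⊤ W le_top).hom (ι (actHom ρ g r))
    rw [← hact]
    exact h2
  · intro r hr
    refine ⟨(𝒴.π.appLE ⊤ U le_top).hom ((Scheme.ΓSpecIso (.of (invariants ρ))).inv.hom ⟨r, hr⟩), ?_⟩
    have h1 := Scheme.Hom.appLE_comp_appLE p₁ 𝒴.π ⊤ U W le_top le_rfl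
    have h2 := Scheme.Hom.appLE_comp_appLE p₂ (quotientMap ρ) ⊤ ⊤ W le_top le_top
    simp only [p₁, p₂, pullback.condition] at h1 h2
    have h3 := congrArg (fun f => f.hom ((Scheme.ΓSpecIso (.of (invariants ρ))).inv.hom ⟨r, hr⟩))
      (h1.trans h2.symm)
    refine h3.trans (congrArg (p₂.appLE ⊤ W le_top).hom ?_)
    have h4 := Scheme.ΓSpecIso_inv_naturality (CommRingCat.ofHom (invariants ρ).val.toRingHom)
    have h5 : (quotientMap ρ).appLE ⊤ ⊤ le_top =
        (Spec.map (CommRingCat.ofHom (invariants ρ).val.toRingHom)).appTop := by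
      simp [quotientMap, Scheme.Hom.appTop, Scheme.Hom.app_eq_appLE]
    rw [h5]
    exact (congrArg (fun f => f.hom ⟨r, hr⟩) h4).symm
  · intro g a
    rw [hφ]
    exact 𝒴.actK_embed g _
  · intro a a' h
    simp only [RingHom.comp_apply, hφ] at h
    exact 𝒴.sectionToK_injective U h
  · intro r
    refine (evalAt_comp 𝒴.genericFibreProduct p₂ ⊤ W le_top
      (𝒴.top_le_genericFibreProduct_preimage U) (ι r)).symm.trans ?_
    rw [← evalAt_genericSpace]
    congr 1
    simp only [p₂, genericFibreProduct_snd]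

/-- Each r is a root of the monic polynomial ∏(X - g·r), whose coefficients are invariant. -/
instance : IsIntegralHom (quotientMap ρ) := by
  unfold quotientMap
  rw [IsIntegralHom.SpecMap_iff]
  intro r
  cases nonempty_fintype G
  let p : Polynomial (MvPolynomial (Fin n) ℂ) :=
    ∏ g, (Polynomial.X - Polynomial.C (actHom ρ g r))
  have hp : ∀ i, p.coeff i ∈ invariants ρ := by
    intro i
    rw [mem_invariants]
    intro h
    have : p.map (actHom ρ h : MvPolynomial (Fin n) ℂ →+* MvPolynomial (Fin n) ℂ) = p := by
      simp only [p, Polynomial.map_prod, Polynomial.map_sub, Polynomial.map_X, Polynomial.map_C]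
      exact Fintype.prod_equiv (Equiv.mulLeft h) _ _ fun g => by simp [actHom_mul]
    have h1 := congrArg (fun q => Polynomial.coeff q i) this
    rw [Polynomial.coeff_map] at h1
    exact h1
  have hlift : p ∈ Polynomial.lifts (invariants ρ).val.toRingHom := by
    rw [Polynomial.lifts_iff_coeff_lifts]
    exact fun i => ⟨⟨_, hp i⟩, rfl⟩
  have hmonic : p.Monic := Polynomial.monic_prod_X_sub_C _ _
  obtain ⟨q, hq, -, hqm⟩ := Polynomial.lifts_and_natDegree_eq_and_monic hlift hmonic
  refine ⟨q, hqm, ?_⟩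
  rw [← Polynomial.eval_map]
  refine (congrArg (Polynomial.eval r) hq).trans ?_
  rw [Polynomial.eval_prod]
  refine Finset.prod_eq_zero (Finset.mem_univ 1) ?_
  simp [actHom_one]

/-- A nonempty open set contains a nonempty basic open set of some function b. Then b is not
nilpotent, so its value at the generic point is nonzero and the generic point lies in that set. -/
lemma denseRange_genericFibreProduct : DenseRange 𝒴.genericFibreProduct := by
  let p₁ := pullback.fst 𝒴.π (quotientMap ρ)
  rw [DenseRange, dense_iff_inter_open]
  rintro V hV ⟨z, hz⟩
  obtain ⟨_, ⟨U, hU, rfl⟩, hzU, -⟩ := 𝒴.Y.isBasis_affineOpens.exists_subset_of_mem_open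
    (Set.mem_univ (p₁ z)) isOpen_univ
  have : Nonempty U := ⟨⟨_, hzU⟩⟩
  have hW : IsAffineOpen (p₁ ⁻¹ᵁ U) := hU.preimage p₁
  obtain ⟨b, hb, hzb⟩ := hW.exists_basicOpen_le (V := ⟨V, hV⟩) ⟨z, hz⟩ hzU
  have hev : evalAt 𝒴.genericFibreProduct _ (𝒴.top_le_genericFibreProduct_preimage U) b ≠ 0 := by
    intro h
    have h1 := 𝒴.isNilpotent_of_evalAt_eq_zero hU h
    have h2 := 𝒴.fibreProduct.basicOpen_eq_bot_of_isNilpotent _ b h1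
    exact (h2 ▸ hzb : z ∈ (⊥ : 𝒴.fibreProduct.Opens))
  let pt : Spec (.of (K n)) := (⊥ : PrimeSpectrum (K n))
  exact ⟨_, hb (top_le_preimage_basicOpen _ _ hev (trivial : pt ∈ ⊤)), pt, rfl⟩

end Resolution
end GConst
end

noncomputable section
namespace GConst

/-! ### Integrality and function field of the reduction, and the generic point of N -/

section FieldPoints

variable {k : Type} [Field k] {Z : Scheme.{0}}

instance (j : Spec (.of k) ⟶ Z) : QuasiCompact j where
  isCompact_preimage _ _ _ := (Set.toFinite _).isCompact

/-- A field-valued point of `Z` is a point of `Z_red`. -/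
def reductionLift (j : Spec (.of k) ⟶ Z) : Spec (.of k) ⟶ reduction Z :=
  IsClosedImmersion.lift (reductionι Z) j (by
    have : (reductionι Z).ker = Z.nilradical := Scheme.IdealSheafData.ker_subschemeι _
    rw [this]
    exact nilradical_le_ker _)

lemma reductionLift_ι (j : Spec (.of k) ⟶ Z) : reductionLift j ≫ reductionι Z = j :=
  IsClosedImmersion.lift_fac _ _ _

lemma denseRange_reductionLift {j : Spec (.of k) ⟶ Z} (hj : DenseRange j) :
    DenseRange (reductionLift j) := by
  intro z
  have hι : Topology.IsInducing (reductionι Z) := (reductionι Z).isEmbedding.isInducing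
  rw [hι.closure_eq_preimage_closure_image, ← Set.range_comp]
  have h : (reductionι Z : reduction Z → Z) ∘ reductionLift j = j := by
    funext x
    rw [Function.comp_apply, ← Scheme.Hom.comp_apply, reductionLift_ι]
  rw [h]
  exact hj _

/-- The closure of the image of a one-point space is irreducible, and Z is reduced. -/
lemma isIntegral_of_denseRange [IsReduced Z] {j : Spec (.of k) ⟶ Z} (hj : DenseRange j) :
    IsIntegral Z := by
  have : IrreducibleSpace Z := by
    rw [irreducibleSpace_def]
    change IsIrreducible Set.univ
    rw [← hj.closure_range, ← Set.image_univ]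
    exact ((IrreducibleSpace.isIrreducible_univ _).image _ j.continuous.continuousOn).closure
  exact isIntegral_of_irreducibleSpace_of_isReduced _

lemma specializes_genericPoint_of_denseRange [IsIntegral Z] {j : Spec (.of k) ⟶ Z}
    (hj : DenseRange j) : j (IsLocalRing.closedPoint k) ⤳ genericPoint Z := by
  rw [specializes_iff_mem_closure]
  have h : Set.range j = {j (IsLocalRing.closedPoint k)} := by
    ext z
    constructor
    · rintro ⟨y, rfl⟩
      rw [Subsingleton.elim y (IsLocalRing.closedPoint k)]
      rfl
    · rintro rfl
      exact ⟨_, rfl⟩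
  rw [← h]
  exact hj _

/-- The embedding of the function field given by a dense field-valued point. -/
def functionFieldTo [IsIntegral Z] (j : Spec (.of k) ⟶ Z) (hj : DenseRange j) :
    Z.functionField ⟶ .of k :=
  Z.presheaf.stalkSpecializes (specializes_genericPoint_of_denseRange hj) ≫
    Scheme.stalkClosedPointTo j

lemma Spec_functionFieldTo [IsIntegral Z] (j : Spec (.of k) ⟶ Z) (hj : DenseRange j) :
    Spec.map (functionFieldTo j hj) ≫ genericInclusion Z = j := by
  refine Eq.trans ?_ (Scheme.Spec_stalkClosedPointTo_fromSpecStalk j)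
  rw [← Scheme.SpecMap_stalkSpecializes_fromSpecStalk
    (specializes_genericPoint_of_denseRange hj), ← Category.assoc]
  exact congrArg (· ≫ _) (Spec.map_comp _ _)

end FieldPoints

namespace Resolution

variable {G : Type*} [CommGroup G] [Finite G] {n : ℕ}
  {ρ : G →* Matrix.GeneralLinearGroup (Fin n) ℂ} (𝒴 : Resolution ρ)

theorem isIntegral_reducedFibreProduct : IsIntegral 𝒴.reducedFibreProduct :=
  isIntegral_of_denseRange (denseRange_reductionLift 𝒴.denseRange_genericFibreProduct)

/-- The generic point of the reduced fibre product. -/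
def genericReduced : Spec (.of (K n)) ⟶ 𝒴.reducedFibreProduct :=
  reductionLift 𝒴.genericFibreProduct

omit [Finite G] in
lemma genericReduced_ι : 𝒴.genericReduced ≫ reductionι _ = 𝒴.genericFibreProduct :=
  reductionLift_ι _

lemma denseRange_genericReduced : DenseRange 𝒴.genericReduced :=
  denseRange_reductionLift 𝒴.denseRange_genericFibreProduct

variable [IsIntegral 𝒴.reducedFibreProduct]

/-- The identification of the function field of the reduced fibre product. -/
def reducedToK : 𝒴.reducedFibreProduct.functionField ⟶ .of (K n) :=
  functionFieldTo 𝒴.genericReduced 𝒴.denseRange_genericReduced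

lemma Spec_reducedToK :
    Spec.map 𝒴.reducedToK ≫ genericInclusion 𝒴.reducedFibreProduct = 𝒴.genericReduced :=
  Spec_functionFieldTo _ _

/-- The image is a subfield of K(ℂⁿ) containing all polynomials, which are pulled back from ℂⁿ. -/
lemma reducedToK_bijective : Function.Bijective 𝒴.reducedToK.hom := by
  refine ⟨RingHom.injective (RingHom.comp (RingHom.id (K n)) 𝒴.reducedToK.hom), ?_⟩
  have hR : ∀ r : MvPolynomial (Fin n) ℂ, ∃ a, 𝒴.reducedToK.hom a = algebraMap _ (K n) r := by
    intro r
    let p := reductionι 𝒴.fibreProduct ≫ pullback.snd 𝒴.π (quotientMap ρ)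
    let b := (p.appLE ⊤ ⊤ le_top).hom ((Scheme.ΓSpecIso (.of (MvPolynomial (Fin n) ℂ))).inv.hom r)
    have hp : 𝒴.genericReduced ≫ p = genericSpace n := by
      simp only [p]
      rw [← Category.assoc, genericReduced_ι, genericFibreProduct_snd]
    refine ⟨(𝒴.reducedFibreProduct.presheaf.germ ⊤ _ trivial).hom b, ?_⟩
    rw [← evalAt_genericSpace]
    refine (evalAt_fromSpecStalk _ 𝒴.reducedToK ⊤ trivial le_top b).symm.trans ?_
    have h1 := evalAt_comp 𝒴.genericReduced p ⊤ ⊤ le_top le_top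
      ((Scheme.ΓSpecIso (.of (MvPolynomial (Fin n) ℂ))).inv.hom r)
    simp only [hp] at h1
    refine Eq.trans ?_ h1.symm
    have h2 := 𝒴.Spec_reducedToK
    unfold genericInclusion at h2
    simp only [h2, b]
  intro x
  obtain ⟨r, s, -, rfl⟩ := IsFractionRing.div_surjective (A := MvPolynomial (Fin n) ℂ) x
  obtain ⟨a, ha⟩ := hR r
  obtain ⟨b, hb⟩ := hR s
  refine ⟨a / b, ?_⟩
  rw [← ha, ← hb]
  exact map_div₀ (RingHom.comp (RingHom.id (K n)) 𝒴.reducedToK.hom) a b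

/-- The generic point of `N`. -/
def genericN : Spec (.of (K n)) ⟶ 𝒴.N :=
  Spec.map 𝒴.reducedToK ≫ (genericInclusion 𝒴.reducedFibreProduct).toNormalization

lemma genericN_normalisationπ :
    𝒴.genericN ≫ normalisationπ 𝒴.reducedFibreProduct = 𝒴.genericReduced := by
  unfold genericN normalisationπ
  rw [Category.assoc, Scheme.Hom.toNormalization_fromNormalization, Spec_reducedToK]

lemma genericN_NtoFibreProduct : 𝒴.genericN ≫ 𝒴.NtoFibreProduct = 𝒴.genericFibreProduct := by
  unfold NtoFibreProduct
  rw [← Category.assoc, genericN_normalisationπ, genericReduced_ι]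

lemma genericN_NtoY : 𝒴.genericN ≫ 𝒴.NtoY = 𝒴.genericY := by
  unfold NtoY
  rw [← Category.assoc, genericN_NtoFibreProduct, genericFibreProduct_fst]

lemma genericN_NtoSpace : 𝒴.genericN ≫ 𝒴.NtoSpace = genericSpace n := by
  unfold NtoSpace
  rw [← Category.assoc, genericN_NtoFibreProduct, genericFibreProduct_snd]

/-- On generic points the claim concerns the function field. As `genericInclusion` and `reductionι`
are monomorphisms, it can be checked in Y ×_X ℂⁿ, where one projection asks that g fix K(Y) and the
other that it act on R by `actHom`. -/
lemma genericN_NMap (g : G) : 𝒴.genericN ≫ 𝒴.NMap g =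
    Spec.map (CommRingCat.ofHom (actK ρ g : K n →+* K n)) ≫ 𝒴.genericN := by
  let Z := 𝒴.reducedFibreProduct
  let γ := reductionMap (𝒴.fibreProductMap g)
  have h1 : 𝒴.genericN ≫ 𝒴.NMap g = Spec.map 𝒴.reducedToK ≫ genericMap γ ≫
      (genericInclusion Z).toNormalization := by
    unfold genericN NMap normalisationMap
    rw [Category.assoc, Scheme.Hom.toNormalization_normalizationDesc]
  have h2 : Spec.map 𝒴.reducedToK ≫ genericMap γ =
      Spec.map (CommRingCat.ofHom (actK ρ g : K n →+* K n)) ≫ Spec.map 𝒴.reducedToK := by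
    have : Mono (genericInclusion Z) := by unfold genericInclusion; infer_instance
    rw [← cancel_mono (genericInclusion Z), Category.assoc, Category.assoc, genericMap_comp,
      Spec_reducedToK, ← Category.assoc, Spec_reducedToK, ← cancel_mono (reductionι _),
      Category.assoc, Category.assoc, reductionMap_ι, genericReduced_ι, ← Category.assoc,
      genericReduced_ι]
    apply pullback.hom_ext
    · rw [Category.assoc, Category.assoc, fibreProductMap_fst, genericFibreProduct_fst]
      unfold genericY
      rw [← Category.assoc, ← Spec.map_comp]
      congr 2
      apply CommRingCat.hom_ext
      exact RingHom.ext fun a => (𝒴.actK_embed g a).symm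
    · rw [Category.assoc, Category.assoc, fibreProductMap_snd, ← Category.assoc,
        genericFibreProduct_snd]
      unfold genericSpace spaceMap
      rw [← Spec.map_comp, ← Spec.map_comp]
      congr 1
      apply CommRingCat.hom_ext
      exact RingHom.ext fun r => (actK_algebraMap ρ g r).symm
  rw [h1, ← Category.assoc, h2, Category.assoc]
  rfl

end Resolution
end GConst
end

noncomputable section
namespace GConst

/-! ### Functions on N as elements of K(ℂⁿ), and the isomorphism -/

section FieldPoints

variable {k : Type} [Field k] {Z : Scheme.{0}}

/-- A function on an integral scheme which vanishes at a dense point is zero. -/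
lemma evalAt_injective_of_denseRange [IsIntegral Z] {j : Spec (.of k) ⟶ Z} (hj : DenseRange j)
    (O : Z.Opens) (e : ⊤ ≤ j ⁻¹ᵁ O) : Function.Injective (evalAt j O e) := by
  rw [injective_iff_map_eq_zero]
  intro a ha
  rw [← basicOpen_eq_bot_iff]
  by_contra hne
  obtain ⟨z, hz⟩ := (Z.basicOpen a).ne_bot_iff_nonempty.1 hne
  obtain ⟨y, hy⟩ := hj.exists_mem_open (Z.basicOpen a).isOpen ⟨z, hz⟩
  have e' : ⊤ ≤ j ⁻¹ᵁ Z.basicOpen a := fun x _ => by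
    rw [Subsingleton.elim x y]
    exact hy
  have h1 := evalAt_res j (Z.basicOpen_le a) e' a
  rw [ha] at h1
  have h2 : IsUnit ((Z.presheaf.map (homOfLE (Z.basicOpen_le a)).op).hom a) :=
    Z.toRingedSpace.isUnit_res_basicOpen a
  have h3 := h2.map (evalAt j (Z.basicOpen a) e')
  rw [h1] at h3
  exact not_isUnit_zero h3

lemma evalAt_Spec_map_bijective {F : CommRingCat.{0}} {τ : F ⟶ .of k}
    (hτ : Function.Bijective τ.hom) (O : (Spec F).Opens) (e : ⊤ ≤ Spec.map τ ⁻¹ᵁ O) :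
    Function.Bijective (evalAt (Spec.map τ) O e) := by
  have : IsIso τ := (ConcreteCategory.isIso_iff_bijective τ).2 hτ
  obtain rfl : O = ⊤ := by
    rw [eq_top_iff]
    intro x _
    obtain ⟨y, rfl⟩ := (Spec.map τ).surjective x
    exact e trivial
  have h : evalAt (Spec.map τ) ⊤ e =
      ((Spec.map τ).appTop ≫ (Scheme.ΓSpecIso (.of k)).hom).hom := by
    unfold evalAt
    simp [Scheme.Hom.appTop, Scheme.Hom.app_eq_appLE]
  have h2 : IsIso ((Spec.map τ).appTop ≫ (Scheme.ΓSpecIso (.of k)).hom) := by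
    rw [Scheme.ΓSpecIso_naturality]
    infer_instance
  rw [h]
  exact ConcreteCategory.bijective_of_isIso _

/-- A function on `X` which is integral over the functions on an affine open subset of `Y` lifts to
the normalisation of `Y` in `X`. -/
lemma exists_toNormalization_appLE_eq {X Y : Scheme.{0}} (f : X ⟶ Y) [QuasiCompact f]
    [QuasiSeparated f] {W : Y.Opens} (hW : IsAffineOpen W) {b : Γ(X, f ⁻¹ᵁ W)}
    (hb : (f.app W).hom.IsIntegralElem b)
    (e : f ⁻¹ᵁ W ≤ f.toNormalization ⁻¹ᵁ f.fromNormalization ⁻¹ᵁ W) :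
    ∃ s, (f.toNormalization.appLE (f.fromNormalization ⁻¹ᵁ W) (f ⁻¹ᵁ W) e).hom s = b := by
  let := (f.app W).hom.toAlgebra
  let x : integralClosure Γ(Y, W) Γ(X, f ⁻¹ᵁ W) := ⟨b, hb⟩
  obtain ⟨s, hs⟩ := (ConcreteCategory.bijective_of_isIso (f.normalizationObjIso hW).hom).2 x
  have h := congrArg (fun g => g.hom s) (f.normalizationObjIso_hom_val hW)
  exact ⟨s, h.symm.trans (congrArg Subtype.val hs)⟩

end FieldPoints

namespace Resolution

variable {G : Type*} [CommGroup G] [Finite G] {n : ℕ}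
  {ρ : G →* Matrix.GeneralLinearGroup (Fin n) ℂ} (𝒴 : Resolution ρ)
  [IsIntegral 𝒴.reducedFibreProduct]

/-- `toNormalization` is dominant, and `reducedToK` is an isomorphism. -/
lemma denseRange_genericN : DenseRange 𝒴.genericN := by
  have : IsIso 𝒴.reducedToK :=
    (ConcreteCategory.isIso_iff_bijective 𝒴.reducedToK).2 𝒴.reducedToK_bijective
  have h := (genericInclusion 𝒴.reducedFibreProduct).toNormalization.denseRange.comp
    (Spec.map 𝒴.reducedToK).surjective.denseRange
    (genericInclusion 𝒴.reducedFibreProduct).toNormalization.continuous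
  exact h

lemma top_le_genericN_preimage (U : 𝒴.Y.Opens) [Nonempty U] :
    ⊤ ≤ 𝒴.genericN ⁻¹ᵁ (𝒴.NtoY ⁻¹ᵁ U) := by
  rw [← Scheme.Hom.comp_preimage, genericN_NtoY]
  exact 𝒴.top_le_genericY_preimage U

/-- The inclusion in `K(ℂⁿ)` of the sections of the pushforward of `𝒪_N`. -/
def evalN (U : 𝒴.Y.Opens) [Nonempty U] : 𝒴.NSec U →+* K n :=
  evalAt 𝒴.genericN (𝒴.NtoY ⁻¹ᵁ U) (𝒴.top_le_genericN_preimage U)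

lemma evalN_injective (U : 𝒴.Y.Opens) [Nonempty U] : Function.Injective (𝒴.evalN U) :=
  evalAt_injective_of_denseRange 𝒴.denseRange_genericN _ _

lemma evalN_res {U V : 𝒴.Y.Opens} [Nonempty U] [Nonempty V] (h : V ≤ U) (s : 𝒴.NSec U) :
    𝒴.evalN V (NSec.res 𝒴 h s) = 𝒴.evalN U s :=
  evalAt_res 𝒴.genericN (𝒴.NtoY.preimage_mono h) (𝒴.top_le_genericN_preimage V) s

lemma evalN_algebraMap (U : 𝒴.Y.Opens) [Nonempty U] (a : Γ(𝒴.Y, U)) :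
    𝒴.evalN U (algebraMap Γ(𝒴.Y, U) (𝒴.NSec U) a) = 𝒴.sectionToK U a := by
  have h := evalAt_comp 𝒴.genericN 𝒴.NtoY U _ le_rfl (𝒴.top_le_genericN_preimage U) a
  rw [← Scheme.Hom.app_eq_appLE] at h
  refine h.symm.trans ?_
  rw [← 𝒴.evalAt_genericY U (𝒴.top_le_genericY_preimage U)]
  congr 1
  simp only [genericN_NtoY]

lemma evalN_smul (U : 𝒴.Y.Opens) [Nonempty U] (a : Γ(𝒴.Y, U)) (s : 𝒴.NSec U) :
    𝒴.evalN U (a • s) = 𝒴.sectionToK U a * 𝒴.evalN U s := by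
  rw [Algebra.smul_def, map_mul, evalN_algebraMap]

lemma evalN_poly (U : 𝒴.Y.Opens) [Nonempty U] (r : MvPolynomial (Fin n) ℂ) (s : 𝒴.NSec U) :
    𝒴.evalN U (r • s) = algebraMap _ (K n) r * 𝒴.evalN U s := by
  rw [Algebra.smul_def, map_mul]
  congr 1
  refine (evalAt_comp 𝒴.genericN 𝒴.NtoSpace ⊤ _ le_top (𝒴.top_le_genericN_preimage U) _).symm.trans
    ?_
  rw [← evalAt_genericSpace]
  congr 1
  simp only [genericN_NtoSpace]

lemma evalN_group (U : 𝒴.Y.Opens) [Nonempty U] (g : G) (s : 𝒴.NSec U) :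
    𝒴.evalN U (𝒴.actNSec g U s) = actK ρ g (𝒴.evalN U s) := by
  have hU : 𝒴.NtoY ⁻¹ᵁ U ≤ 𝒴.NMap g ⁻¹ᵁ 𝒴.NtoY ⁻¹ᵁ U := by
    rw [← Scheme.Hom.comp_preimage, NMap_Y]
  refine (evalAt_comp 𝒴.genericN (𝒴.NMap g) _ _ hU (𝒴.top_le_genericN_preimage U) s).symm.trans ?_
  refine Eq.trans ?_ (evalAt_Spec_map_comp 𝒴.genericN (actK ρ g : K n →+* K n) _
    (𝒴.top_le_genericN_preimage U) (fun x _ => 𝒴.top_le_genericN_preimage U trivial) s)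
  congr 1
  simp only [genericN_NMap]

instance : IsIntegralHom 𝒴.NtoY := by
  unfold NtoY NtoFibreProduct
  infer_instance

/-- Over an affine open subset, the functions on `N` are the elements of `K(ℂⁿ)` which are integral
over the functions on `Y`. -/
theorem mem_range_evalN_iff {U : 𝒴.Y.Opens} (hU : IsAffineOpen U) [Nonempty U] {h : K n} :
    h ∈ (𝒴.evalN U).range ↔ (𝒴.sectionToK U).IsIntegralElem h := by
  have hcomp : (𝒴.evalN U).comp (algebraMap Γ(𝒴.Y, U) (𝒴.NSec U)) = 𝒴.sectionToK U :=
    RingHom.ext (𝒴.evalN_algebraMap U)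
  constructor
  · rintro ⟨s, rfl⟩
    -- N → Y is integral, since the quotient map and the normalisation are.
    have := (𝒴.NtoY.isIntegral_app U hU s).map (𝒴.evalN U)
    exact hcomp ▸ this
  · rintro ⟨p, hp, hph⟩
    let i := genericInclusion 𝒴.reducedFibreProduct
    let q := reductionι 𝒴.fibreProduct ≫ pullback.fst 𝒴.π (quotientMap ρ)
    let W := q ⁻¹ᵁ U
    have hW : IsAffineOpen W := hU.preimage q
    have he : ⊤ ≤ Spec.map 𝒴.reducedToK ⁻¹ᵁ (i ⁻¹ᵁ W) := by
      rw [← Scheme.Hom.comp_preimage, ← Scheme.Hom.comp_preimage, Spec_reducedToK,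
        ← Category.assoc, genericReduced_ι, genericFibreProduct_fst]
      exact 𝒴.top_le_genericY_preimage U
    -- β identifies the functions at the generic point of the reduced fibre product with K(ℂⁿ).
    let β := evalAt (Spec.map 𝒴.reducedToK) (i ⁻¹ᵁ W) he
    have hβ : Function.Bijective β := evalAt_Spec_map_bijective 𝒴.reducedToK_bijective _ _
    have hβN : ∀ s : 𝒴.NSec U, 𝒴.evalN U s = β ((i.toNormalization.appLE (i.fromNormalization ⁻¹ᵁ W)
        (i ⁻¹ᵁ W) (by simp [← Scheme.Hom.comp_preimage])).hom s) := fun s =>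
      evalAt_comp (Spec.map 𝒴.reducedToK) i.toNormalization _ (i ⁻¹ᵁ W) _ he s
    have hβY : (β.comp (i.app W).hom).comp (q.app U).hom = 𝒴.sectionToK U := by
      ext a
      have h1 := evalAt_comp (Spec.map 𝒴.reducedToK) (i ≫ q) U (i ⁻¹ᵁ W) le_rfl he a
      have h0 : (i ≫ q).appLE U (i ⁻¹ᵁ W) le_rfl = q.app U ≫ i.app W :=
        (Scheme.Hom.app_eq_appLE (i ≫ q)).symm.trans (Scheme.Hom.comp_app _ _ _)
      rw [h0] at h1
      refine h1.symm.trans ?_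
      rw [← 𝒴.evalAt_genericY U (𝒴.top_le_genericY_preimage U)]
      have h2 : Spec.map 𝒴.reducedToK ≫ i ≫ q = 𝒴.genericY := by
        rw [← Category.assoc, Spec_reducedToK, ← Category.assoc, genericReduced_ι,
          genericFibreProduct_fst]
      congr 1
      simp only [h2]
    obtain ⟨b, rfl⟩ := hβ.2 h
    -- The equation of h over Γ(Y,U) is pushed forward to the functions on the reduced fibre product
    -- over U. Being integral over these, b lifts to the normalisation.
    have hb : (i.app W).hom.IsIntegralElem b := by
      refine ⟨p.map (q.app U).hom, hp.map _, hβ.1 ?_⟩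
      rw [map_zero, Polynomial.eval₂_map, Polynomial.hom_eval₂, ← hph, ← hβY]
      rfl
    obtain ⟨s, hs⟩ := exists_toNormalization_appLE_eq i hW hb
      (by simp [← Scheme.Hom.comp_preimage])
    exact ⟨s, (hβN s).trans (congrArg β hs)⟩

/-- The functions on `N` are the elements of `K(ℂⁿ)` which are integral in codimension one. -/
theorem mem_range_evalN_iff_isRegularOn {U : 𝒴.Y.Opens} [Nonempty U] {h : K n} :
    h ∈ (𝒴.evalN U).range ↔ 𝒴.IsRegularOn U h := by
  constructor
  · rintro ⟨s, rfl⟩ P hP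
    obtain ⟨_, ⟨V, hV, rfl⟩, hPV, hVU⟩ := 𝒴.Y.isBasis_affineOpens.exists_subset_of_mem_open
      hP U.isOpen
    have : Nonempty V := ⟨⟨_, hPV⟩⟩
    rw [← 𝒴.evalN_res hVU]
    exact (𝒴.isIntegralElem_iff_isRegularOn hV).1 ((𝒴.mem_range_evalN_iff hV).1 ⟨_, rfl⟩) P hPV
  · intro hh
    let ι := {V : 𝒴.Y.Opens // V ≤ U ∧ IsAffineOpen V ∧ Nonempty V}
    have hne : ∀ V : ι, Nonempty V.1 := fun V => V.2.2.2
    have hex : ∀ V : ι, ∃ s : 𝒴.NSec V.1, 𝒴.evalN V.1 s = h := fun V =>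
      (𝒴.mem_range_evalN_iff V.2.2.1).2 ((𝒴.isIntegralElem_iff_isRegularOn V.2.2.1).2
        (hh.mono V.2.1))
    choose sf hsf using hex
    -- The lifts over affine opens agree on overlaps because they have the same value h at the dense
    -- generic point of N.
    obtain ⟨s, hs, -⟩ := 𝒴.N.sheaf.existsUnique_gluing' (fun V : ι => 𝒴.NtoY ⁻¹ᵁ V.1) (𝒴.NtoY ⁻¹ᵁ U)
      (fun V => homOfLE (𝒴.NtoY.preimage_mono V.2.1)) (by
        intro x hx
        obtain ⟨_, ⟨V, hV, rfl⟩, hxV, hVU⟩ := 𝒴.Y.isBasis_affineOpens.exists_subset_of_mem_open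
          (show 𝒴.NtoY x ∈ (U : Set 𝒴.Y) from hx) U.isOpen
        exact TopologicalSpace.Opens.mem_iSup.2 ⟨⟨V, hVU, hV, ⟨⟨_, hxV⟩⟩⟩, hxV⟩) sf (by
        intro V V'
        have hV : ⊤ ≤ 𝒴.genericN ⁻¹ᵁ (𝒴.NtoY ⁻¹ᵁ V.1 ⊓ 𝒴.NtoY ⁻¹ᵁ V'.1) := fun x _ =>
          ⟨𝒴.top_le_genericN_preimage V.1 trivial, 𝒴.top_le_genericN_preimage V'.1 trivial⟩
        refine evalAt_injective_of_denseRange 𝒴.denseRange_genericN _ hV ?_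
        exact (evalAt_res 𝒴.genericN inf_le_left hV (sf V)).trans ((hsf V).trans
          ((evalAt_res 𝒴.genericN inf_le_right hV (sf V')).trans (hsf V')).symm))
    obtain ⟨_, ⟨V, hV, rfl⟩, hxV, hVU⟩ := 𝒴.Y.isBasis_affineOpens.exists_subset_of_mem_open
      (Classical.arbitrary U).2 U.isOpen
    let W : ι := ⟨V, hVU, hV, ⟨⟨_, hxV⟩⟩⟩
    refine ⟨s, ?_⟩
    rw [← hsf W, ← hs W]
    exact (𝒴.evalN_res W.2.1 s).symm

/-- The sections of the pushforward of `𝒪_N` as sections of the constant sheaf `K(ℂⁿ)`. -/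
def sectionN (U : 𝒴.Y.Opens) : 𝒴.NSec U →ₗ[Γ(𝒴.Y, U)] 𝒴.KSec U where
  toFun s := (⟨fun y => haveI : Nonempty U := ⟨y⟩; 𝒴.evalN U s,
    IsLocallyConstant.of_constant _ fun _ _ => rfl⟩ : LocallyConstant U (K n))
  map_add' s t := LocallyConstant.ext fun y => map_add (haveI : Nonempty U := ⟨y⟩; 𝒴.evalN U) s t
  map_smul' a s := LocallyConstant.ext fun y => haveI : Nonempty U := ⟨y⟩; 𝒴.evalN_smul U a s

omit [Finite G] in
lemma subsingleton_NSec {U : 𝒴.Y.Opens} (h : IsEmpty U) : Subsingleton (𝒴.NSec U) := by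
  have hU : U = ⊥ := by
    ext x
    exact ⟨fun hx => h.elim ⟨x, hx⟩, fun hx => hx.elim⟩
  subst hU
  exact inferInstanceAs (Subsingleton Γ(𝒴.N, ⊥))

lemma sectionN_injective (U : 𝒴.Y.Opens) : Function.Injective (𝒴.sectionN U) := by
  intro s t h
  rcases isEmpty_or_nonempty U with hU | hU
  · exact (𝒴.subsingleton_NSec hU).elim _ _
  · exact 𝒴.evalN_injective U (𝒴.constSec_injective U h)

lemma range_sectionN (hρ : Function.Injective ρ) (U : 𝒴.Y.Opens) :
    LinearMap.range (𝒴.sectionN U) = 𝒴.canonicalFamily U := by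
  ext s
  rcases isEmpty_or_nonempty U with hU | hU
  -- Over the empty set there is no generic point to evaluate at, but both sides are zero.
  · have : s = 0 := LocallyConstant.ext fun y => hU.elim y
    rw [this]
    exact ⟨fun _ => zero_mem _, fun _ => zero_mem _⟩
  · rw [𝒴.mem_canonicalFamily_iff hρ]
    constructor
    · rintro ⟨t, rfl⟩
      exact ⟨_, 𝒴.mem_range_evalN_iff_isRegularOn.1 ⟨t, rfl⟩, rfl⟩
    · rintro ⟨h, hh, rfl⟩
      obtain ⟨t, rfl⟩ := 𝒴.mem_range_evalN_iff_isRegularOn.2 hh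
      exact ⟨t, rfl⟩

/-- The pushforward of `𝒪_N` is the canonical family. -/
def canonicalIso (hρ : Function.Injective ρ) : 𝒴.CanonicalIso where
  equiv U := (LinearEquiv.ofInjective (𝒴.sectionN U) (𝒴.sectionN_injective U)).trans
    (LinearEquiv.ofEq _ _ (𝒴.range_sectionN hρ U))
  equiv_res {U V} h s := LocallyConstant.ext fun y => by
    have : Nonempty V := ⟨y⟩
    have : Nonempty U := ⟨⟨y.1, h y.2⟩⟩
    exact 𝒴.evalN_res h s
  equiv_poly U r s := LocallyConstant.ext fun y => by
    have : Nonempty U := ⟨y⟩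
    exact 𝒴.evalN_poly U r s
  equiv_group U g s := LocallyConstant.ext fun y => by
    have : Nonempty U := ⟨y⟩
    exact 𝒴.evalN_group U g s

end Resolution
end GConst

theorem proposition3p8 {G : Type*} [CommGroup G] [Finite G] {n : ℕ}
    (ρ : G →* Matrix.GeneralLinearGroup (Fin n) ℂ) (hρ : Function.Injective ρ)
    (𝒴 : GConst.Resolution ρ) :
    ∃ _ : AlgebraicGeometry.IsIntegral 𝒴.reducedFibreProduct, Nonempty 𝒴.CanonicalIso :=
  haveI := 𝒴.isIntegral_reducedFibreProduct
  ⟨this, ⟨𝒴.canonicalIso hρ⟩⟩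

end
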